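/- Fix an integer $e\ge 2$. We write $x\equiv_e y$ for $e\mid x-y$, and $x<_e y$ for $x<y$ and $x\equiv_e y$. **Partitions.** For a partition $\lambda=(\lambda_1\ge\lambda_2\ge\cdots)$ let $\lambda'$ be its conjugate and $\beta(\lambda)=\{\lambda_i-i\mid i\ge 1\}\subset\mathbb Z$ its set of beads. Integers are positions on an abacus with $e$ runners, the residue classes modulo $e$, and smaller integers lie higher. For $b\in\mathbb Z$ let $\mathrm{wt}_\lambda(b)=|\{x<_e b\mid x\notin\beta(\lambda)\}|$. The $e$-weight of $\lambda$ is $\sum_{b\in\beta(\lambda)}\mathrm{wt}_\lambda(b)$. The $e$-core of $\lambda$ is the partition obtained by sliding all beads up their runners as far as possible. Two partitions are in the same block if they have the same $e$-core and the same $e$-weight. For $0\le j<e$ the $j$-th component of the $e$-quotient of $\lambda$ is the partition whose parts are the nonzero $\mathrm{wt}_\lambda(b)$ with $b\in\beta(\lambda)$, $b\equiv_e j$. We call $\lambda$ *hook-quotient* if every component $\nu$ of its $e$-quotient is a hook, i.e. $\nu_2\le 1$. We call $\lambda$ *$e$-regular* if no $e$ of its nonzero parts are equal. **Labels.** Let $\lambda$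 have $e$-weight $w$. Its bead movements are the $w$ pairs $(b;q)=(b;b-ie)$ with $b\in\beta(\lambda)$ and $0\le i<\mathrm{wt}_\lambda(b)$. List them as $(b_1;q_1)<\dots<(b_w;q_w)$, where $(b;q)<(b';q')$ iff $q<q'$, or $q=q'$ and $b<b'$. Put $$\mathbf z(\lambda)=(z_1,\dots,z_w)\in\mathbb Z^w,\qquad z_i=|\{y\in\mathbb Z\mid q_i-e<y\le q_i,\ y\notin\beta(\lambda)\}|.$$ We call $\lambda$ *$0$-increasing* if $z_1\le z_2\le\dots\le z_w$. **Parallelotopes.** Let $\lambda$ be hook-quotient of $e$-weight $w$ and let $\mathbf e_1,\dots,\mathbf e_w$ be the standard basis of $\mathbb Z^w$. For each residue class $j$ modulo $e$ containing some $q_i$, write $\{i\mid q_i\equiv_e j\}=\{i_1<\dots<i_r\}$ and $l=\min\{s\mid b_{i_s}=b_{i_r}\}$, and define $$\epsilon^\lambda_{i_\gamma}=\begin{cases}\mathbf e_{i_\gamma}-\mathbf e_{i_{\gamma+1}}&\text{if }\gamma<l,\\ \mathbf e_{i_\gamma}&\text{if }\gamma=l,\\ \mathbf e_{i_\gamma}-\mathbf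 e_{i_{\gamma-1}}&\text{if }\gamma>l.\end{cases}$$ The vectors $\epsilon^\lambda_1,\dots,\epsilon^\lambda_w$ form a basis of $\mathbb Z^w$. Let $\Pi(\lambda)=\{\mathbf z(\lambda)+\sum_{a\in\Gamma}\epsilon^\lambda_a\mid\Gamma\subseteq\{1,\dots,w\}\}$. If $\mathbf z(\mu)=\mathbf z(\lambda)+\sum_{a\in\Gamma}\epsilon^\lambda_a\in\Pi(\lambda)$, put $d_\lambda(\mu)=|\Gamma|$. **The Mullineux–Kleshchev involution.** A bead $x\in\beta(\lambda)$ is removable if $x-1\notin\beta(\lambda)$. A removable bead $x$ is normal if for all $y$ with $x<_e y$ the number of $t\in\beta(\lambda)$ with $x<_e t\le y$ and $t-1\notin\beta(\lambda)$ is at least the number of $t\notin\beta(\lambda)$ with $x<_e t\le y$ and $t-1\in\beta(\lambda)$. For $a\in\mathbb Z/e\mathbb Z$, if $\lambda$ has a normal bead in the residue class $a$, then $\tilde E_a(\lambda)$ is the partition obtained from $\lambda$ by moving the smallest such bead $x$ to $x-1$; otherwise $\tilde E_a(\lambda)=0$. For an $e$-regular partition $\mu$, the image $\mu^*$ is the unique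 partition $\nu$ for which there are $n\ge 0$ and $a_1,\dots,a_n\in\mathbb Z/e\mathbb Z$ with $\tilde E_{a_n}\cdots\tilde E_{a_1}(\mu)=\emptyset$ and $\tilde E_{-a_n}\cdots\tilde E_{-a_1}(\nu)=\emptyset$. **Statement.** Let $\lambda$ be a hook-quotient partition and let $\mu$ be an $e$-regular $0$-increasing partition in the same block, of $e$-weight $w$. Then $\mathbf z(\mu)\in\Pi(\lambda)$ if and only if $\mathbf z(\mu^*)\in\Pi(\lambda')$, and in that case $$d_\lambda(\mu)+d_{\lambda'}(\mu^*)=w.$$ -/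

import Mathlib

/-!
Partitions are Mathlib's `YoungDiagram`s: `lam.rowLen i` is the `(i+1)`-st part and
`lam.transpose` is the conjugate partition.  Throughout, `e : ℕ` is the number of runners.
-/

noncomputable section

namespace Abacus

open Classical

/-- The set of beta-numbers `{lam_1 - 1, lam_2 - 2, …}` (rows are indexed from `0` here). -/
def betaSet (lam : YoungDiagram) : Set ℤ :=
  {b | ∃ i : ℕ, b = (lam.rowLen i : ℤ) - ((i : ℤ) + 1)}

/-- `wt e lam b` is the number of unoccupied positions above `b` on the runner of `b`. -/
def wt (e : ℕ) (lam : YoungDiagram) (b : ℤ) : ℕ :=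
  {x : ℤ | x < b ∧ x ≡ b [ZMOD e] ∧ x ∉ betaSet lam}.ncard

/-! ### Bead movements -/

/-- The set of bead movements `(b; q)`, with `b` a bead and `q = b - i e`, `0 ≤ i < wt b`.
The movement `(b; q)` is stored as the element `(q, b)` of the lexicographic product, so that
the linear order of `ℤ ×ₗ ℤ` is: first compare the `q`, then the `b`. -/
def beadMovementSet (e : ℕ) (lam : YoungDiagram) : Set (ℤ ×ₗ ℤ) :=
  {m | ∃ b ∈ betaSet lam, ∃ i : ℕ, i < wt e lam b ∧ m = toLex (b - (i : ℤ) * (e : ℤ), b)}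

theorem mem_betaSet_of_lt (lam : YoungDiagram) {x : ℤ} (hx : x < -(lam.colLen 0 : ℤ)) :
    x ∈ betaSet lam := by
  refine ⟨(-x - 1).toNat, ?_⟩
  have h0 : lam.rowLen (-x - 1).toNat = 0 := by
    by_contra h
    have h1 : ((-x - 1).toNat, 0) ∈ lam := YoungDiagram.mem_iff_lt_rowLen.2 (Nat.pos_of_ne_zero h)
    have h2 := YoungDiagram.mem_iff_lt_colLen.1 h1
    omega
  rw [h0]
  omega

theorem le_of_mem_betaSet (lam : YoungDiagram) {x : ℤ} (hx : x ∈ betaSet lam) :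
    x ≤ lam.rowLen 0 := by
  obtain ⟨i, rfl⟩ := hx
  have := lam.rowLen_anti 0 i (Nat.zero_le i)
  omega

theorem beadMovementSet_finite (e : ℕ) (lam : YoungDiagram) :
    (beadMovementSet e lam).Finite := by
  have hS : (Set.Icc (-(lam.colLen 0 : ℤ)) (lam.rowLen 0)).Finite := Set.finite_Icc _ _
  refine (hS.biUnion (t := fun b => (fun i : ℕ => (toLex (b - (i : ℤ) * (e : ℤ), b) : ℤ ×ₗ ℤ)) ''
    {i | i < wt e lam b}) fun b _ => (Set.finite_lt_nat _).image _).subset ?_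
  rintro m ⟨b, hb, i, hi, rfl⟩
  refine Set.mem_biUnion (x := b) ⟨?_, le_of_mem_betaSet lam hb⟩ ⟨i, hi, rfl⟩
  have hne : {x : ℤ | x < b ∧ x ≡ b [ZMOD e] ∧ x ∉ betaSet lam}.Nonempty :=
    Set.nonempty_of_ncard_ne_zero (by unfold wt at hi; omega)
  obtain ⟨x, hxb, -, hx⟩ := hne
  by_contra h
  exact hx (mem_betaSet_of_lt lam (by omega))

/-- The bead movements, as a finite linearly ordered set. -/
def beadMovements (e : ℕ) (lam : YoungDiagram) : Finset (ℤ ×ₗ ℤ) :=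
  (beadMovementSet_finite e lam).toFinset

/-- The `e`-weight: the number of bead movements, i.e. the sum of `wt b` over all beads `b`. -/
def weight (e : ℕ) (lam : YoungDiagram) : ℕ := (beadMovements e lam).card

/-- The bead movements in increasing order, indexed by `Fin w` with `w` the `e`-weight. -/
def movement (e : ℕ) (lam : YoungDiagram) (i : Fin (weight e lam)) : ℤ ×ₗ ℤ :=
  (beadMovements e lam).orderEmbOfFin rfl i

/-- The starting position `q` of the `i`-th bead movement `(b; q)`. -/
def startPos (e : ℕ) (lam : YoungDiagram) (i : Fin (weight e lam)) : ℤ :=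
  (ofLex (movement e lam i)).1

/-- The bead `b` of the `i`-th bead movement `(b; q)`. -/
def bead (e : ℕ) (lam : YoungDiagram) (i : Fin (weight e lam)) : ℤ :=
  (ofLex (movement e lam i)).2

/-! ### The label of a partition -/

/-- The number of unoccupied positions in the interval `(x - e, x]`. -/
def gapCount (e : ℕ) (lam : YoungDiagram) (x : ℤ) : ℕ :=
  {y : ℤ | x - e < y ∧ y ≤ x ∧ y ∉ betaSet lam}.ncard

/-- The vector `z(lam)` in `ℤ^w`, where `w` is the `e`-weight of `lam`. -/
def z (e : ℕ) (lam : YoungDiagram) : Fin (weight e lam) → ℤ :=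
  fun i => (gapCount e lam (startPos e lam i) : ℤ)

/-- `z(lam)` as a list of length `w`.  Lists are used to compare vectors attached to
different partitions: equal lists means equal `e`-weights and equal vectors. -/
def zList (e : ℕ) (lam : YoungDiagram) : List ℤ := List.ofFn (z e lam)

/-- `lam` is `m`-increasing: consecutive entries of `z(lam)` increase by at least `m`. -/
def IsIncreasing (e : ℕ) (m : ℤ) (lam : YoungDiagram) : Prop :=
  ∀ i j : Fin (weight e lam), (j : ℕ) = (i : ℕ) + 1 → m ≤ z e lam j - z e lam i

/-! ### Quotients, cores and blocks -/

/-- The beads of positive weight. -/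
def activeBeads (e : ℕ) (lam : YoungDiagram) : Finset ℤ :=
  (beadMovements e lam).image fun m => (ofLex m).2

/-- The nonzero weights of the beads on runner `j`, in weakly decreasing order. -/
def quotientParts (e : ℕ) (lam : YoungDiagram) (j : ℤ) : List ℕ :=
  (((activeBeads e lam).filter fun b => b ≡ j [ZMOD e]).val.map (wt e lam)).sort (· ≥ ·)

theorem quotientParts_sorted (e : ℕ) (lam : YoungDiagram) (j : ℤ) :
    (quotientParts e lam j).SortedGE :=
  (Multiset.pairwise_sort _ _).sortedGE

/-- The component of the `e`-quotient of `lam` that is read off from runner `j`. -/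
def eQuotient (e : ℕ) (lam : YoungDiagram) (j : ℤ) : YoungDiagram :=
  YoungDiagram.ofRowLens (quotientParts e lam j) (quotientParts_sorted e lam j)

/-- A hook is a partition whose second part is at most `1` (the empty partition is a hook). -/
def IsHook (lam : YoungDiagram) : Prop := lam.rowLen 1 ≤ 1

/-- Every component of the `e`-quotient is a hook. -/
def IsHookQuotient (e : ℕ) (lam : YoungDiagram) : Prop :=
  ∀ j : ℤ, 0 ≤ j → j < e → IsHook (eQuotient e lam j)

/-- `mu` is obtained from `lam` by moving a bead from `x` to the unoccupied position `y`. -/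
def MoveBead (lam mu : YoungDiagram) (x y : ℤ) : Prop :=
  x ∈ betaSet lam ∧ y ∉ betaSet lam ∧ betaSet mu = insert y (betaSet lam \ {x})

/-- `kap` is the `e`-core of `lam`: it is reached from `lam` by sliding beads up their runners,
one step at a time, and no further slide is possible. -/
def IsCoreOf (e : ℕ) (kap lam : YoungDiagram) : Prop :=
  Relation.ReflTransGen (fun al be => ∃ x : ℤ, MoveBead al be x (x - e)) lam kap ∧
    ∀ x ∈ betaSet kap, x - e ∈ betaSet kap

/-- Same `e`-weight and same `e`-core. -/
def SameBlock (e : ℕ) (lam mu : YoungDiagram) : Prop :=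
  weight e lam = weight e mu ∧ ∃ kap, IsCoreOf e kap lam ∧ IsCoreOf e kap mu

/-- No `e` consecutive parts are equal and nonzero. -/
def IsRegular (e : ℕ) (lam : YoungDiagram) : Prop :=
  ¬ ∃ i : ℕ, lam.rowLen i ≠ 0 ∧ ∀ k : ℕ, k < e → lam.rowLen (i + k) = lam.rowLen i

/-! ### Modified basis vectors and parallelotopes -/

/-- The indices of the bead movements on the same runner as the `i`-th one. -/
def runnerIdx (e : ℕ) (lam : YoungDiagram) (i : Fin (weight e lam)) :
    Finset (Fin (weight e lam)) :=
  Finset.univ.filter fun k => startPos e lam k ≡ startPos e lam i [ZMOD e]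

theorem runnerIdx_nonempty (e : ℕ) (lam : YoungDiagram) (i : Fin (weight e lam)) :
    (runnerIdx e lam i).Nonempty :=
  ⟨i, by simp [runnerIdx]⟩

/-- The index of the last bead movement on the runner of the `i`-th one. -/
def lastIdx (e : ℕ) (lam : YoungDiagram) (i : Fin (weight e lam)) : Fin (weight e lam) :=
  (runnerIdx e lam i).max' (runnerIdx_nonempty e lam i)

/-- The bead movements on the runner of the `i`-th one that belong to the same bead as the
last of them. -/
def lastBeadIdx (e : ℕ) (lam : YoungDiagram) (i : Fin (weight e lam)) :
    Finset (Fin (weight e lam)) :=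
  (runnerIdx e lam i).filter fun k => bead e lam k = bead e lam (lastIdx e lam i)

theorem lastBeadIdx_nonempty (e : ℕ) (lam : YoungDiagram) (i : Fin (weight e lam)) :
    (lastBeadIdx e lam i).Nonempty :=
  ⟨lastIdx e lam i, Finset.mem_filter.2
    ⟨Finset.max'_mem _ (runnerIdx_nonempty e lam i), rfl⟩⟩

/-- The index `i_l` on the runner of the `i`-th bead movement. -/
def pivot (e : ℕ) (lam : YoungDiagram) (i : Fin (weight e lam)) : Fin (weight e lam) :=
  (lastBeadIdx e lam i).min' (lastBeadIdx_nonempty e lam i)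

theorem pivot_mem (e : ℕ) (lam : YoungDiagram) (i : Fin (weight e lam)) :
    pivot e lam i ∈ runnerIdx e lam i :=
  (Finset.mem_filter.1 (Finset.min'_mem _ (lastBeadIdx_nonempty e lam i))).1

/-- For `i` before the pivot: the next index on the same runner. -/
def nextIdx (e : ℕ) (lam : YoungDiagram) (i : Fin (weight e lam)) (h : i < pivot e lam i) :
    Fin (weight e lam) :=
  ((runnerIdx e lam i).filter fun k => i < k).min'
    ⟨pivot e lam i, Finset.mem_filter.2 ⟨pivot_mem e lam i, h⟩⟩

/-- For `i` after the pivot: the previous index on the same runner. -/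
def prevIdx (e : ℕ) (lam : YoungDiagram) (i : Fin (weight e lam)) (h : pivot e lam i < i) :
    Fin (weight e lam) :=
  ((runnerIdx e lam i).filter fun k => k < i).max'
    ⟨pivot e lam i, Finset.mem_filter.2 ⟨pivot_mem e lam i, h⟩⟩

/-- The modified basis vectors of `lam` (meant for hook-quotient `lam`). -/
def eps (e : ℕ) (lam : YoungDiagram) (i : Fin (weight e lam)) : Fin (weight e lam) → ℤ :=
  if h : i < pivot e lam i then Pi.single i 1 - Pi.single (nextIdx e lam i h) 1
  else if h : pivot e lam i < i then Pi.single i 1 - Pi.single (prevIdx e lam i h) 1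
  else Pi.single i 1

/-- The vertex `z(lam) + ∑_{a ∈ G} eps_a` of the parallelotope, as a list of length `w`. -/
def vertex (e : ℕ) (lam : YoungDiagram) (G : Finset (Fin (weight e lam))) : List ℤ :=
  List.ofFn (z e lam + ∑ a ∈ G, eps e lam a)

/-- The parallelotope of `lam`, anchored at `z(lam)`. -/
def parallelotope (e : ℕ) (lam : YoungDiagram) : Set (List ℤ) :=
  Set.range (vertex e lam)

/-- `dist e lam mu = |G|` if `z(mu) = z(lam) + ∑_{a ∈ G} eps_a`
(`G` is unique, since the `eps_a` form a basis), and `0` if there is no such `G`. -/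
def dist (e : ℕ) (lam mu : YoungDiagram) : ℕ :=
  if h : ∃ G, vertex e lam G = zList e mu then h.choose.card else 0

/-! ### The Mullineux-Kleshchev map -/

/-- A bead at `x` is removable if the preceding position is unoccupied. -/
def IsRemovable (lam : YoungDiagram) (x : ℤ) : Prop :=
  x ∈ betaSet lam ∧ x - 1 ∉ betaSet lam

/-- A removable bead at `x` is normal if for every position `y` below `x` on its runner, among
the `t` with `x < t ≤ y` on the runner there are at least as many `t` carrying a removable bead
as there are `t` with an addable bead at `t - 1`. -/
def IsNormal (e : ℕ) (lam : YoungDiagram) (x : ℤ) : Prop :=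
  IsRemovable lam x ∧ ∀ y : ℤ, x < y → y ≡ x [ZMOD e] →
    {t : ℤ | x < t ∧ t ≤ y ∧ t ≡ x [ZMOD e] ∧ t ∉ betaSet lam ∧ t - 1 ∈ betaSet lam}.ncard ≤
    {t : ℤ | x < t ∧ t ≤ y ∧ t ≡ x [ZMOD e] ∧ t ∈ betaSet lam ∧ t - 1 ∉ betaSet lam}.ncard

/-- Kashiwara's operator `E_a` sends `lam` to the partition `mu` (and not to `0`): `mu` is obtained
by moving the top normal bead on runner `a` to the preceding position. -/
def KashiwaraE (e : ℕ) (a : ZMod e) (lam mu : YoungDiagram) : Prop :=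
  ∃ x : ℤ, (x : ZMod e) = a ∧ IsNormal e lam x ∧
    (∀ x' : ℤ, (x' : ZMod e) = a → IsNormal e lam x' → x ≤ x') ∧ MoveBead lam mu x (x - 1)

/-- Kleshchev's rule: if a path of Kashiwara operators `E_{a_1}, …, E_{a_n}` leads from `mu` to the
empty partition, and `E_{-a_1}, …, E_{-a_n}` leads from `nu` to the empty partition, then `nu` is
the image of `mu`. -/
inductive MullineuxPair (e : ℕ) : YoungDiagram → YoungDiagram → Prop
  | empty : MullineuxPair e ⊥ ⊥
  | step (a : ZMod e) (mu nu mu' nu' : YoungDiagram) :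
      KashiwaraE e a mu mu' → KashiwaraE e (-a) nu nu' → MullineuxPair e mu' nu' →
      MullineuxPair e mu nu

/-- The Mullineux-Kleshchev map on `e`-regular partitions, where the `nu` below exists, is unique
and does not depend on the path; the value `⊥` on all other partitions is a convention. -/
def mullineux (e : ℕ) (mu : YoungDiagram) : YoungDiagram :=
  if h : ∃ nu, MullineuxPair e mu nu then h.choose else ⊥

end Abacus

end

/-! The theorem compares two dualities, one for parallelotopes and one for labels. Both have the
form: reverse the list and replace every entry `v` by `e - v`.

Parallelotopes. If `lam` is hook-quotient, at most one bead movement starts at each position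
(`IsHookQuotient.mult_le_one`), so coordinates can be indexed by starting positions. The map `x ↦ e
- 1 - x` carries the starting positions of `lam` to those of its conjugate and matches the modified
basis vectors (`epsAt_conj`). The sum of all basis vectors, evaluated at `y`, is `ch B y - ch B (y -
e)` (`sum_epsAt`), which is exactly the change of the gap count from `y` to `y - 1`. Hence the
vertex opposite to the anchor of `lam` is dual to the anchor of the conjugate, and a set of basis
vectors corresponds to the complementary set (`IsVertex.conj`). The distance is well defined because
a linear functional is one on every basis vector (`IsVertex.unique`).

Labels. It remains to see that the label of the Mullineux image is the dual of the label of a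
regular 0-increasing partition (`zList_mullineux`). Bead sets are put into classes `Cls e D ℓ`: the
runners have levels `D` (this fixes the core), gap counts increase along the starting positions, and
`ℓ v` movements have gap count `v`. Four facts are used.

Performing as many good moves of colour `a` as the level of runner `a` exceeds that of runner `a -
1` exchanges these levels and keeps `ℓ` and monotonicity; the same holds backwards (`Cls.ep`,
`Cls.of_ep`). These reflections and translations connect all level functions (`lev_induction`).

A class has at most one member (`cls_unique`). By the reflections one core is enough, and on a well
separated core the members must have columns as quotients, of lengths given by `ℓ`.

Parallel sequences of good moves with opposite colours are compatible (`matched`), so the image does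
not depend on the path. This is a confluence argument: two good moves of different colours either
commute or satisfy a quartic relation between adjacent colours, and the largest heights of the
signatures, which agree on both sides, detect which relation applies.

For `ℓ` supported in `1, …, e - 1`, members of `(D, ℓ)` and of the dual class are matched
(`hasPair`). Induct on the support: on a core where only the runners `v - 1` and `v` are close, `ℓ
v` good moves of colour `v` lead to a class with `ℓ v` replaced by zero, and `ℓ v` moves of colour
`-v` do the same on the dual side.

For `e = 2` each colour is its own negative and there are not enough colours for the adjacency
argument. There the Mullineux map is the identity on regular partitions, and all labels of regular
0-increasing partitions consist of ones. -/

noncomputable section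

namespace Abacus

open Classical

/-! ### Bead sets of arbitrary charge -/

/-- A set of beads: all small positions are occupied and all large ones are not. -/
def Maya (B : Set ℤ) : Prop := (∃ lo, ∀ x < lo, x ∈ B) ∧ ∃ hi, ∀ x ≥ hi, x ∉ B

/-- The indicator function of a set of beads. -/
def ch (B : Set ℤ) (x : ℤ) : ℤ := if x ∈ B then 1 else 0

/-- The number of beads at or below `x` on its runner. -/
def nb (e : ℕ) (B : Set ℤ) (x : ℤ) : ℤ := ({i : ℕ | x + e * i ∈ B}.ncard : ℤ)

/-- The number of gaps strictly above `x` on its runner. -/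
def ng (e : ℕ) (B : Set ℤ) (x : ℤ) : ℤ := ({i : ℕ | x - e * (i + 1) ∉ B}.ncard : ℤ)

/-- The number of bead movements starting at `x`. -/
def mult (e : ℕ) (B : Set ℤ) (x : ℤ) : ℤ := min (nb e B x) (ng e B x)

/-- The level of the runner of `x`, relative to `x`. -/
def lev (e : ℕ) (B : Set ℤ) (x : ℤ) : ℤ := nb e B x - ng e B x

/-- The number of gaps in `(x - e, x]`. -/
def gp (e : ℕ) (B : Set ℤ) (x : ℤ) : ℤ := ∑ j ∈ Finset.range e, (1 - ch B (x - j))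

theorem ch_of_mem {B : Set ℤ} {x : ℤ} (h : x ∈ B) : ch B x = 1 := if_pos h
theorem ch_of_notMem {B : Set ℤ} {x : ℤ} (h : x ∉ B) : ch B x = 0 := if_neg h
theorem ch_eq_one {B : Set ℤ} {x : ℤ} : ch B x = 1 ↔ x ∈ B := by
  unfold ch; split_ifs with h <;> simp [h]
theorem ch_eq_zero {B : Set ℤ} {x : ℤ} : ch B x = 0 ↔ x ∉ B := by
  unfold ch; split_ifs with h <;> simp [h]
theorem ch_cases (B : Set ℤ) (x : ℤ) : (x ∈ B ∧ ch B x = 1) ∨ (x ∉ B ∧ ch B x = 0) := by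
  unfold ch; split_ifs with h <;> simp [h]
theorem ch_nonneg (B : Set ℤ) (x : ℤ) : 0 ≤ ch B x := by
  rcases ch_cases B x with h | h <;> omega
theorem ch_le_one (B : Set ℤ) (x : ℤ) : ch B x ≤ 1 := by
  rcases ch_cases B x with h | h <;> omega

theorem ch_ext {B C : Set ℤ} (h : ∀ x, ch B x = ch C x) : B = C := by
  ext x
  rw [← ch_eq_one, ← ch_eq_one, h]

/-- The source of every recursion along a runner: index zero is the current position, the shifted
set belongs to the next one. -/
theorem ncard_succ_split (S : Set ℕ) (hS : S.Finite) :
    (S.ncard : ℤ) = (if 0 ∈ S then 1 else 0) + ({i | i + 1 ∈ S}.ncard : ℤ) := by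
  have h1 : ((fun i => i + 1) '' {i | i + 1 ∈ S}).ncard = {i | i + 1 ∈ S}.ncard :=
    Set.ncard_image_of_injective _ (add_left_injective 1)
  rw [← h1]
  split_ifs with h
  · have : S = insert 0 ((fun i => i + 1) '' {i | i + 1 ∈ S}) := by
      ext i
      cases i with
      | zero => simp [h]
      | succ i => simp
    conv_lhs => rw [this]
    rw [Set.ncard_insert_of_notMem (by simp) (hS.subset (by rintro _ ⟨i, hi, rfl⟩; exact hi))]
    push_cast; ring
  · have : S = (fun i => i + 1) '' {i | i + 1 ∈ S} := by
      ext i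
      cases i with
      | zero => simp [h]
      | succ i => simp
    conv_lhs => rw [this]
    simp

/-! ### Recursions for the counts of beads and gaps along a runner. -/

section basics

variable {e : ℕ} (he : 0 < e) {B : Set ℤ} (hB : Maya B)
include he hB

theorem nb_finite (x : ℤ) : {i : ℕ | x + e * i ∈ B}.Finite := by
  obtain ⟨-, hi, h⟩ := hB
  refine (Set.finite_lt_nat (hi - x).toNat).subset fun i hi' => ?_
  by_contra hc
  refine h _ ?_ hi'
  simp only [Set.mem_ofPred_eq, not_lt] at hc
  have : (i : ℤ) ≤ e * i := by nlinarith
  omega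

theorem ng_finite (x : ℤ) : {i : ℕ | x - e * (i + 1) ∉ B}.Finite := by
  obtain ⟨⟨lo, h⟩, -⟩ := hB
  refine (Set.finite_lt_nat (x - lo).toNat).subset fun i hi' => ?_
  by_contra hc
  refine hi' (h _ ?_)
  simp only [Set.mem_ofPred_eq, not_lt] at hc
  have : ((i : ℤ) + 1) ≤ e * (i + 1) := by nlinarith
  omega

theorem nb_rec (x : ℤ) : nb e B x = ch B x + nb e B (x + e) := by
  unfold nb
  rw [ncard_succ_split _ (nb_finite he hB x)]
  congr 1
  · simp [ch]
  · have : ∀ i : ℕ, x + e * ((i + 1 : ℕ) : ℤ) = x + e + e * i := by intro i; push_cast; ring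
    simp only [Set.mem_ofPred_eq, this]

theorem ng_rec (x : ℤ) : ng e B (x + e) = 1 - ch B x + ng e B x := by
  unfold ng
  rw [ncard_succ_split _ (ng_finite he hB (x + e))]
  congr 1
  · simp only [Set.mem_ofPred_eq]
    have : x + (e : ℤ) - e * (((0 : ℕ) : ℤ) + 1) = x := by push_cast; ring
    simp only [this]
    rcases ch_cases B x with h | h <;> simp [h]
  · have : ∀ i : ℕ, x + e - e * (((i + 1 : ℕ) : ℤ) + 1) = x - e * (i + 1) := by
      intro i; push_cast; ring
    simp only [Set.mem_ofPred_eq, this]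

theorem nb_pos_iff (x : ℤ) : 0 < nb e B x ↔ ∃ i : ℕ, x + e * i ∈ B := by
  unfold nb
  rw [Int.natCast_pos, Set.ncard_pos (nb_finite he hB x)]
  rfl

theorem ng_pos_iff (x : ℤ) : 0 < ng e B x ↔ ∃ i : ℕ, x - e * (i + 1) ∉ B := by
  unfold ng
  rw [Int.natCast_pos, Set.ncard_pos (ng_finite he hB x)]
  rfl

end basics

theorem nb_nonneg (e : ℕ) (B : Set ℤ) (x : ℤ) : 0 ≤ nb e B x := Int.natCast_nonneg _
theorem ng_nonneg (e : ℕ) (B : Set ℤ) (x : ℤ) : 0 ≤ ng e B x := Int.natCast_nonneg _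

theorem nb_eq_zero {e : ℕ} {B : Set ℤ} {hi : ℤ} (h : ∀ x ≥ hi, x ∉ B) {x : ℤ} (hx : hi ≤ x) :
    nb e B x = 0 := by
  unfold nb
  have : {i : ℕ | x + e * i ∈ B} = ∅ := by
    ext i
    simp only [Set.mem_ofPred_eq, Set.mem_empty_iff_false, iff_false]
    exact h _ (by have : (0 : ℤ) ≤ e * i := by positivity
                  omega)
  simp [this]

theorem ng_eq_zero {e : ℕ} {B : Set ℤ} {lo : ℤ} (h : ∀ x < lo, x ∈ B) {x : ℤ}
    (hx : x < lo + e) : ng e B x = 0 := by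
  unfold ng
  have : {i : ℕ | x - e * (i + 1) ∉ B} = ∅ := by
    ext i
    simp only [Set.mem_ofPred_eq, Set.mem_empty_iff_false, iff_false, not_not]
    exact h _ (by have : (0 : ℤ) ≤ e * i := by positivity
                  have h2 : (e : ℤ) * (i + 1) = e * i + e := by ring
                  omega)
  simp [this]

/-- Functions on `ℤ` that vanish far to the right are determined by their `e`-step differences. -/
theorem eq_of_step_right {e : ℕ} (he : 0 < e) {f g : ℤ → ℤ} (h : ∀ x, f x - f (x + e) = g x - g (x + e))
    {hi : ℤ} (h0 : ∀ x ≥ hi, f x = g x) (x : ℤ) : f x = g x := by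
  have key : ∀ n : ℕ, ∀ x, hi ≤ x + n → f x = g x := by
    intro n
    induction n with
    | zero => intro x hx; exact h0 x (by simpa using hx)
    | succ n ih =>
      intro x hx
      have h1 := ih (x + e) (by push_cast at hx; omega)
      have h2 := h x
      omega
  exact key (hi - x).toNat x (by omega)

theorem eq_of_step_left {e : ℕ} (he : 0 < e) {f g : ℤ → ℤ} (h : ∀ x, f (x + e) - f x = g (x + e) - g x)
    {lo : ℤ} (h0 : ∀ x < lo, f x = g x) (x : ℤ) : f x = g x := by
  have key : ∀ n : ℕ, ∀ x, x < lo + n → f x = g x := by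
    intro n
    induction n with
    | zero => intro x hx; exact h0 x (by simpa using hx)
    | succ n ih =>
      intro x hx
      have h1 := ih (x - e) (by push_cast at hx; omega)
      have h2 := h (x - e)
      rw [sub_add_cancel] at h2
      omega
  exact key (x - lo + 1).toNat x (by omega)

section basics2

variable {e : ℕ} (he : 0 < e) {B : Set ℤ} (hB : Maya B)
include he hB

/-- Passing a bead lowers `nb` and passing a gap raises `ng`, so the difference drops by one either
way. It therefore does not see the arrangement of the beads, only the core. -/
theorem lev_add (x : ℤ) : lev e B (x + e) = lev e B x - 1 := by
  have h1 := nb_rec he hB x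
  have h2 := ng_rec he hB x
  unfold lev; omega

theorem lev_add_mul (x : ℤ) (t : ℤ) : lev e B (x + e * t) = lev e B x - t := by
  induction t using Int.induction_on with
  | zero => simp
  | succ n ih =>
    have := lev_add he hB (x + e * n)
    rw [show x + (e : ℤ) * (n + 1) = x + e * n + e by ring]; omega
  | pred n ih =>
    have := lev_add he hB (x + e * (-n - 1))
    rw [show x + (e : ℤ) * (-n - 1) + e = x + e * (-n) by ring] at this; omega

theorem nb_add_mul_le (x : ℤ) (t : ℕ) : nb e B (x + e * t) ≤ nb e B x := by
  induction t with
  | zero => simp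
  | succ n ih =>
    have := nb_rec he hB (x + e * n)
    have h2 := ch_nonneg B (x + e * n)
    push_cast
    rw [show x + (e : ℤ) * (n + 1) = x + e * n + e by ring]; omega

theorem ng_add_mul_le (x : ℤ) (t : ℕ) : ng e B x ≤ ng e B (x + e * t) := by
  induction t with
  | zero => simp
  | succ n ih =>
    have := ng_rec he hB (x + e * n)
    have h2 := ch_le_one B (x + e * n)
    push_cast
    rw [show x + (e : ℤ) * (n + 1) = x + e * n + e by ring]; omega

theorem mult_pos_iff (x : ℤ) :
    0 < mult e B x ↔ (∃ i : ℕ, x + e * i ∈ B) ∧ ∃ i : ℕ, x - e * (i + 1) ∉ B := by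
  unfold mult
  rw [lt_min_iff, nb_pos_iff he hB, ng_pos_iff he hB]

end basics2

/-- The window of length `e` gains `x` and loses `x - e`. Both the comparison of adjacent runners
and the conjugation of vertices rest on this. -/
theorem gp_sub (e : ℕ) (B : Set ℤ) (x : ℤ) : gp e B x - gp e B (x - 1) = ch B (x - e) - ch B x := by
  unfold gp
  rw [← Finset.sum_sub_distrib]
  have h : ∀ j ∈ Finset.range e, (1 - ch B (x - j)) - (1 - ch B (x - 1 - j)) =
      (fun j : ℕ => ch B (x - j)) (j + 1) - (fun j : ℕ => ch B (x - j)) j := by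
    intro j _
    simp only
    rw [show x - 1 - (j : ℤ) = x - ((j + 1 : ℕ) : ℤ) by push_cast; ring]
    ring
  rw [Finset.sum_congr rfl h]
  exact (Finset.sum_range_sub (fun j : ℕ => ch B (x - j)) e).trans (by simp)

theorem mult_nonneg (e : ℕ) (B : Set ℤ) (x : ℤ) : 0 ≤ mult e B x :=
  le_min (nb_nonneg _ _ _) (ng_nonneg _ _ _)

/-! ### Conjugation and translation -/

/-- The conjugate set of beads: reverse and complement. -/
def conj (B : Set ℤ) : Set ℤ := {x | -1 - x ∉ B}

/-- The translate of a set of beads. -/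
def tr (c : ℤ) (B : Set ℤ) : Set ℤ := {x | x - c ∈ B}

theorem Maya.conj {B : Set ℤ} (hB : Maya B) : Maya (conj B) := by
  obtain ⟨⟨lo, h1⟩, hi, h2⟩ := hB
  refine ⟨⟨-hi, fun x hx => h2 _ (by omega)⟩, -lo, fun x hx hc => hc (h1 _ (by omega))⟩

theorem Maya.tr {B : Set ℤ} (hB : Maya B) (c : ℤ) : Maya (tr c B) := by
  obtain ⟨⟨lo, h1⟩, hi, h2⟩ := hB
  exact ⟨⟨lo + c, fun x hx => h1 _ (by omega)⟩, hi + c, fun x hx => h2 _ (by omega)⟩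

theorem ch_conj (B : Set ℤ) (x : ℤ) : ch (conj B) x = 1 - ch B (-1 - x) := by
  unfold ch Abacus.conj
  by_cases h : -1 - x ∈ B <;> simp [h]

theorem ch_tr (c : ℤ) (B : Set ℤ) (x : ℤ) : ch (tr c B) x = ch B (x - c) := rfl

theorem conj_conj (B : Set ℤ) : conj (conj B) = B :=
  ch_ext fun x => by rw [ch_conj, ch_conj]; ring_nf

theorem nb_conj (e : ℕ) (B : Set ℤ) (x : ℤ) : nb e (conj B) x = ng e B (-1 - x + e) := by
  unfold nb ng Abacus.conj
  have : ∀ i : ℕ, -1 - (x + e * i) = -1 - x + e - e * ((i : ℤ) + 1) := by intro i; ring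
  simp only [Set.mem_ofPred_eq, this]

theorem ng_conj (e : ℕ) (B : Set ℤ) (x : ℤ) : ng e (conj B) x = nb e B (-1 - x + e) := by
  unfold nb ng Abacus.conj
  have : ∀ i : ℕ, -1 - (x - e * ((i : ℤ) + 1)) = -1 - x + e + e * i := by intro i; ring
  simp only [Set.mem_ofPred_eq, this, not_not]

theorem mult_conj (e : ℕ) (B : Set ℤ) (x : ℤ) : mult e (conj B) x = mult e B (-1 - x + e) := by
  unfold mult; rw [nb_conj, ng_conj, min_comm]

theorem lev_conj (e : ℕ) (B : Set ℤ) (x : ℤ) : lev e (conj B) x = - lev e B (-1 - x + e) := by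
  unfold lev; rw [nb_conj, ng_conj]; ring

theorem nb_tr (e : ℕ) (c : ℤ) (B : Set ℤ) (x : ℤ) : nb e (tr c B) x = nb e B (x - c) := by
  unfold nb Abacus.tr
  have : ∀ i : ℕ, x + e * i - c = x - c + e * i := by intro i; ring
  simp only [Set.mem_ofPred_eq, this]

theorem ng_tr (e : ℕ) (c : ℤ) (B : Set ℤ) (x : ℤ) : ng e (tr c B) x = ng e B (x - c) := by
  unfold ng Abacus.tr
  have : ∀ i : ℕ, x - e * ((i : ℤ) + 1) - c = x - c - e * (i + 1) := by intro i; ring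
  simp only [Set.mem_ofPred_eq, this]

theorem mult_tr (e : ℕ) (c : ℤ) (B : Set ℤ) (x : ℤ) : mult e (tr c B) x = mult e B (x - c) := by
  unfold mult; rw [nb_tr, ng_tr]

theorem lev_tr (e : ℕ) (c : ℤ) (B : Set ℤ) (x : ℤ) : lev e (tr c B) x = lev e B (x - c) := by
  unfold lev; rw [nb_tr, ng_tr]

theorem gp_tr (e : ℕ) (c : ℤ) (B : Set ℤ) (x : ℤ) : gp e (tr c B) x = gp e B (x - c) := by
  unfold gp
  refine Finset.sum_congr rfl fun j _ => ?_
  rw [ch_tr]; ring_nf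

/-- The window ending at `x` is reflected onto the window ending at `e - 2 - x`, with beads and gaps
interchanged. -/
theorem gp_conj (e : ℕ) (B : Set ℤ) (x : ℤ) : gp e (conj B) x = e - gp e B (-1 - x + e - 1) := by
  unfold gp
  rw [eq_sub_iff_add_eq, ← Finset.sum_range_reflect (fun j : ℕ => 1 - ch B (-1 - x + e - 1 - j)),
    ← Finset.sum_add_distrib]
  rw [Finset.sum_congr rfl (g := fun _ => (1 : ℤ))]
  · simp
  · intro j hj
    rw [ch_conj]
    have hj := Finset.mem_range.1 hj
    rw [show (-1 - x + (e : ℤ) - 1 - ((e - 1 - j : ℕ) : ℤ)) = -1 - (x - j) by omega]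
    ring

theorem tr_tr (c d : ℤ) (B : Set ℤ) : tr c (tr d B) = tr (c + d) B := by
  ext x; simp only [tr, Set.mem_ofPred_eq, sub_sub]

theorem tr_zero (B : Set ℤ) : tr 0 B = B := by ext x; simp [tr]

/-! ### Local relations between two adjacent Kashiwara operators, in terms of height functions -/

/-- `p` is the last place where `f` attains its positive maximum. -/
def GoodF (f : ℤ → ℤ) (p : ℤ) : Prop := 0 < f p ∧ (∀ i, f i ≤ f p) ∧ ∀ i, p < i → f i < f p

/-- The effect of a move in row `p` on the height function of its own colour. -/
def dn (p : ℤ) (f : ℤ → ℤ) (i : ℤ) : ℤ := f i - if i ≤ p then 2 else 0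

/-- The effect of a move in row `p` on the height function of an adjacent colour. -/
def upw (p : ℤ) (f : ℤ → ℤ) (i : ℤ) : ℤ := f i + if i ≤ p then 1 else 0

theorem dn_le {p i : ℤ} (f : ℤ → ℤ) (h : i ≤ p) : dn p f i = f i - 2 := by simp [dn, h]
theorem dn_gt {p i : ℤ} (f : ℤ → ℤ) (h : p < i) : dn p f i = f i := by simp [dn, h]
theorem upw_le {p i : ℤ} (f : ℤ → ℤ) (h : i ≤ p) : upw p f i = f i + 1 := by simp [upw, h]
theorem upw_gt {p i : ℤ} (f : ℤ → ℤ) (h : p < i) : upw p f i = f i := by simp [upw, h]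

theorem GoodF.unique {f : ℤ → ℤ} {p q : ℤ} (hp : GoodF f p) (hq : GoodF f q) : p = q := by
  rcases lt_trichotomy p q with h | h | h
  · have := hp.2.2 q h; have := hq.2.1 p; omega
  · exact h
  · have := hq.2.2 p h; have := hp.2.1 q; omega

theorem exists_goodF {f : ℤ → ℤ} {M hi : ℤ} (hM : ∀ i, f i ≤ M) (hhi : ∀ i ≥ hi, f i = 0)
    {i : ℤ} (h : 0 < f i) : ∃ p, GoodF f p ∧ f i ≤ f p := by
  obtain ⟨m, ⟨j, rfl⟩, hmax⟩ := Int.exists_greatest_of_bdd (P := fun m => ∃ j, f j = m)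
    ⟨M, by rintro _ ⟨j, rfl⟩; exact hM j⟩ ⟨_, i, rfl⟩
  have h1 : ∀ k, f k ≤ f j := fun k => hmax _ ⟨k, rfl⟩
  have h2 := h1 i
  obtain ⟨p, hp, hpm⟩ := Int.exists_greatest_of_bdd (P := fun k => f k = f j)
    ⟨hi, fun k hk => by by_contra hc; have := hhi k (by omega); omega⟩ ⟨j, rfl⟩
  refine ⟨p, ⟨by omega, fun k => by have := h1 k; omega, fun k hk => ?_⟩, by omega⟩
  have := h1 k
  rcases this.lt_or_eq with h3 | h3
  · omega
  · have := hpm k h3; omega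

/-- The first operator does not raise the other height: the operators commute. -/
theorem GoodF.commute {f g : ℤ → ℤ} {p q : ℤ} (hp : GoodF f p) (hq : GoodF g q)
    (h : ∀ i ≤ p, g i < g q) :
    p < q ∧ GoodF (upw p g) q ∧ GoodF (upw q f) p := by
  have hpq : p < q := by
    by_contra hc
    have := h q (by omega); omega
  refine ⟨hpq, ⟨?_, fun i => ?_, fun i hi => ?_⟩, ⟨?_, fun i => ?_, fun i hi => ?_⟩⟩
  · rw [upw_gt _ hpq]; exact hq.1
  · rw [upw_gt _ hpq]
    rcases le_or_gt i p with h1 | h1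
    · rw [upw_le _ h1]; have := h i h1; omega
    · rw [upw_gt _ h1]; exact hq.2.1 i
  · rw [upw_gt _ hpq, upw_gt _ (by omega)]; exact hq.2.2 i hi
  · rw [upw_le _ hpq.le]; have := hp.1; omega
  · rw [upw_le _ hpq.le]
    have := hp.2.1 i
    unfold upw; split_ifs <;> omega
  · rw [upw_le _ hpq.le]
    have := hp.2.2 i hi
    unfold upw; split_ifs <;> omega

/-- If `f` regains its old maximum after the move in row `q`, then `q` lies beyond `p`. There `g`
was unaffected by the first move, so the two moves commute already. -/
theorem GoodF.of_raised {f g : ℤ → ℤ} {p q : ℤ} (hp : GoodF f p) (hq : GoodF (upw p g) q)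
    {i : ℤ} (h : f p ≤ upw q (dn p f) i) : GoodF g q ∧ ∀ i ≤ p, g i < g q := by
  have hpq : p < q := by
    by_contra hc
    have h1 := hp.2.1 i
    rcases le_or_gt i q with h2 | h2
    · rw [upw_le _ h2, dn_le _ (by omega)] at h; omega
    · rw [upw_gt _ h2] at h
      rcases le_or_gt i p with h3 | h3
      · rw [dn_le _ h3] at h; omega
      · rw [dn_gt _ h3] at h; have := hp.2.2 i h3; omega
  obtain ⟨h1, h2, h3⟩ := hq
  rw [upw_gt _ hpq] at h1 h2 h3
  have h4 : ∀ i ≤ p, g i < g q := fun i hi => by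
    have := h2 i; rw [upw_le _ hi] at this; omega
  refine ⟨⟨h1, fun i => ?_, fun i hi => ?_⟩, h4⟩
  · have := h2 i
    unfold upw at this; split_ifs at this <;> omega
  · have := h3 i hi; rw [upw_gt _ (by omega)] at this; exact this

/-- If the move in row `q` does not raise `f`, then `q < p`. Heights drop by at most one per row, so
row `q + 1` competes for the next maximum of `g` and forces `q < s ≤ p`; neither move then reaches
the part of `f` beyond `p`. -/
theorem GoodF.not_raised_twice {f g : ℤ → ℤ} {p q s : ℤ} (hp : GoodF f p) (hq : GoodF g q)
    (hstep : ∀ i, g i ≤ g (i + 1) + 1)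
    (h : ∀ i ≤ q, f i < f p) (hs : GoodF (dn q (upw p g)) s) :
    (∀ i, upw q (dn p f) i < f p) ∧ ∀ i, upw s (upw q (dn p f)) i < f p := by
  have hqp : q < p := by
    by_contra hc
    have := h p (by omega); omega
  have hs1 : q < s := by
    by_contra hc
    have h1 := hs.2.1 (q + 1)
    rw [dn_gt _ (by omega), upw_le _ (by omega), dn_le _ (by omega), upw_le _ (by omega)] at h1
    have := hstep q; have := hq.2.1 s; omega
  have hs2 : s ≤ p := by
    by_contra hc
    have h1 := hs.2.1 (q + 1)
    rw [dn_gt _ (by omega), upw_le _ (by omega), dn_gt _ (by omega), upw_gt _ (by omega)] at h1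
    have := hstep q; have := hq.2.2 s (by omega); omega
  refine ⟨fun i => ?_, fun i => ?_⟩ <;>
  · have h1 := hp.2.1 i
    have h2 := hp.2.2 i
    have h3 := h i
    unfold upw dn
    split_ifs <;> omega

/-- Both operators raise the other height: the quartic relation. -/
theorem GoodF.quartic_aux {f g : ℤ → ℤ} {p q : ℤ} (hp : GoodF f p) (hq : GoodF g q)
    (hf : ∀ i, f i ≤ f (i + 1) + 1)
    (h1 : ∃ i ≤ p, g i = g q) (hpq : p < q) :
    ∃ s r,
      (GoodF (upw p g) s ∧ GoodF (dn s (upw p g)) q ∧ GoodF (upw q (upw s (dn p f))) r) ∧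
      (GoodF (upw q f) p ∧ GoodF (dn p (upw q f)) r ∧ GoodF (upw r (upw p (dn q g))) s) ∧
      (∀ i, upw s (dn p f) i < f p) ∧ (∃ i, f p ≤ upw q (upw s (dn p f)) i) ∧
      (∀ i, upw p (dn q g) i < g q) ∧ (∃ i, g q ≤ upw r (upw p (dn q g)) i) := by
  obtain ⟨i₀, hi₀, hi₀'⟩ := h1
  -- The move in row `p` raises `g` by one up to `p`, so the new last maximum is the last old
  -- maximum not beyond `p`.
  obtain ⟨s, ⟨hsp, hs⟩, hsmax⟩ := Int.exists_greatest_of_bdd (P := fun i => i ≤ p ∧ g i = g q)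
    ⟨p, fun i hi => hi.1⟩ ⟨i₀, hi₀, hi₀'⟩
  have hp1 : f (p + 1) = f p - 1 := by
    have := hf p; have := hp.2.2 (p + 1) (by omega); omega
  -- After its first move `f` has maximum `f p - 1`; the move in row `q` raises it up to `q`, and
  -- the second move of this colour takes place in the last row that profits.
  obtain ⟨r, ⟨hpr, hrq, hr⟩, hrmax⟩ := Int.exists_greatest_of_bdd
    (P := fun i => p < i ∧ i ≤ q ∧ f i = f p - 1)
    ⟨q, fun i hi => hi.2.1⟩ ⟨p + 1, by omega, by omega, hp1⟩
  have hg1 : ∀ i, s < i → i ≤ p → g i < g q := fun i h2 h3 => by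
    have := hq.2.1 i
    by_contra hc
    have := hsmax i ⟨h3, by omega⟩; omega
  have hf1 : ∀ i, r < i → f i < f p ∧ (i ≤ q → f i < f p - 1) := fun i h2 => by
    have h4 := hp.2.2 i (by omega)
    refine ⟨h4, fun h3 => ?_⟩
    by_contra hc
    have := hrmax i ⟨by omega, h3, by omega⟩; omega
  have hp0 := hp.1
  have hq0 := hq.1
  refine ⟨s, r, ⟨⟨?_, fun i => ?_, fun i hi => ?_⟩, ⟨?_, fun i => ?_, fun i hi => ?_⟩,
    ⟨?_, fun i => ?_, fun i hi => ?_⟩⟩, ⟨⟨?_, fun i => ?_, fun i hi => ?_⟩,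
    ⟨?_, fun i => ?_, fun i hi => ?_⟩, ⟨?_, fun i => ?_, fun i hi => ?_⟩⟩,
    fun i => ?_, ⟨p + 1, ?_⟩, fun i => ?_, ⟨s, ?_⟩⟩
  all_goals
    try have a1 := hp.2.1 i
    try have a2 := hp.2.2 i
    try have a3 := hq.2.1 i
    try have a4 := hq.2.2 i
    try have a5 := hg1 i
    try have a6 := hf1 i
    simp only [upw, dn]
    split_ifs <;> omega

/-- At a good row the height drops, and two adjacent colours never drop in the same row. -/
theorem GoodF.not_both {f g : ℤ → ℤ} {p q : ℤ} (hp : GoodF f p) (hq : GoodF g q)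
    (hf : ∀ i, f i ≤ f (i + 1) + 1) (h : ∀ i, f i = f (i + 1) + 1 → g i ≤ g (i + 1)) : p ≠ q := by
  rintro rfl
  have := hf p
  have := h p
  have := hp.2.2 (p + 1) (by omega)
  have := hq.2.2 (p + 1) (by omega)
  omega

/-- The height of the signature at `x`: removable minus addable beads at or below `x`. -/
def ht (e : ℕ) (B : Set ℤ) (x : ℤ) : ℤ := nb e B x - nb e B (x - 1)

/-- `x` is the good removable bead on its runner. -/
def Good (e : ℕ) (B : Set ℤ) (x : ℤ) : Prop :=
  0 < ht e B x ∧ (∀ t : ℤ, ht e B (x + e * t) ≤ ht e B x) ∧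
    ∀ t : ℤ, 0 < t → ht e B (x + e * t) < ht e B x

/-- Move the bead at `x` to `x - 1`. -/
def mv (B : Set ℤ) (x : ℤ) : Set ℤ := {y | (y ∈ B ∧ y ≠ x) ∨ y = x - 1}

/-- The heights along the runner of `a`. -/
def row (e : ℕ) (B : Set ℤ) (a : ℤ) (i : ℤ) : ℤ := ht e B (a + e * i)

theorem ch_mv {B : Set ℤ} {x : ℤ} (h1 : x ∈ B) (h2 : x - 1 ∉ B) (y : ℤ) :
    ch (mv B x) y = ch B y - (if y = x then 1 else 0) + (if y = x - 1 then 1 else 0) := by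
  have : y ∈ mv B x ↔ (y ∈ B ∧ y ≠ x) ∨ y = x - 1 := Iff.rfl
  rcases eq_or_ne y x with rfl | h
  · rw [ch_of_mem h1, ch_of_notMem (by rw [this]; omega)]
    have : y ≠ y - 1 := by omega
    simp [this]
  · rcases eq_or_ne y (x - 1) with rfl | h'
    · rw [ch_of_notMem h2, ch_of_mem (by rw [this]; tauto)]; simp
    · simp only [h, h', if_false]
      unfold ch; simp [this, h, h']

theorem Maya.mv {B : Set ℤ} (hB : Maya B) (x : ℤ) : Maya (mv B x) := by
  obtain ⟨⟨lo, h1⟩, hi, h2⟩ := hB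
  refine ⟨⟨min lo x, fun y hy => Or.inl ⟨h1 y (by omega), by omega⟩⟩, max hi x, fun y hy hc => ?_⟩
  rcases hc with ⟨hc, -⟩ | hc
  · exact h2 y (by omega) hc
  · omega

theorem Maya.of_mv {B : Set ℤ} {x : ℤ} (hB : Maya (Abacus.mv B x)) : Maya B := by
  obtain ⟨⟨lo, h1⟩, hi, h2⟩ := hB
  refine ⟨⟨min lo (x - 1), fun y hy => ?_⟩, max hi (x + 1), fun y hy hc => ?_⟩
  · rcases h1 y (by omega) with h | h
    · exact h.1
    · omega
  · exact h2 y (by omega) (Or.inl ⟨hc, by omega⟩)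

/-- The indicator of the part of a runner weakly above `x` has a point mass as its `e`-step
difference; this is how one bead enters `nb`. -/
theorem dvd_step {e : ℕ} (he : 0 < e) (x y : ℤ) :
    (if y ≤ x ∧ (e : ℤ) ∣ x - y then (1 : ℤ) else 0) -
      (if y + e ≤ x ∧ (e : ℤ) ∣ x - (y + e) then 1 else 0) = if y = x then 1 else 0 := by
  have h : (e : ℤ) ∣ x - (y + e) ↔ (e : ℤ) ∣ x - y := by
    rw [← sub_sub]; exact dvd_sub_self_right
  simp only [h]
  by_cases hd : (e : ℤ) ∣ x - y
  · simp only [hd, and_true]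
    have : 0 < x - y → (e : ℤ) ≤ x - y := fun h => Int.le_of_dvd h hd
    split_ifs <;> omega
  · have : y ≠ x := by rintro rfl; simp at hd
    simp [hd, this]

theorem good_iff (e : ℕ) (B : Set ℤ) (a p : ℤ) : Good e B (a + e * p) ↔ GoodF (row e B a) p := by
  unfold Good GoodF row
  refine and_congr Iff.rfl (and_congr ⟨fun h i => ?_, fun h t => ?_⟩ ⟨fun h i hi => ?_, fun h t ht => ?_⟩)
  · have := h (i - p); rwa [show a + e * p + e * (i - p) = a + e * i by ring] at this
  · have := h (p + t); rwa [show a + e * (p + t) = a + e * p + e * t by ring] at this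
  · have := h (i - p) (by omega); rwa [show a + e * p + e * (i - p) = a + e * i by ring] at this
  · have := h (p + t) (by omega); rwa [show a + e * (p + t) = a + e * p + e * t by ring] at this

theorem Good.unique {e : ℕ} {B : Set ℤ} {x y : ℤ} (hx : Good e B x) (hy : Good e B y) (h : (e : ℤ) ∣ y - x) :
    x = y := by
  obtain ⟨t, ht⟩ := h
  have h1 : Good e B (x + e * 0) := by simpa using hx
  have h2 : Good e B (x + e * t) := by rwa [← ht, add_sub_cancel]
  have := ((good_iff e B x 0).1 h1).unique ((good_iff e B x t).1 h2)
  rw [← this] at ht; omega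

/-! ### How a good move changes the heights of all colours. -/

section heights

variable {e : ℕ} (he : 2 ≤ e) {B : Set ℤ} (hB : Maya B)
include he hB

theorem nb_mv {x : ℤ} (h1 : x ∈ B) (h2 : x - 1 ∉ B) (y : ℤ) :
    nb e (mv B x) y = nb e B y - (if y ≤ x ∧ (e : ℤ) ∣ x - y then 1 else 0)
      + (if y ≤ x - 1 ∧ (e : ℤ) ∣ x - 1 - y then 1 else 0) := by
  obtain ⟨hi, hhi⟩ := hB.2
  obtain ⟨hi', hhi'⟩ := (hB.mv x).2
  have he0 : 0 < e := by omega
  refine eq_of_step_right (f := fun y => nb e (mv B x) y) (g := fun y => nb e B y -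
    (if y ≤ x ∧ (e : ℤ) ∣ x - y then 1 else 0) + (if y ≤ x - 1 ∧ (e : ℤ) ∣ x - 1 - y then 1 else 0))
    he0 (hi := max (max hi hi') (x + 1)) (fun y => ?_)
    (fun y hy => ?_) y
  · have a1 := nb_rec he0 hB y
    have a2 := nb_rec he0 (hB.mv x) y
    have a3 := ch_mv h1 h2 y
    have a4 := dvd_step he0 x y
    have a5 := dvd_step he0 (x - 1) y
    omega
  · rw [nb_eq_zero hhi (by omega), nb_eq_zero hhi' (by omega), if_neg (by omega),
      if_neg (by omega)]
    rfl

theorem ht_step (x : ℤ) : ht e B x - ht e B (x + e) = ch B x - ch B (x - 1) := by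
  have he0 : 0 < e := by omega
  have a1 := nb_rec he0 hB x
  have a2 := nb_rec he0 hB (x - 1)
  unfold ht
  rw [show x + (e : ℤ) - 1 = x - 1 + e by ring]; omega

theorem row_step (a i : ℤ) :
    row e B a i - row e B a (i + 1) = ch B (a + e * i) - ch B (a + e * i - 1) := by
  unfold row
  rw [← ht_step he hB, show a + (e : ℤ) * (i + 1) = a + e * i + e by ring]

/-- The height drops strictly from `x` to `x + e`, and this drop is `ch B x - ch B (x - 1)`. -/
theorem Good.mem {x : ℤ} (h : Good e B x) : x ∈ B ∧ x - 1 ∉ B := by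
  have h1 := ht_step he hB x
  have h2 := h.2.2 1 one_pos
  rw [mul_one] at h2
  rw [← ch_eq_one, ← ch_eq_zero]
  have := ch_nonneg B x; have := ch_le_one B x
  have := ch_nonneg B (x - 1); have := ch_le_one B (x - 1)
  omega

theorem row_bounded (a : ℤ) : (∃ M, ∀ i, row e B a i ≤ M) ∧ ∃ hi, ∀ i ≥ hi, row e B a i = 0 := by
  obtain ⟨⟨lo, hlo⟩, hi, hhi⟩ := hB
  have hB : Maya B := ⟨⟨lo, hlo⟩, hi, hhi⟩
  have h2 : ∀ i, i ≥ |hi| + |a| + 1 → row e B a i = 0 := by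
    intro i hi'
    have : i ≤ e * i := by nlinarith [abs_nonneg hi, abs_nonneg a]
    have h3 := le_abs_self hi
    have h4 := neg_abs_le a
    unfold row ht
    rw [nb_eq_zero hhi (by omega), nb_eq_zero hhi (by omega)]; rfl
  refine ⟨⟨2 * (|hi| + |a| + 1 + |lo|+ |a| + 1), fun i => ?_⟩, _, h2⟩
  -- constant far to the left
  have h3 : ∀ i, i ≤ - (|lo| + |a| + 1) → row e B a i = row e B a (i + 1) := by
    intro i hi'
    have h4 : e * i ≤ i := by nlinarith [abs_nonneg lo, abs_nonneg a]
    have h5 := neg_abs_le lo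
    have h6 := le_abs_self a
    have := row_step he hB a i
    rw [ch_of_mem (hlo _ (by omega)), ch_of_mem (hlo _ (by omega))] at this
    omega
  -- Going left from a row where the height vanishes, each step adds at most one.
  have h7 : ∀ n : ℕ, row e B a (|hi| + |a| + 1 - n) ≤ n := by
    intro n
    induction n with
    | zero => rw [h2 _ (by simp)]; simp
    | succ n ih =>
      have := row_step he hB a (|hi| + |a| + 1 - (n + 1))
      rw [show |hi| + |a| + 1 - ((n : ℤ) + 1) + 1 = |hi| + |a| + 1 - n by ring] at this
      have := ch_le_one B (a + e * (|hi| + |a| + 1 - (n + 1)))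
      have := ch_nonneg B (a + e * (|hi| + |a| + 1 - (n + 1)) - 1)
      push_cast
      omega
  have h8 : ∀ n : ℕ, row e B a (-(|lo| + |a| + 1) - n) = row e B a (-(|lo| + |a| + 1)) := by
    intro n
    induction n with
    | zero => simp
    | succ n ih =>
      rw [← ih, h3 _ (by push_cast; omega)]
      congr 1; push_cast; ring
  have b1 := abs_nonneg hi
  have b2 := abs_nonneg lo
  have b3 := abs_nonneg a
  rcases le_or_gt i (-(|lo| + |a| + 1)) with h | h
  · have := h8 (-(|lo| + |a| + 1) - i).toNat
    rw [show (-(|lo| + |a| + 1) - ((-(|lo| + |a| + 1) - i).toNat : ℤ)) = i by omega] at this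
    rw [this]
    have := h7 ((|hi| + |a| + 1) + (|lo| + |a| + 1)).toNat
    rw [show (|hi| + |a| + 1 - (((|hi| + |a| + 1) + (|lo| + |a| + 1)).toNat : ℤ)) =
      -(|lo| + |a| + 1) by omega] at this
    omega
  · rcases le_or_gt i (|hi| + |a| + 1) with h' | h'
    · have := h7 ((|hi| + |a| + 1) - i).toNat
      rw [show (|hi| + |a| + 1 - (((|hi| + |a| + 1) - i).toNat : ℤ)) = i by omega] at this
      omega
    · rw [h2 i (by omega)]; omega

theorem exists_good {a i : ℤ} (h : 0 < row e B a i) :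
    ∃ p, Good e B (a + e * p) ∧ row e B a i ≤ row e B a p := by
  obtain ⟨⟨M, hM⟩, hi, hhi⟩ := row_bounded he hB a
  obtain ⟨p, hp, hp'⟩ := exists_goodF hM hhi h
  exact ⟨p, (good_iff e B a p).2 hp, hp'⟩

theorem row_mv_of_mem {a p : ℤ} (hm : a + e * p ∈ B ∧ a + e * p - 1 ∉ B) :
    row e (mv B (a + e * p)) a = dn p (row e B a) := by
  funext i
  unfold row ht dn
  rw [nb_mv he hB hm.1 hm.2, nb_mv he hB hm.1 hm.2]
  have d1 : (e : ℤ) ∣ a + e * p - (a + e * i) := ⟨p - i, by ring⟩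
  have d2 : (e : ℤ) ∣ a + e * p - 1 - (a + e * i - 1) := ⟨p - i, by ring⟩
  have d3 : ¬ (e : ℤ) ∣ a + e * p - 1 - (a + e * i) := by
    rintro ⟨t, ht⟩
    have : (e : ℤ) ∣ 1 := ⟨p - i - t, by linear_combination (-1 : ℤ) * ht⟩
    have := Int.le_of_dvd one_pos this; omega
  have d4 : ¬ (e : ℤ) ∣ a + e * p - (a + e * i - 1) := by
    rintro ⟨t, ht⟩
    have : (e : ℤ) ∣ 1 := ⟨t - p + i, by linear_combination ht⟩
    have := Int.le_of_dvd one_pos this; omega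
  have h3 : a + e * i ≤ a + e * p ↔ i ≤ p := by
    rw [add_le_add_iff_left]; exact mul_le_mul_iff_right₀ (by omega)
  have h4 : a + e * i - 1 ≤ a + e * p - 1 ↔ i ≤ p := by rw [sub_le_sub_iff_right, h3]
  simp only [d1, d2, d3, d4, and_true, and_false, if_false, h3, h4]
  split_ifs <;> ring

theorem row_mv_self {a p : ℤ} (h : Good e B (a + e * p)) :
    row e (mv B (a + e * p)) a = dn p (row e B a) :=
  row_mv_of_mem he hB (h.mem he hB)

/-- With `e ≥ 3` the colours `a + 1` and `a - 1` are different, so each of them sees only one end of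
the move and changes by one rather than two. -/
theorem row_mv_adj (he3 : 3 ≤ e) {a p s : ℤ} (hs : s = 1 ∨ s = -1) (h : Good e B (a + e * p)) :
    row e (mv B (a + e * p)) (a + s) = upw p (row e B (a + s)) := by
  have hm := h.mem he hB
  funext i
  unfold row ht upw
  rw [nb_mv he hB hm.1 hm.2, nb_mv he hB hm.1 hm.2]
  have nd : ∀ c : ℤ, c ≠ 0 → |c| < 3 → ∀ z : ℤ, z = c + e * (p - i) → ¬ (e : ℤ) ∣ z := by
    rintro c hc hc3 z rfl ⟨t, ht⟩
    have : (e : ℤ) ∣ c := ⟨t - p + i, by linear_combination ht⟩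
    have := Int.le_of_dvd (abs_pos.2 hc) ((dvd_abs _ _).2 this)
    omega
  have h3 : ∀ c : ℤ, c + e * i ≤ c + e * p ↔ i ≤ p := fun c => by
    rw [add_le_add_iff_left]; exact mul_le_mul_iff_right₀ (by omega)
  rcases hs with rfl | rfl
  · have d1 := nd (-1) (by norm_num) (by norm_num) (a + e * p - (a + 1 + e * i)) (by ring)
    have d2 := nd (-2) (by norm_num) (by norm_num) (a + e * p - 1 - (a + 1 + e * i)) (by ring)
    have d3 := nd (-1) (by norm_num) (by norm_num) (a + e * p - 1 - (a + 1 + e * i - 1)) (by ring)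
    have d4 : (e : ℤ) ∣ a + e * p - (a + 1 + e * i - 1) := ⟨p - i, by ring⟩
    have h5 : a + 1 + e * i - 1 ≤ a + e * p ↔ i ≤ p := by
      rw [← h3 a]; constructor <;> intro h <;> linarith
    simp only [d1, d2, d3, d4, and_true, and_false, if_false, h5]
    split_ifs <;> ring
  · have d1 := nd 1 (by norm_num) (by norm_num) (a + e * p - (a + -1 + e * i)) (by ring)
    have d2 : (e : ℤ) ∣ a + e * p - 1 - (a + -1 + e * i) := ⟨p - i, by ring⟩
    have d3 := nd 1 (by norm_num) (by norm_num) (a + e * p - 1 - (a + -1 + e * i - 1)) (by ring)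
    have d4 := nd 2 (by norm_num) (by norm_num) (a + e * p - (a + -1 + e * i - 1)) (by ring)
    have h5 : a + -1 + e * i ≤ a + e * p - 1 ↔ i ≤ p := by
      rw [← h3 a]; constructor <;> intro h <;> linarith
    simp only [d1, d2, d3, d4, and_true, and_false, if_false, h5]
    split_ifs <;> ring

theorem row_mv_far {a b p : ℤ} (h1 : ¬ (e : ℤ) ∣ a - b) (h2 : ¬ (e : ℤ) ∣ a - b + 1)
    (h3 : ¬ (e : ℤ) ∣ a - b - 1) (h : Good e B (a + e * p)) :
    row e (mv B (a + e * p)) b = row e B b := by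
  have hm := h.mem he hB
  funext i
  unfold row ht
  rw [nb_mv he hB hm.1 hm.2, nb_mv he hB hm.1 hm.2]
  have nd : ∀ c : ℤ, ¬ (e : ℤ) ∣ c → ∀ z : ℤ, z = c + e * (p - i) → ¬ (e : ℤ) ∣ z := by
    rintro c hc z rfl ⟨t, ht⟩
    exact hc ⟨t - p + i, by linear_combination ht⟩
  have d1 := nd _ h1 (a + e * p - (b + e * i)) (by ring)
  have d2 := nd _ h3 (a + e * p - 1 - (b + e * i)) (by ring)
  have d3 := nd _ h1 (a + e * p - 1 - (b + e * i - 1)) (by ring)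
  have d4 := nd _ h2 (a + e * p - (b + e * i - 1)) (by ring)
  simp only [d1, d2, d3, d4, and_false, if_false]
  ring

end heights

theorem mv_comm {B : Set ℤ} {x y : ℤ} (hx : x ∈ B ∧ x - 1 ∉ B) (hy : y ∈ B ∧ y - 1 ∉ B)
    (hx' : x ∈ mv B y ∧ x - 1 ∉ mv B y) (hy' : y ∈ mv B x ∧ y - 1 ∉ mv B x) :
    mv (mv B x) y = mv (mv B y) x :=
  ch_ext fun z => by
    rw [ch_mv hy'.1 hy'.2, ch_mv hx.1 hx.2, ch_mv hx'.1 hx'.2, ch_mv hy.1 hy.2]; ring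

/-! ### The Mullineux-Kleshchev relation on sets of beads -/

/-- `MP e n B C`: there is a path of length `n` of Kashiwara operators from `B` to a vacuum and a
path with opposite colours from `C` to the conjugate vacuum. -/
inductive MP (e : ℕ) : ℕ → Set ℤ → Set ℤ → Prop
  | base (c : ℤ) : MP e 0 (Set.Iio c) (Set.Iio (-c))
  | step (n : ℕ) (B C : Set ℤ) (x y : ℤ) : (e : ℤ) ∣ x + y → Good e B x → Good e C y →
      MP e n (mv B x) (mv C y) → MP e (n + 1) B C

theorem maya_Iio (c : ℤ) : Maya (Set.Iio c) :=
  ⟨⟨c, fun _ h => h⟩, c, fun _ h h' => absurd h' (not_lt.2 h)⟩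

theorem MP.maya {e n : ℕ} {B C : Set ℤ} (h : MP e n B C) : Maya B ∧ Maya C := by
  induction h with
  | base c => exact ⟨maya_Iio _, maya_Iio _⟩
  | step n B C x y _ _ _ _ ih => exact ⟨ih.1.of_mv, ih.2.of_mv⟩

theorem MP.symm {e n : ℕ} {B C : Set ℤ} (h : MP e n B C) : MP e n C B := by
  induction h with
  | base c => simpa using MP.base (e := e) (-c)
  | step n B C x y hxy hx hy _ ih => exact MP.step n C B y x (by rwa [add_comm]) hy hx ih

/-- Every good move on the left is matched by one on the right. -/
def Matched (e n : ℕ) : Prop :=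
  ∀ B C, MP e n B C → ∀ x, Good e B x →
    ∃ m y, n = m + 1 ∧ (e : ℤ) ∣ x + y ∧ Good e C y ∧ MP e m (mv B x) (mv C y)

theorem matched_zero {e : ℕ} (he : 2 ≤ e) : Matched e 0 := by
  intro B C h x hx
  cases h with
  | base c =>
    have := hx.mem he (maya_Iio c)
    have h1 : x < c := this.1
    exact absurd (show x - 1 < c by omega) this.2

/-! ### Consequences of matching: equal heights and commuting squares. -/

section

variable {e : ℕ} (he : 2 ≤ e)
include he

/-- A good move lowers the largest height of its colour by exactly one, and matching performs it on
both sides at once. Together with `MP.symm` this shows that the largest heights of opposite colours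
agree; it is the invariant that recognises the local relation on the other side. -/
theorem MP.heights {n : ℕ} (hn : ∀ m ≤ n, Matched e m) {B C : Set ℤ} (h : MP e n B C) (a k : ℤ)
    (hk : ∃ i, k ≤ row e B a i) : ∃ i, k ≤ row e C (-a) i := by
  induction n generalizing B C k with
  | zero =>
    rcases le_or_gt k 0 with h0 | h0
    · obtain ⟨hi, hhi⟩ := (row_bounded he h.maya.2 (-a)).2
      exact ⟨hi, by rw [hhi hi le_rfl]; exact h0⟩
    · obtain ⟨i, hi⟩ := hk
      obtain ⟨p, hp, -⟩ := exists_good he h.maya.1 (show 0 < row e B a i by omega)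
      obtain ⟨m, y, hm, -⟩ := hn 0 le_rfl B C h _ hp
      omega
  | succ n ih =>
    rcases le_or_gt k 0 with h0 | h0
    · obtain ⟨hi, hhi⟩ := (row_bounded he h.maya.2 (-a)).2
      exact ⟨hi, by rw [hhi hi le_rfl]; exact h0⟩
    obtain ⟨i, hi⟩ := hk
    obtain ⟨p, hp, hpi⟩ := exists_good he h.maya.1 (show 0 < row e B a i by omega)
    obtain ⟨m, y, hm, ⟨t, ht⟩, hy, hmp⟩ := hn _ le_rfl B C h _ hp
    obtain rfl : n = m := by omega
    obtain rfl : y = -a + e * (t - p) := by linear_combination ht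
    have hF := (good_iff e C _ _).1 hy
    have hf := (good_iff e B _ _).1 hp
    have h1 := row_mv_self he h.maya.1 hp
    have h2 := row_mv_self he h.maya.2 hy
    obtain ⟨j, hj⟩ := ih (fun m hm => hn m (by omega)) hmp (k - 1) ⟨p + 1, by
      rw [h1, dn_gt _ (by omega)]
      have := row_step he h.maya.1 a p
      have := ch_le_one B (a + e * p)
      have := ch_nonneg B (a + e * p - 1)
      omega⟩
    rw [h2] at hj
    refine ⟨t - p, ?_⟩
    rcases le_or_gt j (t - p) with h3 | h3
    · rw [dn_le _ h3] at hj; have := hF.2.1 j; omega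
    · rw [dn_gt _ h3] at hj; have := hF.2.2 j h3; omega

/-- When both pairs of moves commute, a matched pair at the far corner can be lifted along the other
edge of the square. -/
theorem MP.square {m : ℕ} {B C : Set ℤ} (hB : Maya B) (hC : Maya C) {x x' y y' : ℤ}
    (hxy : (e : ℤ) ∣ x + y)
    (h1 : Good e B x) (h2 : Good e B x') (h3 : Good e (mv B x) x') (h4 : Good e (mv B x') x)
    (k1 : Good e C y) (k2 : Good e C y') (k3 : Good e (mv C y) y') (k4 : Good e (mv C y') y)
    (h : MP e m (mv (mv B x) x') (mv (mv C y) y')) : MP e (m + 1) (mv B x') (mv C y') := by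
  refine MP.step m _ _ x y hxy h4 k4 ?_
  rwa [← mv_comm (h1.mem he hB) (h2.mem he hB) (h4.mem he (hB.mv _)) (h3.mem he (hB.mv _)),
    ← mv_comm (k1.mem he hC) (k2.mem he hC) (k4.mem he (hC.mv _)) (k3.mem he (hC.mv _))]

end

/-! ### Local relations between adjacent colours on bead sets. -/

section adjacent

variable {e : ℕ} (he : 3 ≤ e) {B : Set ℤ} (hB : Maya B) {a s : ℤ} (hs : s = 1 ∨ s = -1)
include he hB hs

theorem row_mv_adj' {q : ℤ} (h : Good e B (a + s + e * q)) :
    row e (mv B (a + s + e * q)) a = upw q (row e B a) := by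
  have := row_mv_adj (by omega) hB he (a := a + s) (s := -s) (by omega) h
  rwa [add_neg_cancel_right] at this

/-- A drop needs a bead at `a + e * i` and a gap just before it; the adjacent colour shares one of
these two positions, in the opposite role. -/
theorem step_adj (i : ℤ) (h : row e B a i = row e B a (i + 1) + 1) :
    row e B (a + s) i ≤ row e B (a + s) (i + 1) := by
  have he2 : 2 ≤ e := by omega
  have h1 := row_step he2 hB a i
  have h2 := row_step he2 hB (a + s) i
  have b1 := ch_nonneg B (a + e * i - 1)
  have b2 := ch_le_one B (a + e * i)
  have b3 := ch_nonneg B (a + s + e * i - 1)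
  have b4 := ch_le_one B (a + s + e * i)
  rcases hs with rfl | rfl
  · rw [show a + 1 + (e : ℤ) * i - 1 = a + e * i by ring] at *; omega
  · rw [show a + -1 + (e : ℤ) * i = a + e * i - 1 by ring] at *; omega

omit hs in
theorem row_le_succ (a i : ℤ) : row e B a i ≤ row e B a (i + 1) + 1 := by
  have he2 : 2 ≤ e := by omega
  have h1 := row_step he2 hB a i
  have b1 := ch_nonneg B (a + e * i - 1)
  have b2 := ch_le_one B (a + e * i)
  omega

theorem Good.commute_adj {p q : ℤ} (hp : Good e B (a + e * p)) (hq : Good e B (a + s + e * q))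
    (h : (∀ i ≤ p, row e B (a + s) i < row e B (a + s) q) ∨ ∀ i ≤ q, row e B a i < row e B a p) :
    Good e (mv B (a + e * p)) (a + s + e * q) ∧ Good e (mv B (a + s + e * q)) (a + e * p) := by
  rw [good_iff, good_iff, row_mv_adj (by omega) hB he hs hp, row_mv_adj' he hB hs hq]
  rw [good_iff] at hp hq
  rcases h with h | h
  · exact (hp.commute hq h).2
  · exact (hq.commute hp h).2.symm

/-- When each move raises the other height, the paths with colours `a, b, b, a` and `b, a, a, b`
meet. The two final bounds record when the height of `a` is restored: not after the first `b`, but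
after the second. This timing distinguishes the relation from a commuting square. -/
theorem Good.quartic {p q : ℤ} (hp : Good e B (a + e * p)) (hq : Good e B (a + s + e * q))
    (h1 : ∃ i ≤ p, row e B (a + s) i = row e B (a + s) q)
    (h2 : ∃ i ≤ q, row e B a i = row e B a p) :
    ∃ q1 q2 p1 p2 p3 q3, ∃ B1 B2 B3 B4 C1 C2 C3 : Set ℤ,
      B1 = mv B (a + e * p) ∧ Good e B1 (a + s + e * q1) ∧
      B2 = mv B1 (a + s + e * q1) ∧ Good e B2 (a + s + e * q2) ∧
      B3 = mv B2 (a + s + e * q2) ∧ Good e B3 (a + e * p1) ∧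
      B4 = mv B3 (a + e * p1) ∧
      C1 = mv B (a + s + e * q) ∧ Good e C1 (a + e * p2) ∧
      C2 = mv C1 (a + e * p2) ∧ Good e C2 (a + e * p3) ∧
      C3 = mv C2 (a + e * p3) ∧ Good e C3 (a + s + e * q3) ∧
      B4 = mv C3 (a + s + e * q3) ∧
      (∀ i, row e B2 a i < row e B a p) ∧ ∃ i, row e B a p ≤ row e B3 a i := by
  have he2 : 2 ≤ e := by omega
  have hp' := (good_iff e B _ _).1 hp
  have hq' := (good_iff e B _ _).1 hq
  have hne := hp'.not_both hq' (row_le_succ he hB a) (step_adj he hB hs)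
  have main : ∃ q1 q2 p1 p2 p3 q3,
      (GoodF (upw p (row e B (a + s))) q1 ∧ GoodF (dn q1 (upw p (row e B (a + s)))) q2 ∧
        GoodF (upw q2 (upw q1 (dn p (row e B a)))) p1) ∧
      (GoodF (upw q (row e B a)) p2 ∧ GoodF (dn p2 (upw q (row e B a))) p3 ∧
        GoodF (upw p3 (upw p2 (dn q (row e B (a + s))))) q3) ∧
      (∀ i, upw q1 (dn p (row e B a)) i < row e B a p) ∧
      (∃ i, row e B a p ≤ upw q2 (upw q1 (dn p (row e B a))) i) ∧
      ((p = p2 ∧ p1 = p3) ∨ (p = p3 ∧ p1 = p2)) ∧ ((q = q2 ∧ q1 = q3) ∨ (q = q1 ∧ q2 = q3)) := by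
    rcases hne.lt_or_gt with hlt | hlt
    · obtain ⟨s', r, h3, h4, h5, h6, -, -⟩ := hp'.quartic_aux hq' (row_le_succ he hB a) h1 hlt
      exact ⟨s', q, r, p, r, s', h3, h4, h5, h6, by simp, by simp⟩
    · obtain ⟨s', r, h3, h4, -, -, h5, h6⟩ := hq'.quartic_aux hp' (row_le_succ he hB _) h2 hlt
      exact ⟨q, r, s', s', p, r, h4, h3, h5, h6, by simp, by simp⟩
  obtain ⟨q1, q2, p1, p2, p3, q3, ⟨g1, g2, g3⟩, ⟨k1, k2, k3⟩, r1, r2, e1, e2⟩ := main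
  -- first path
  have m1 := hB.mv (a + e * p)
  have ra1 := row_mv_self he2 hB hp
  have rb1 := row_mv_adj he2 hB he hs hp
  rw [← rb1, ← good_iff] at g1
  rw [← rb1] at g2
  rw [← ra1] at g3 r1 r2
  have m2 := m1.mv (a + s + e * q1)
  have ra2 := row_mv_adj' he m1 hs g1
  have rb2 := row_mv_self he2 m1 g1
  rw [← rb2, ← good_iff] at g2
  rw [← ra2] at g3 r1 r2
  have m3 := m2.mv (a + s + e * q2)
  have ra3 := row_mv_adj' he m2 hs g2
  rw [← ra3, ← good_iff] at g3
  rw [← ra3] at r2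
  -- second path
  have n1 := hB.mv (a + s + e * q)
  have sa1 := row_mv_adj' he hB hs hq
  have sb1 := row_mv_self he2 hB hq
  rw [← sa1, ← good_iff] at k1
  rw [← sa1] at k2
  rw [← sb1] at k3
  have n2 := n1.mv (a + e * p2)
  have sa2 := row_mv_self he2 n1 k1
  have sb2 := row_mv_adj he2 n1 he hs k1
  rw [← sa2, ← good_iff] at k2
  rw [← sb2] at k3
  have n3 := n2.mv (a + e * p3)
  have sb3 := row_mv_adj he2 n2 he hs k2
  rw [← sb3, ← good_iff] at k3
  refine ⟨q1, q2, p1, p2, p3, q3, _, _, _, _, _, _, _, rfl, g1, rfl, g2, rfl, g3, rfl, rfl, k1,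
    rfl, k2, rfl, k3, ?_, r1, r2⟩
  have a0 := hp.mem he2 hB
  have b0 := hq.mem he2 hB
  have a1 := g1.mem he2 m1
  have a2 := g2.mem he2 m2
  have a3 := g3.mem he2 m3
  have b1 := k1.mem he2 n1
  have b2 := k2.mem he2 n2
  have b3 := k3.mem he2 n3
  refine ch_ext fun z => ?_
  rw [ch_mv a3.1 a3.2, ch_mv a2.1 a2.2, ch_mv a1.1 a1.2, ch_mv a0.1 a0.2,
    ch_mv b3.1 b3.2, ch_mv b2.1 b2.2, ch_mv b1.1 b1.2, ch_mv b0.1 b0.2]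
  -- Both paths move the same four beads, only in a different order.
  rcases e1 with ⟨rfl, rfl⟩ | ⟨rfl, rfl⟩ <;> rcases e2 with ⟨rfl, rfl⟩ | ⟨rfl, rfl⟩ <;> ring

theorem Good.not_raised_twice {p q t : ℤ} (hp : Good e B (a + e * p))
    (hq : Good e B (a + s + e * q)) (h : ∀ i ≤ q, row e B a i < row e B a p)
    (ht : Good e (mv (mv B (a + e * p)) (a + s + e * q)) (a + s + e * t)) (i : ℤ) :
    row e (mv (mv (mv B (a + e * p)) (a + s + e * q)) (a + s + e * t)) a i < row e B a p := by
  have he2 : 2 ≤ e := by omega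
  have hq1 := (Good.commute_adj he hB hs hp hq (Or.inr h)).1
  have hp' := (good_iff e B _ _).1 hp
  have hq' := (good_iff e B _ _).1 hq
  have m1 := hB.mv (a + e * p)
  have m2 := m1.mv (a + s + e * q)
  have ht' := (good_iff _ _ _ _).1 ht
  rw [row_mv_self he2 m1 hq1, row_mv_adj he2 hB he hs hp] at ht'
  rw [row_mv_adj' he m2 hs ht, row_mv_adj' he m1 hs hq1, row_mv_self he2 hB hp]
  exact (hp'.not_raised_twice hq' (row_le_succ he hB _) h ht').2 i

end adjacent

/-- Each side is either a commuting square or a quartic relation. The heights agree along matched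
paths and the two relations restore the height of the first colour at different times, so both sides
are of the same kind; then the known path can be exchanged for the other one on both sides. -/
theorem matched_adj {e n : ℕ} (he : 3 ≤ e) (hn : ∀ m ≤ n, Matched e m) {B C : Set ℤ}
    (hB : Maya B) (hC : Maya C) {a s p P : ℤ} (hs : s = 1 ∨ s = -1)
    (hp : Good e B (a + e * p)) (hP : Good e C (-a + e * P))
    (h : MP e n (mv B (a + e * p)) (mv C (-a + e * P))) {q : ℤ}
    (hq : Good e B (a + s + e * q)) :
    ∃ Q, Good e C (-a + -s + e * Q) ∧ MP e n (mv B (a + s + e * q)) (mv C (-a + -s + e * Q)) := by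
  have he2 : 2 ≤ e := by omega
  have hs' : -s = 1 ∨ -s = -1 := by omega
  have hneg : ∀ x, -(a + s) + x = -a + -s + x := fun x => by ring
  have hneg' : -(a + s) = -a + -s := by ring
  have dvd1 : ∀ u v : ℤ, (e : ℤ) ∣ a + s + e * u + (-a + -s + e * v) := fun u v => ⟨u + v, by ring⟩
  have dvd2 : ∀ u v : ℤ, (e : ℤ) ∣ a + e * u + (-a + e * v) := fun u v => ⟨u + v, by ring⟩
  have hp' := (good_iff e B _ _).1 hp
  have hq' := (good_iff e B _ _).1 hq
  have hP' := (good_iff e C _ _).1 hP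
  have mB1 := hB.mv (a + e * p)
  have mC1 := hC.mv (-a + e * P)
  have ra := row_mv_self he2 hB hp
  have rb := row_mv_adj he2 hB he hs hp
  have Ra := row_mv_self he2 hC hP
  have Rb := row_mv_adj he2 hC he hs' hP
  -- partners of good beads
  have partner : ∀ m ≤ n, ∀ {B' C' : Set ℤ}, MP e m B' C' → ∀ {b u : ℤ}, Good e B' (b + e * u) →
      ∃ v m', m = m' + 1 ∧ Good e C' (-b + e * v) ∧ MP e m' (mv B' (b + e * u)) (mv C' (-b + e * v)) := by
    intro m hm B' C' h' b u hu
    obtain ⟨m', y, h1, ⟨t, ht⟩, h2, h3⟩ := hn m hm B' C' h' _ hu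
    obtain rfl : y = -b + e * (t - u) := by linear_combination ht
    exact ⟨_, m', h1, h2, h3⟩
  have uniq : ∀ {D : Set ℤ} {b u v : ℤ}, Good e D (b + e * u) → Good e D (b + e * v) → u = v :=
    fun h1 h2 => ((good_iff _ _ _ _).1 h1).unique ((good_iff _ _ _ _).1 h2)
  have hts : ∀ m ≤ n, ∀ {B' C' : Set ℤ}, MP e m B' C' → ∀ b k : ℤ, (∃ i, k ≤ row e B' b i) →
      ∃ i, k ≤ row e C' (-b) i := fun m hm B' C' h' b k hk =>
    h'.heights he2 (fun m' hm' => hn m' (by omega)) b k hk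
  have hts' : ∀ m ≤ n, ∀ {B' C' : Set ℤ}, MP e m B' C' → ∀ b k : ℤ, (∃ i, k ≤ row e C' (-b) i) →
      ∃ i, k ≤ row e B' b i := fun m hm B' C' h' b k hk => by
    simpa using h'.symm.heights he2 (fun m' hm' => hn m' (by omega)) (-b) k hk
  -- the heights agree
  have hval : row e B a p = row e C (-a) P := by
    have key : ∀ {D : Set ℤ}, Maya D → ∀ {b u k : ℤ}, Good e D (b + e * u) →
        (∃ i, k ≤ row e (mv D (b + e * u)) b i) → k ≤ row e D b u - 1 := by
      rintro D hD b u k hu ⟨i, hi⟩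
      have hu' := (good_iff e D _ _).1 hu
      rw [row_mv_self he2 hD hu] at hi
      rcases le_or_gt i u with h3 | h3
      · rw [dn_le _ h3] at hi; have := hu'.2.1 i; omega
      · rw [dn_gt _ h3] at hi; have := hu'.2.2 i h3; omega
    have key2 : ∀ {D : Set ℤ}, Maya D → ∀ {b u : ℤ}, Good e D (b + e * u) →
        ∃ i, row e D b u - 1 ≤ row e (mv D (b + e * u)) b i := by
      intro D hD b u hu
      refine ⟨u + 1, ?_⟩
      rw [row_mv_self he2 hD hu, dn_gt _ (by omega)]
      have := row_le_succ he hD b u; omega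
    have h1 := key hC hP (hts n le_rfl h a _ (key2 hB hp))
    have h2 := key hB hp (hts' n le_rfl h a _ (key2 hC hP))
    omega
  -- a square on the right whenever the heights allow it
  have square : ∀ Q, Good e C (-a + -s + e * Q) →
      ((∀ i ≤ P, row e C (-a + -s) i < row e C (-a + -s) Q) ∨
        ∀ i ≤ Q, row e C (-a) i < row e C (-a) P) →
      ((∀ i ≤ p, row e B (a + s) i < row e B (a + s) q) ∨
        ∀ i ≤ q, row e B a i < row e B a p) →
      MP e n (mv B (a + s + e * q)) (mv C (-a + -s + e * Q)) := by
    intro Q hQ hc hb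
    obtain ⟨b1, b2⟩ := hp.commute_adj he hB hs hq hb
    obtain ⟨c1, c2⟩ := hP.commute_adj he hC hs' hQ hc
    obtain ⟨v, m', rfl, hv, hm⟩ := partner n le_rfl h b1
    rw [hneg] at hv hm
    obtain rfl := uniq c1 hv
    exact MP.square he2 hB hC (dvd2 _ _) hp hq b1 b2 hP hQ c1 c2 hm
  by_cases hA : ∀ i ≤ p, row e B (a + s) i < row e B (a + s) q
  · -- the left side does not raise the height of the second colour
    obtain ⟨b1, b2⟩ := hp.commute_adj he hB hs hq (Or.inl hA)
    obtain ⟨v, m', rfl, hv, hm⟩ := partner n le_rfl h b1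
    rw [hneg] at hv hm
    have hpq := (hp'.commute hq' hA).1
    -- Since `p < q`, the second move restores the height of the first colour. The right side must
    -- show the same, and `GoodF.of_raised` turns this into commutation there.
    have hr : ∃ i, row e B a p ≤ row e (mv (mv B (a + e * p)) (a + s + e * q)) a i := by
      refine ⟨p + 1, ?_⟩
      rw [row_mv_adj' he mB1 hs b1, ra, upw_le _ (by omega), dn_gt _ (by omega)]
      have := row_le_succ he hB a p; omega
    obtain ⟨i, hi⟩ := hts _ (by omega) hm a _ hr
    rw [row_mv_adj' he mC1 hs' hv, Ra, hval] at hi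
    rw [good_iff, Rb] at hv
    obtain ⟨hv1, hv2⟩ := hP'.of_raised hv hi
    rw [← good_iff] at hv1
    exact ⟨v, hv1, square v hv1 (Or.inl hv2) (Or.inl hA)⟩
  -- otherwise the second colour has a good bead on the right
  obtain ⟨j, hjp, hj⟩ : ∃ i ≤ p, row e B (a + s) i = row e B (a + s) q := by
    push Not at hA
    obtain ⟨j, hjp, hj⟩ := hA
    exact ⟨j, hjp, le_antisymm (hq'.2.1 j) hj⟩
  -- The move in row `p` raises the second colour to height at least two, hence also on the right
  -- after the move in row `P`. That move contributes at most one, so a positive height was there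
  -- before it.
  have hex : ∃ Q, Good e C (-a + -s + e * Q) := by
    obtain ⟨i, hi⟩ := hts n le_rfl h (a + s) (row e B (a + s) q + 1)
      ⟨j, by rw [rb, upw_le _ hjp, hj]⟩
    rw [hneg', Rb] at hi
    have : 0 < row e C (-a + -s) i := by
      have := hq'.1
      unfold upw at hi; split_ifs at hi <;> omega
    obtain ⟨Q, hQ, -⟩ := exists_good he2 hC this
    exact ⟨Q, hQ⟩
  obtain ⟨Q, hQ⟩ := hex
  refine ⟨Q, hQ, ?_⟩
  have hQ' := (good_iff e C _ _).1 hQ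
  by_cases hA' : ∀ i ≤ P, row e C (-a + -s) i < row e C (-a + -s) Q
  · -- impossible unless the left side is a square
    by_cases hBb : ∀ i ≤ q, row e B a i < row e B a p
    · exact square Q hQ (Or.inl hA') (Or.inr hBb)
    -- A quartic relation on the left keeps the first colour low after two moves, while a commuting
    -- square on the right has already restored its height.
    exfalso
    push Not at hBb
    obtain ⟨j', hj'q, hj'⟩ := hBb
    obtain ⟨q1, q2, p1, p2, p3, q3, B1, B2, B3, B4, C1, C2, C3, rfl, g1, rfl, g2, rfl, g3, rfl, rfl,
      k1, rfl, k2, rfl, k3, heq, r1, r2⟩ := hp.quartic he hB hs hq ⟨j, hjp, hj⟩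
        ⟨j', hj'q, le_antisymm (hp'.2.1 j') hj'⟩
    obtain ⟨c1, c2⟩ := hP.commute_adj he hC hs' hQ (Or.inl hA')
    obtain ⟨v, m', rfl, hv, hm⟩ := partner n le_rfl h g1
    rw [hneg] at hv hm
    obtain rfl := uniq c1 hv
    have hPQ := (hP'.commute hQ' hA').1
    obtain ⟨i, hi⟩ := hts' _ (by omega) hm a (row e C (-a) P) ⟨P + 1, by
      rw [row_mv_adj' he mC1 hs' c1, Ra, upw_le _ (by omega), dn_gt _ (by omega)]
      have := row_le_succ he hC (-a) P; omega⟩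
    have := r1 i
    omega
  obtain ⟨J, hJP, hJ⟩ : ∃ i ≤ P, row e C (-a + -s) i = row e C (-a + -s) Q := by
    push Not at hA'
    obtain ⟨j, hjp, hj⟩ := hA'
    exact ⟨j, hjp, le_antisymm (hQ'.2.1 j) hj⟩
  by_cases hBb : ∀ i ≤ q, row e B a i < row e B a p
  · by_cases hCb : ∀ i ≤ Q, row e C (-a) i < row e C (-a) P
    · exact square Q hQ (Or.inr hCb) (Or.inr hBb)
    -- Now the right side is quartic and restores the height with the third move, while the
    -- commuting left side never does.
    exfalso
    push Not at hCb
    obtain ⟨J', hJ'Q, hJ'⟩ := hCb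
    obtain ⟨q1, q2, p1, p2, p3, q3, D1, D2, D3, D4, C1, C2, C3, rfl, g1, rfl, g2, rfl, g3, rfl, rfl,
      k1, rfl, k2, rfl, k3, heq, r1, r2⟩ := hP.quartic he hC hs' hQ ⟨J, hJP, hJ⟩
        ⟨J', hJ'Q, le_antisymm (hP'.2.1 J') hJ'⟩
    obtain ⟨b1, b2⟩ := hp.commute_adj he hB hs hq (Or.inr hBb)
    obtain ⟨v, m', rfl, hv, hm⟩ := partner n le_rfl h b1
    rw [hneg] at hv hm
    obtain rfl := uniq g1 hv
    obtain ⟨m'', y, rfl, ⟨t, ht⟩, hy, hm2⟩ := hn m' (by omega) _ _ hm.symm _ g2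
    obtain rfl : y = a + s + e * (t - q2) := by linear_combination ht
    have hlow := hp.not_raised_twice he hB hs hq hBb hy
    obtain ⟨i, hi⟩ := hts' _ (by omega) hm2.symm a _ r2
    have := hlow i
    omega
  · push Not at hBb
    obtain ⟨j', hj'q, hj'⟩ := hBb
    obtain ⟨q1, q2, p1, p2, p3, q3, B1, B2, B3, B4, C1, C2, C3, rfl, g1, rfl, g2, rfl, g3, rfl, rfl,
      k1, rfl, k2, rfl, k3, heq, r1, r2⟩ := hp.quartic he hB hs hq ⟨j, hjp, hj⟩
        ⟨j', hj'q, le_antisymm (hp'.2.1 j') hj'⟩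
    obtain ⟨v1, m1, rfl, hv1, hm1⟩ := partner n le_rfl h g1
    rw [hneg] at hv1 hm1
    obtain ⟨v2, m2, rfl, hv2, hm2⟩ := partner m1 (by omega) hm1 g2
    rw [hneg] at hv2 hm2
    by_cases hCb : ∀ i ≤ Q, row e C (-a) i < row e C (-a) P
    · exfalso
      have c1 := (hP.commute_adj he hC hs' hQ (Or.inr hCb)).1
      obtain rfl := uniq c1 hv1
      have hlow := hP.not_raised_twice he hC hs' hQ hCb hv2
      obtain ⟨i, hi⟩ := hts _ (by omega) hm2 a _ r2
      have := hlow i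
      omega
    push Not at hCb
    obtain ⟨J', hJ'Q, hJ'⟩ := hCb
    obtain ⟨Q1, Q2, P1, P2, P3, Q3, E1, E2, E3, E4, F1, F2, F3, rfl, G1, rfl, G2, rfl, G3, rfl, rfl,
      K1, rfl, K2, rfl, K3, Heq, R1, R2⟩ := hP.quartic he hC hs' hQ ⟨J, hJP, hJ⟩
        ⟨J', hJ'Q, le_antisymm (hP'.2.1 J') hJ'⟩
    obtain rfl := uniq G1 hv1
    obtain rfl := uniq G2 hv2
    -- Both sides are quartic: follow the known path for four moves to the common end and return
    -- along the path that starts with the second colour.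
    obtain ⟨v3, m3, rfl, hv3, hm3⟩ := partner m2 (by omega) hm2 g3
    obtain rfl := uniq G3 hv3
    rw [heq, Heq] at hm3
    exact MP.step _ _ _ _ _ (dvd2 _ _) k1 K1 (MP.step _ _ _ _ _ (dvd2 _ _) k2 K2
      (MP.step _ _ _ _ _ (dvd1 _ _) k3 K3 hm3))

/-- Compare the given good bead with the first move of the path. Equal colours give equal beads,
adjacent colours are `matched_adj`, and all other colours do not influence each other. -/
theorem matched_succ {e n : ℕ} (he : 3 ≤ e) (hn : ∀ m ≤ n, Matched e m) : Matched e (n + 1) := by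
  have he2 : 2 ≤ e := by omega
  intro B C h z hz
  have hBC := h.maya
  cases h with
  | step n B C x y hxy hx hy h =>
  obtain ⟨hB, hC⟩ := hBC
  obtain ⟨t, ht⟩ := hxy
  obtain rfl : y = -x + e * t := by linear_combination ht
  have hx0 : Good e B (x + e * 0) := by simpa using hx
  have h0 : MP e n (mv B (x + e * 0)) (mv C (-x + e * t)) := by simpa using h
  by_cases h1 : (e : ℤ) ∣ z - x
  · obtain rfl := hx.unique hz h1
    exact ⟨n, _, rfl, ⟨t, ht⟩, hy, h⟩
  have adj : ∀ s : ℤ, s = 1 ∨ s = -1 → (e : ℤ) ∣ z - x - s →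
      ∃ m y, n + 1 = m + 1 ∧ (e : ℤ) ∣ z + y ∧ Good e C y ∧ MP e m (mv B z) (mv C y) := by
    rintro s hs ⟨q, hq⟩
    obtain rfl : z = x + s + e * q := by linear_combination hq
    obtain ⟨Q, hQ, hm⟩ := matched_adj he hn hB hC hs hx0 hy h0 hz
    exact ⟨n, _, rfl, ⟨q + Q, by ring⟩, hQ, hm⟩
  by_cases h2 : (e : ℤ) ∣ z - x - 1
  · exact adj 1 (Or.inl rfl) h2
  by_cases h3 : (e : ℤ) ∣ z - x + 1
  · exact adj (-1) (Or.inr rfl) (by simpa using h3)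
  -- far colours
  have far : ∀ {D : Set ℤ}, Maya D → ∀ {u v : ℤ}, ¬ (e : ℤ) ∣ v - u → ¬ (e : ℤ) ∣ v - u - 1 →
      ¬ (e : ℤ) ∣ v - u + 1 → Good e D u → (Good e (mv D u) v ↔ Good e D v) := by
    intro D hD u v k1 k2 k3 hu
    have hu0 : Good e D (u + e * 0) := by simpa using hu
    have := row_mv_far he2 hD (a := u) (b := v) (p := 0)
      (by rwa [← dvd_neg, neg_sub]) (by rwa [← dvd_neg, show -(u - v + 1) = v - u - 1 by ring])
      (by rwa [← dvd_neg, show -(u - v - 1) = v - u + 1 by ring]) hu0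
    have a1 := good_iff e (mv D u) v 0
    have a2 := good_iff e D v 0
    simp only [mul_zero, add_zero] at this a1 a2
    rw [a1, a2, this]
  have g1 := (far hB h1 h2 h3 hx).2 hz
  obtain ⟨m, w, rfl, ⟨r, hr⟩, hw, hm⟩ := hn n le_rfl _ _ h _ g1
  have k1 : ¬ (e : ℤ) ∣ w - (-x + e * t) := fun ⟨k, hk⟩ => h1 ⟨r - k - t, by linear_combination hr - hk⟩
  have k2 : ¬ (e : ℤ) ∣ w - (-x + e * t) - 1 := fun ⟨k, hk⟩ =>
    h3 ⟨r - k - t, by linear_combination hr - hk⟩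
  have k3 : ¬ (e : ℤ) ∣ w - (-x + e * t) + 1 := fun ⟨k, hk⟩ =>
    h2 ⟨r - k - t, by linear_combination hr - hk⟩
  have hw' := (far hC k1 k2 k3 hy).1 hw
  have n1 : ¬ (e : ℤ) ∣ x - z := by rwa [← dvd_neg, neg_sub]
  have n2 : ¬ (e : ℤ) ∣ x - z - 1 := by rwa [← dvd_neg, show -(x - z - 1) = z - x + 1 by ring]
  have n3 : ¬ (e : ℤ) ∣ x - z + 1 := by rwa [← dvd_neg, show -(x - z + 1) = z - x - 1 by ring]
  have l1 : ¬ (e : ℤ) ∣ (-x + e * t) - w := by rwa [← dvd_neg, neg_sub]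
  have l2 : ¬ (e : ℤ) ∣ (-x + e * t) - w - 1 := by
    rwa [← dvd_neg, show -((-x + e * t) - w - 1) = w - (-x + e * t) + 1 by ring]
  have l3 : ¬ (e : ℤ) ∣ (-x + e * t) - w + 1 := by
    rwa [← dvd_neg, show -((-x + e * t) - w + 1) = w - (-x + e * t) - 1 by ring]
  exact ⟨m + 1, w, rfl, ⟨r, hr⟩, hw', MP.square he2 hB hC ⟨t, ht⟩ hx hz g1 ((far hB n1 n2 n3 hz).2 hx)
    hy hw' hw ((far hC l1 l2 l3 hw').2 hy) hm⟩

theorem matched {e : ℕ} (he : 3 ≤ e) (n : ℕ) : Matched e n := by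
  have : ∀ m ≤ n, Matched e m := by
    induction n with
    | zero => intro m hm; rw [Nat.le_zero.1 hm]; exact matched_zero (by omega)
    | succ n ih =>
      intro m hm
      rcases hm.lt_or_eq with h | rfl
      · exact ih m (by omega)
      · exact matched_succ he ih
  exact this n le_rfl

/-! ### Reflections on two adjacent runners -/

/-- `(L', R')` is obtained from the pair of runners `(L, R)` by moving the beads in the rows of `F`
from `R` to `L`; the rows of `F` are the smallest records of the signature, and their number is the
difference of the levels. -/
structure Flip (L R L' R' : Set ℤ) (F : Finset ℤ) : Prop where
  mayaL : Maya L
  mayaR : Maya R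
  mayaL' : Maya L'
  mayaR' : Maya R'
  mem : ∀ f ∈ F, f ∉ L ∧ f ∈ R
  memL' : ∀ x, x ∈ L' ↔ x ∈ L ∨ x ∈ F
  memR' : ∀ x, x ∈ R' ↔ x ∈ R ∧ x ∉ F
  record : ∀ f ∈ F, ∀ r, f < r → nb 1 R r - nb 1 L r < nb 1 R f - nb 1 L f
  init : ∀ f ∈ F, ∀ s < f, (∀ r, s < r → nb 1 R r - nb 1 L r < nb 1 R s - nb 1 L s) → s ∈ F
  card : (F.card : ℤ) = lev 1 R 0 - lev 1 L 0

/-- Rows common to the two active ranges: once there is a gap on `R` it stays. -/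
def Star (L R : Set ℤ) : Prop :=
  ∀ t, 0 < mult 1 L t → 0 < mult 1 R t → t - 1 ∉ R → t ∉ R

theorem exists_gap_bead {R : Set ℤ} {s f : ℤ} (hsf : s < f) (hs : s ∉ R) (hf : f ∈ R) :
    ∃ q, s < q ∧ q ≤ f ∧ q - 1 ∉ R ∧ q ∈ R := by
  obtain ⟨u, ⟨hu1, hu2⟩, hmax⟩ := Int.exists_greatest_of_bdd (P := fun x => x ≤ f ∧ x ∉ R)
    ⟨f, fun x hx => hx.1⟩ ⟨s, hsf.le, hs⟩
  have hsu := hmax s ⟨hsf.le, hs⟩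
  have huf : u ≠ f := by rintro rfl; exact hu2 hf
  refine ⟨u + 1, by omega, by omega, by simpa using hu2, ?_⟩
  by_contra hc
  have := hmax (u + 1) ⟨by omega, hc⟩
  omega

section one

variable {P : Set ℤ} (hP : Maya P)
include hP

theorem nb_one_rec (x : ℤ) : nb 1 P x = ch P x + nb 1 P (x + 1) := by
  simpa using nb_rec one_pos hP x

theorem ng_one_rec (x : ℤ) : ng 1 P (x + 1) = 1 - ch P x + ng 1 P x := by
  simpa using ng_rec one_pos hP x

theorem lev_one (x : ℤ) : lev 1 P x = lev 1 P 0 - x := by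
  simpa using lev_add_mul one_pos hP 0 x

theorem nb_one_anti {x y : ℤ} (h : x ≤ y) : nb 1 P y ≤ nb 1 P x := by
  have := nb_add_mul_le one_pos hP x (y - x).toNat
  rwa [show x + ((1 : ℕ) : ℤ) * ((y - x).toNat : ℤ) = y by push_cast; omega] at this

theorem ng_one_mono {x y : ℤ} (h : x ≤ y) : ng 1 P x ≤ ng 1 P y := by
  have := ng_add_mul_le one_pos hP x (y - x).toNat
  rwa [show x + ((1 : ℕ) : ℤ) * ((y - x).toNat : ℤ) = y by push_cast; omega] at this

theorem nb_one_pos {x : ℤ} : 0 < nb 1 P x ↔ ∃ y, x ≤ y ∧ y ∈ P := by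
  rw [nb_pos_iff one_pos hP]
  constructor
  · rintro ⟨i, hi⟩; exact ⟨_, by push_cast; omega, hi⟩
  · rintro ⟨y, hy, h⟩
    exact ⟨(y - x).toNat, by rwa [show x + ((1 : ℕ) : ℤ) * ((y - x).toNat : ℤ) = y by push_cast; omega]⟩

theorem ng_one_pos {x : ℤ} : 0 < ng 1 P x ↔ ∃ y, y < x ∧ y ∉ P := by
  rw [ng_pos_iff one_pos hP]
  constructor
  · rintro ⟨i, hi⟩; exact ⟨_, by push_cast; omega, hi⟩
  · rintro ⟨y, hy, h⟩
    exact ⟨(x - y - 1).toNat, by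
      rwa [show x - ((1 : ℕ) : ℤ) * (((x - y - 1).toNat : ℤ) + 1) = y by push_cast; omega]⟩

theorem mult_one_pos {x : ℤ} : 0 < mult 1 P x ↔ (∃ y, x ≤ y ∧ y ∈ P) ∧ ∃ y, y < x ∧ y ∉ P := by
  unfold mult; rw [lt_min_iff, nb_one_pos hP, ng_one_pos hP]

end one

theorem card_filter_ge (F : Finset ℤ) (x : ℤ) : ((F.filter (x ≤ ·)).card : ℤ) =
    (if x ∈ F then 1 else 0) + (F.filter (x + 1 ≤ ·)).card := by
  have h : F.filter (x ≤ ·) = (if x ∈ F then {x} else ∅) ∪ F.filter (x + 1 ≤ ·) := by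
    ext y
    split_ifs with hx <;> simp only [Finset.mem_filter, Finset.mem_union, Finset.mem_singleton,
      Finset.notMem_empty, false_or]
    · constructor
      · rintro ⟨h1, h2⟩; by_cases h3 : y = x
        · exact Or.inl h3
        · exact Or.inr ⟨h1, by omega⟩
      · rintro (rfl | h1)
        · exact ⟨hx, le_rfl⟩
        · exact ⟨h1.1, by omega⟩
    · constructor
      · rintro ⟨h1, h2⟩
        have : y ≠ x := by rintro rfl; exact hx h1
        exact ⟨h1, by omega⟩
      · rintro h1; exact ⟨h1.1, by omega⟩
  rw [h, Finset.card_union_of_disjoint]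
  · split_ifs <;> simp
  · rw [Finset.disjoint_left]
    intro y hy hy'
    rw [Finset.mem_filter] at hy'
    split_ifs at hy
    · rw [Finset.mem_singleton] at hy; omega
    · simp at hy

theorem card_filter_lt (F : Finset ℤ) (x : ℤ) : ((F.filter (· < x + 1)).card : ℤ) =
    (if x ∈ F then 1 else 0) + (F.filter (· < x)).card := by
  have h1 := Finset.card_filter_add_card_filter_not (s := F) (x ≤ ·)
  have h2 := Finset.card_filter_add_card_filter_not (s := F) (x + 1 ≤ ·)
  have h3 := card_filter_ge F x
  simp only [not_le] at h1 h2
  omega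

theorem Star.conj {A B : Set ℤ} (hAB : Star A B) : Star (conj A) (conj B) := by
  intro t hA hB h1 h2
  rw [mult_conj] at hA hB
  simp only [Nat.cast_one] at hA hB
  have h3 := hAB (-t) (by convert hA using 2; ring) (by convert hB using 2; ring)
  have h1' : -t ∈ B := by
    by_contra hc; exact h1 (by show -1 - (t - 1) ∉ B; rwa [show -1 - (t - 1) = -t by ring])
  have h2' : -t - 1 ∉ B := by
    have : -1 - t ∉ B := h2
    rwa [show -t - 1 = -1 - t by ring]
  exact h3 h2' h1'

namespace Flip

variable {L R L' R' : Set ℤ} {F : Finset ℤ} (h : Flip L R L' R' F)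
include h

theorem ch_R' (x : ℤ) : ch R' x = ch R x - if x ∈ F then 1 else 0 := by
  have := h.memR' x
  by_cases hx : x ∈ F
  · rw [ch_of_notMem (by tauto), ch_of_mem (h.mem x hx).2]; simp [hx]
  · unfold ch; simp [this, hx]

theorem ch_L' (x : ℤ) : ch L' x = ch L x + if x ∈ F then 1 else 0 := by
  have := h.memL' x
  by_cases hx : x ∈ F
  · rw [ch_of_mem (by tauto), ch_of_notMem (h.mem x hx).1]; simp [hx]
  · unfold ch; simp [this, hx]

theorem nbR' (t : ℤ) : nb 1 R' t = nb 1 R t - (F.filter (t ≤ ·)).card := by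
  obtain ⟨hi, hh⟩ := h.mayaR.2
  obtain ⟨hi', hh'⟩ := h.mayaR'.2
  refine eq_of_step_right (e := 1) one_pos (f := nb 1 R')
    (g := fun t => nb 1 R t - (F.filter (t ≤ ·)).card) (fun x => ?_) (hi := max hi hi')
    (fun x hx => ?_) t
  · have a1 := nb_one_rec h.mayaR x
    have a2 := nb_one_rec h.mayaR' x
    have a3 := h.ch_R' x
    have a4 := card_filter_ge F x
    push_cast
    linarith
  · simp only [ge_iff_le, max_le_iff] at hx
    rw [nb_eq_zero hh hx.1, nb_eq_zero hh' hx.2, Finset.filter_false_of_mem]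
    · simp
    · intro f hf hc
      exact hh f (by omega) (h.mem f hf).2

theorem nbL' (t : ℤ) : nb 1 L' t = nb 1 L t + (F.filter (t ≤ ·)).card := by
  obtain ⟨hi, hh⟩ := h.mayaL.2
  obtain ⟨hi', hh'⟩ := h.mayaL'.2
  refine eq_of_step_right (e := 1) one_pos (f := nb 1 L')
    (g := fun t => nb 1 L t + (F.filter (t ≤ ·)).card) (fun x => ?_) (hi := max hi hi')
    (fun x hx => ?_) t
  · have a1 := nb_one_rec h.mayaL x
    have a2 := nb_one_rec h.mayaL' x
    have a3 := h.ch_L' x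
    have a4 := card_filter_ge F x
    push_cast
    linarith
  · simp only [ge_iff_le, max_le_iff] at hx
    rw [nb_eq_zero hh hx.1, nb_eq_zero hh' hx.2, Finset.filter_false_of_mem]
    · simp
    · intro f hf hc
      exact hh' f (by omega) ((h.memL' f).2 (Or.inr hf))

theorem ngR' (t : ℤ) : ng 1 R' t = ng 1 R t + (F.filter (· < t)).card := by
  obtain ⟨lo, hh⟩ := h.mayaR.1
  obtain ⟨lo', hh'⟩ := h.mayaR'.1
  refine eq_of_step_left (e := 1) one_pos (f := ng 1 R')
    (g := fun t => ng 1 R t + (F.filter (· < t)).card) (fun x => ?_) (lo := min lo lo')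
    (fun x hx => ?_) t
  · have a1 := ng_one_rec h.mayaR x
    have a2 := ng_one_rec h.mayaR' x
    have a3 := h.ch_R' x
    have a4 := card_filter_lt F x
    push_cast
    linarith
  · simp only [lt_min_iff] at hx
    rw [ng_eq_zero hh (by push_cast; omega), ng_eq_zero hh' (by push_cast; omega),
      Finset.filter_false_of_mem]
    · simp
    · intro f hf hc
      exact ((h.memR' f).1 (hh' f (by omega))).2 hf

theorem ngL' (t : ℤ) : ng 1 L' t = ng 1 L t - (F.filter (· < t)).card := by
  obtain ⟨lo, hh⟩ := h.mayaL.1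
  obtain ⟨lo', hh'⟩ := h.mayaL'.1
  refine eq_of_step_left (e := 1) one_pos (f := ng 1 L')
    (g := fun t => ng 1 L t - (F.filter (· < t)).card) (fun x => ?_) (lo := min lo lo')
    (fun x hx => ?_) t
  · have a1 := ng_one_rec h.mayaL x
    have a2 := ng_one_rec h.mayaL' x
    have a3 := h.ch_L' x
    have a4 := card_filter_lt F x
    push_cast
    linarith
  · simp only [lt_min_iff] at hx
    rw [ng_eq_zero hh (by push_cast; omega), ng_eq_zero hh' (by push_cast; omega),
      Finset.filter_false_of_mem]
    · simp
    · intro f hf hc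
      exact (h.mem f hf).1 (hh f (by omega))

omit h in
theorem card_split (t : ℤ) : ((F.filter (t ≤ ·)).card : ℤ) + (F.filter (· < t)).card = F.card := by
  have := Finset.card_filter_add_card_filter_not (s := F) (t ≤ ·)
  simp only [not_le] at this
  exact_mod_cast this

/-- Heights drop by at least one at every element of `F`. -/
theorem card_le {f : ℤ} (hf : f ∈ F) {r : ℤ} (hr : f < r) :
    ((F.filter fun x => f ≤ x ∧ x < r).card : ℤ) ≤
      (nb 1 R f - nb 1 L f) - (nb 1 R r - nb 1 L r) := by
  have h1 := h.record f hf r hr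
  have := Finset.card_le_card_of_injOn (s := F.filter fun x => f ≤ x ∧ x < r)
    (t := Finset.Ioc (nb 1 R r - nb 1 L r) (nb 1 R f - nb 1 L f)) (fun x => nb 1 R x - nb 1 L x)
    (fun x hx => ?_) (fun x hx y hy hxy => ?_)
  · rw [Int.card_Ioc] at this
    omega
  · simp only [Finset.coe_filter, Set.mem_ofPred_eq] at hx
    simp only [Finset.coe_Ioc, Set.mem_Ioc]
    refine ⟨h.record x hx.1 r hx.2.2, ?_⟩
    rcases hx.2.1.eq_or_lt with rfl | h2
    · exact le_rfl
    · exact (h.record f hf x h2).le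
  · simp only [Finset.coe_filter, Set.mem_ofPred_eq] at hx hy
    rcases lt_trichotomy x y with h2 | h2 | h2
    · exact absurd hxy (h.record x hx.1 y h2).ne'
    · exact h2
    · exact absurd hxy (h.record y hy.1 x h2).ne

omit h in
theorem height_step (hL : Maya L) (hR : Maya R) (r : ℤ) :
    nb 1 R r - nb 1 L r ≤ nb 1 R (r + 1) - nb 1 L (r + 1) + 1 := by
  have a1 := nb_one_rec hR r
  have a2 := nb_one_rec hL r
  have a3 := ch_le_one R r
  have a4 := ch_nonneg L r
  omega

/-- Counterpart of `card_le`. Heights drop by at most one per row, so each intermediate value has a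
last row in which it is reached; that row is a record not beyond `f` and so belongs to `F`. -/
theorem le_card {f : ℤ} (hf : f ∈ F) {r : ℤ} (hr : r ≤ f) :
    (nb 1 R r - nb 1 L r) - (nb 1 R (f + 1) - nb 1 L (f + 1)) ≤
      ((F.filter fun x => r ≤ x ∧ x ≤ f).card : ℤ) := by
  have := Finset.card_le_card_of_surjOn (s := F.filter fun x => r ≤ x ∧ x ≤ f)
    (t := Finset.Ioc (nb 1 R (f + 1) - nb 1 L (f + 1)) (nb 1 R r - nb 1 L r))
    (fun x => nb 1 R x - nb 1 L x) ?_
  · rw [Int.card_Ioc] at this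
    omega
  · intro v hv
    simp only [Finset.coe_Ioc, Set.mem_Ioc] at hv
    have hf1 := height_step h.mayaL h.mayaR f
    have hlarge : ∀ x > f, nb 1 R x - nb 1 L x ≤ nb 1 R (f + 1) - nb 1 L (f + 1) := fun x hx => by
      have := h.record f hf x hx
      omega
    obtain ⟨s, ⟨hs1, hs2⟩, hmax⟩ := Int.exists_greatest_of_bdd
      (P := fun x => r ≤ x ∧ v ≤ nb 1 R x - nb 1 L x)
      ⟨f, fun x hx => by by_contra hc; have := hlarge x (by omega); omega⟩ ⟨r, le_rfl, hv.2⟩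
    have hrec : ∀ x > s, nb 1 R x - nb 1 L x < v := fun x hx => by
      by_contra hc
      have := hmax x ⟨by omega, by omega⟩
      omega
    have hsf : s ≤ f := by by_contra hc; have := hlarge s (by omega); omega
    have h1 := hrec (s + 1) (by omega)
    have h2 := height_step h.mayaL h.mayaR s
    have hsF : s ∈ F := by
      rcases hsf.eq_or_lt with rfl | h3
      · exact hf
      · exact h.init f hf s h3 fun x hx => by have := hrec x hx; omega
    refine ⟨s, ?_, by show nb 1 R s - nb 1 L s = v; omega⟩
    simp only [Finset.coe_filter, Set.mem_ofPred_eq]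
    exact ⟨hsF, hs1, hsf⟩

/-- If `R` had only beads from `s` to `f`, heights would decrease from `s` on and `s` would be an
earlier record, hence in `F`. -/
theorem exists_rise {f s : ℤ} (hf : f ∈ F) (hs : s < f) (hsL : s ∉ L) (hsF : s ∉ F) :
    ∃ q, s < q ∧ q ≤ f ∧ q - 1 ∉ R ∧ q ∈ R := by
  by_cases hsR : s ∈ R
  · obtain ⟨r', hr1, hr2, hr3⟩ : ∃ r', s < r' ∧ r' < f ∧ r' ∉ R := by
      by_contra hc
      push Not at hc
      -- heights decrease weakly from `s + 1` to `f`
      have mono : ∀ n : ℕ, ∀ r, s < r → r + n = f → ∀ r', r ≤ r' → r' ≤ f →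
          nb 1 R r' - nb 1 L r' ≤ nb 1 R r - nb 1 L r := by
        intro n
        induction n with
        | zero => intro r _ h2 r' h3 h4; obtain rfl : r = r' := by push_cast at h2; omega
                  exact le_rfl
        | succ n ih =>
          intro r h1 h2 r' h3 h4
          rcases h3.eq_or_lt with rfl | h5
          · exact le_rfl
          have := ih (r + 1) (by omega) (by push_cast at h2; omega) r' (by omega) h4
          have a1 := nb_one_rec h.mayaR r
          have a2 := nb_one_rec h.mayaL r
          have a3 := ch_of_mem (hc r h1 (by push_cast at h2; omega))
          have a4 := ch_le_one L r
          omega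
      refine hsF (h.init f hf s hs fun r hr => ?_)
      have a1 := nb_one_rec h.mayaR s
      have a2 := nb_one_rec h.mayaL s
      rw [ch_of_mem hsR] at a1
      rw [ch_of_notMem hsL] at a2
      have mono' := mono (f - (s + 1)).toNat (s + 1) (by omega) (by omega)
      rcases le_or_gt r f with h1 | h1
      · have := mono' r (by omega) h1; omega
      · have := mono' f (by omega) le_rfl
        have := h.record f hf r h1; omega
    obtain ⟨q, h1, h2, h3⟩ := exists_gap_bead hr2 hr3 (h.mem f hf).2
    exact ⟨q, by omega, h2, h3⟩
  · exact exists_gap_bead hs hsR (h.mem f hf).2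

/-- A bead of `L` beyond `f` would make the row where `R` rises active on both runners, against
`Star`. -/
theorem no_bead (hst : Star L R) {f s : ℤ} (hf : f ∈ F) (hs : s < f) (hsL : s ∉ L) (hsF : s ∉ F) :
    ∀ x ≥ f, x ∉ L := by
  obtain ⟨q, h1, h2, h3, h4⟩ := h.exists_rise hf hs hsL hsF
  intro x hx hxL
  exact hst q ((mult_one_pos h.mayaL).2 ⟨⟨x, by omega, hxL⟩, s, h1, hsL⟩)
    ((mult_one_pos h.mayaR).2 ⟨⟨q, le_rfl, h4⟩, q - 1, by omega, h3⟩) h3 h4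

theorem record_of_no_bead {t : ℤ} (ht : t ∈ R) (hL : ∀ x ≥ t, x ∉ L) {r : ℤ} (hr : t < r) :
    nb 1 R r - nb 1 L r < nb 1 R t - nb 1 L t := by
  have a1 := nb_one_rec h.mayaR t
  rw [ch_of_mem ht] at a1
  have a2 := nb_one_anti h.mayaR (show t + 1 ≤ r by omega)
  rw [nb_eq_zero hL hr.le, nb_eq_zero hL le_rfl]
  omega

/-- A rise of `R'` at a common active row forces `L` to be empty from `t` on, so a bead of `L'`
there comes from `F`. But then `t` is an earlier record and would have been moved. -/
theorem star (hst : Star L R) : Star L' R' := by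
  intro t hL hR h1 h2
  obtain ⟨⟨y, hy, hyL⟩, s, hs, hsL⟩ := (mult_one_pos h.mayaL').1 hL
  rw [h.memR'] at h1 h2
  rw [h.memL'] at hsL hyL
  push Not at hsL
  -- it suffices that there are no beads on `L` from row `t` on
  have key : ¬ ∀ x ≥ t, x ∉ L := fun hno => by
    rcases hyL with hyL | hyF
    · exact hno y hy hyL
    · rcases hy.eq_or_lt with rfl | hlt
      · exact h2.2 hyF
      · exact h2.2 (h.init y hyF t hlt fun r hr => h.record_of_no_bead h2.1 hno hr)
  by_cases ht : t - 1 ∈ R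
  · have hF : t - 1 ∈ F := by by_contra hc; exact h1 ⟨ht, hc⟩
    have hne : s ≠ t - 1 := by rintro rfl; exact hsL.2 hF
    have := h.no_bead hst hF (by omega) hsL.1 hsL.2
    exact key fun x hx => this x (by omega)
  · have hR' : 0 < mult 1 R t := (mult_one_pos h.mayaR).2 ⟨⟨t, le_rfl, h2.1⟩, t - 1, by omega, ht⟩
    refine key fun x hx hxL => ?_
    exact hst t ((mult_one_pos h.mayaL).2 ⟨⟨x, hx, hxL⟩, s, hs, hsL.1⟩) hR' ht h2.1

/-- The multiplicity is `nb - max lev 0`. A flip keeps the sum of the two values of `nb` and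
exchanges the two levels. -/
theorem mult_add (t : ℤ) : mult 1 L' t + mult 1 R' t = mult 1 L t + mult 1 R t := by
  have h1 := h.nbL' t
  have h2 := h.nbR' t
  have h3 := h.ngL' t
  have h4 := h.ngR' t
  have h5 := card_split (F := F) t
  have h6 := h.card
  have h7 := lev_one h.mayaL t
  have h8 := lev_one h.mayaR t
  unfold lev at h6 h7 h8
  unfold mult
  omega

/-- Movements pass from `L` to `R` only where the gap count does not change between the two runners.
A rise of `R` is excluded by `Star`, a fall by counting the moved rows. -/
theorem const_of_lt (hst : Star L R) {t : ℤ} (hD : mult 1 R t < mult 1 R' t) :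
    ch R t = ch R (t - 1) := by
  have hadd := h.mult_add t
  have hL0 := mult_nonneg 1 L' t
  have hR0 := mult_nonneg 1 R t
  obtain ⟨⟨y, hy, hyL⟩, s, hs, hsL⟩ := (mult_one_pos h.mayaL (x := t)).1 (by omega)
  obtain ⟨⟨z, hz, hzR⟩, z', hz', hzR'⟩ := (mult_one_pos h.mayaR' (x := t)).1 (by omega)
  by_cases ht : t ∈ R
  · by_cases ht' : t - 1 ∈ R
    · rw [ch_of_mem ht, ch_of_mem ht']
    · exact absurd ht (hst t ((mult_one_pos h.mayaL).2 ⟨⟨y, hy, hyL⟩, s, hs, hsL⟩)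
        ((mult_one_pos h.mayaR).2 ⟨⟨t, le_rfl, ht⟩, t - 1, by omega, ht'⟩) ht')
  by_cases ht' : t - 1 ∈ R
  swap
  · rw [ch_of_notMem ht, ch_of_notMem ht']
  exfalso
  rw [h.memR'] at hzR
  -- the first bead of `R` after row `t`
  obtain ⟨q, ⟨hq1, hq2⟩, hqmin⟩ := Int.exists_least_of_bdd (P := fun x => t ≤ x ∧ x ∈ R)
    ⟨t, fun x hx => hx.1⟩ ⟨z, hz, hzR.1⟩
  have hqt : t < q := by
    rcases hq1.eq_or_lt with rfl | h1
    · exact absurd hq2 ht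
    · exact h1
  have hq3 : q - 1 ∉ R := fun hc => by have := hqmin (q - 1) ⟨by omega, hc⟩; omega
  have hno : ∀ x ≥ q, x ∉ L := fun x hx hxL =>
    hst q ((mult_one_pos h.mayaL).2 ⟨⟨x, hx, hxL⟩, s, by omega, hsL⟩)
      ((mult_one_pos h.mayaR).2 ⟨⟨q, le_rfl, hq2⟩, q - 1, by omega, hq3⟩) hq3 hq2
  have hnbq : nb 1 R t = nb 1 R q := by
    have : ∀ n : ℕ, t + n ≤ q → nb 1 R (t + n) = nb 1 R t := by
      intro n
      induction n with
      | zero => simp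
      | succ n ih =>
        intro hn
        push_cast at hn ⊢
        have a1 := nb_one_rec h.mayaR (t + n)
        rw [ch_of_notMem fun hc => by have := hqmin (t + n) ⟨by omega, hc⟩; omega] at a1
        have := ih (by omega)
        rw [show t + ((n : ℤ) + 1) = t + n + 1 by ring]; omega
    have := this (q - t).toNat (by omega)
    rwa [show t + ((q - t).toNat : ℤ) = q by omega, eq_comm] at this
  have h1 := h.nbL' t
  have h2 := h.nbR' t
  have h3 := h.ngL' t
  have h4 := h.ngR' t
  have h5 := card_split (F := F) t
  have h6 := h.card
  have h7 := lev_one h.mayaL t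
  have h8 := lev_one h.mayaR t
  unfold lev at h6 h7 h8
  unfold mult at hD
  -- `hD` makes the number of rows of `F` above `t` exceed this bound. Heights drop at each of these
  -- rows before reaching `q`, where `L` has no beads left, so the bound holds nevertheless.
  have hx : ((F.filter (· < t)).card : ℤ) ≤ max 0 (ng 1 L t - nb 1 L t) := by
    rcases (F.filter (· < t)).eq_empty_or_nonempty with h0 | hne
    · rw [h0]; simp
    · obtain ⟨f, hfm, hfmin⟩ := (F.filter (· < t)).exists_min_image id hne
      obtain ⟨hfF, hft⟩ := Finset.mem_filter.1 hfm
      have c1 := h.card_le hfF (show f < q by omega)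
      have c2 : (F.filter (· < t)).card ≤ (F.filter fun x => f ≤ x ∧ x < q).card := by
        refine Finset.card_le_card fun x hx => ?_
        have := hfmin x hx
        rw [Finset.mem_filter] at hx ⊢
        exact ⟨hx.1, this, by omega⟩
      have c3 := lev_one h.mayaL f
      have c4 := lev_one h.mayaR f
      unfold lev at c3 c4
      have c5 := ng_one_mono h.mayaR hft.le
      have c6 := ng_nonneg 1 L f
      have c7 : nb 1 L q = 0 := nb_eq_zero hno le_rfl
      omega
  omega

theorem flip_iff (hst : Star L R) {t : ℤ} (hL : 0 < mult 1 L t) (hL' : 0 < mult 1 L' t) :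
    t ∈ F ↔ t - 1 ∈ F := by
  obtain ⟨⟨y, hy, hyL⟩, -⟩ := (mult_one_pos h.mayaL).1 hL
  obtain ⟨-, s, hs, hsL⟩ := (mult_one_pos h.mayaL').1 hL'
  rw [h.memL'] at hsL
  push Not at hsL
  constructor
  · intro ht
    exact absurd hyL (h.no_bead hst ht hs hsL.1 hsL.2 y hy)
  · intro ht
    have hne : s ≠ t - 1 := by rintro rfl; exact hsL.2 ht
    exact absurd hyL (h.no_bead hst ht (by omega) hsL.1 hsL.2 y (by omega))

theorem ch_sub (hst : Star L R) {t : ℤ} (hL : 0 < mult 1 L t) (hL' : 0 < mult 1 L' t) :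
    ch R' t - ch R' (t - 1) = ch R t - ch R (t - 1) := by
  have h1 := h.flip_iff hst hL hL'
  rw [h.ch_R', h.ch_R']
  by_cases ht : t ∈ F
  · simp [ht, h1.1 ht]
  · have : t - 1 ∉ F := fun hc => ht (h1.2 hc)
    simp [ht, this]

theorem height' (t : ℤ) : ng 1 R' t - ng 1 L' t =
    nb 1 R t - nb 1 L t + F.card - 2 * (F.filter (t ≤ ·)).card := by
  have h3 := h.ngL' t
  have h4 := h.ngR' t
  have h5 := card_split (F := F) t
  have h6 := h.card
  have h7 := lev_one h.mayaL t
  have h8 := lev_one h.mayaR t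
  unfold lev at h6 h7 h8
  omega

omit h in
theorem card_between {f r : ℤ} (hr : r ≤ f) : ((F.filter (r ≤ ·)).card : ℤ) =
    (F.filter fun x => r ≤ x ∧ x ≤ f).card + (F.filter (f + 1 ≤ ·)).card := by
  rw [← Nat.cast_add, ← Finset.card_union_of_disjoint]
  · congr 2
    ext x
    simp only [Finset.mem_filter, Finset.mem_union]
    constructor
    · rintro ⟨h1, h2⟩
      by_cases h3 : x ≤ f
      · exact Or.inl ⟨h1, h2, h3⟩
      · exact Or.inr ⟨h1, by omega⟩
    · rintro (h1 | h1)
      · exact ⟨h1.1, h1.2.1⟩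
      · exact ⟨h1.1, by omega⟩
  · rw [Finset.disjoint_left]
    intro y hy hy'
    rw [Finset.mem_filter] at hy hy'
    omega

/-- Rotating the picture exchanges the two pairs of runners. -/
theorem rotate : Flip (conj L') (conj R') (conj L) (conj R) (F.image fun x => -1 - x) := by
  have hmem : ∀ x, x ∈ F.image (fun x => -1 - x) ↔ -1 - x ∈ F := fun x => by
    simp only [Finset.mem_image]
    constructor
    · rintro ⟨y, hy, rfl⟩; simpa using hy
    · intro hx; exact ⟨_, hx, by ring⟩
  have hH : ∀ r, nb 1 (conj R') r - nb 1 (conj L') r =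
      nb 1 R (-r) - nb 1 L (-r) + F.card - 2 * (F.filter (-r ≤ ·)).card := by
    intro r
    rw [nb_conj, nb_conj, ← h.height']
    simp only [Nat.cast_one, show -1 - r + 1 = -r by ring]
  refine ⟨h.mayaL'.conj, h.mayaR'.conj, h.mayaL.conj, h.mayaR.conj, fun f hf => ?_, fun x => ?_,
    fun x => ?_, fun f hf r hr => ?_, fun f hf s hs hrec => ?_, ?_⟩
  · rw [hmem] at hf
    show ¬ (-1 - f ∉ L') ∧ -1 - f ∉ R'
    rw [h.memL', h.memR']; tauto
  · rw [hmem]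
    show -1 - x ∉ L ↔ -1 - x ∉ L' ∨ _
    have := h.mem (-1 - x)
    rw [h.memL']; tauto
  · rw [hmem]
    show -1 - x ∉ R ↔ -1 - x ∉ R' ∧ _
    have := h.mem (-1 - x)
    rw [h.memR']; tauto
  · rw [hmem] at hf
    have a1 := h.le_card hf (r := -r) (by omega)
    have a2 := card_between (F := F) (f := -1 - f) (r := -r) (by omega)
    have a3 : 0 < (F.filter fun x => -r ≤ x ∧ x ≤ -1 - f).card :=
      Finset.card_pos.2 ⟨-1 - f, Finset.mem_filter.2 ⟨hf, by omega, le_rfl⟩⟩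
    rw [hH, hH]
    simp only [show -1 - f + 1 = -f by ring] at a1 a2
    omega
  · rw [hmem] at hf ⊢
    by_contra hsF
    -- No row of `F` lies between `g` and `-1 - s`, so the counts at `g + 1` and `-s` agree and the
    -- rotated record condition contradicts that `g` is a record.
    obtain ⟨g, hgm, hgmax⟩ := (F.filter (· ≤ -1 - s)).exists_max_image id
      ⟨-1 - f, Finset.mem_filter.2 ⟨hf, by omega⟩⟩
    obtain ⟨hgF, hgs⟩ := Finset.mem_filter.1 hgm
    have hgs' : g ≠ -1 - s := by rintro rfl; exact hsF hgF
    have a1 := hrec (-(g + 1)) (by omega)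
    rw [hH, hH, neg_neg] at a1
    have a2 : F.filter (g + 1 ≤ ·) = F.filter (-s ≤ ·) := by
      ext x
      simp only [Finset.mem_filter]
      refine and_congr_right fun hx => ⟨fun h1 => ?_, fun h1 => by omega⟩
      by_contra hc
      have := hgmax x (Finset.mem_filter.2 ⟨hx, by omega⟩)
      simp only [id] at this
      omega
    rw [a2] at a1
    have a3 := h.record g hgF (-s) (by omega)
    have a4 := height_step h.mayaL h.mayaR g
    omega
  · rw [Finset.card_image_of_injective _ fun a b hab => by simpa using hab, lev_conj, lev_conj]
    simp only [Nat.cast_one, sub_zero, neg_add_cancel]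
    have h1 := h.nbL' 0
    have h2 := h.nbR' 0
    have h3 := h.ngL' 0
    have h4 := h.ngR' 0
    have h5 := card_split (F := F) 0
    have h6 := h.card
    unfold lev at h6 ⊢
    omega

/-- The converse is `star` for the rotated picture. -/
theorem star_iff : Star L' R' ↔ Star L R := by
  refine ⟨fun hs => ?_, h.star⟩
  have := (h.rotate.star hs.conj).conj
  rwa [conj_conj, conj_conj] at this

theorem const_of_gt (hst : Star L R) {t : ℤ} (hD : mult 1 R' t < mult 1 R t) :
    ch R' t = ch R' (t - 1) := by
  have := h.rotate.const_of_lt (h.star hst).conj (t := -t) (by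
    rw [mult_conj, mult_conj]
    simp only [Nat.cast_one]
    rwa [show -1 - -t + 1 = t by ring])
  rw [ch_conj, ch_conj, show -1 - -t = t - 1 by ring, show -1 - (-t - 1) = t by ring] at this
  omega

end Flip

/-! ### Iterated good moves of one colour -/

/-- The rows occupied by beads on the runner of `a`. -/
def rn (e : ℕ) (B : Set ℤ) (a : ℤ) : Set ℤ := {t | a + e * t ∈ B}

theorem nb_rn (e : ℕ) (B : Set ℤ) (a t : ℤ) : nb 1 (rn e B a) t = nb e B (a + e * t) := by
  unfold nb rn
  congr 2
  ext i
  simp only [Set.mem_ofPred_eq, Nat.cast_one, one_mul]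
  rw [show a + (e : ℤ) * (t + i) = a + e * t + e * i by ring]

theorem ng_rn (e : ℕ) (B : Set ℤ) (a t : ℤ) : ng 1 (rn e B a) t = ng e B (a + e * t) := by
  unfold ng rn
  congr 2
  ext i
  simp only [Set.mem_ofPred_eq, Nat.cast_one, one_mul]
  rw [show a + (e : ℤ) * (t - (i + 1)) = a + e * t - e * (i + 1) by ring]

theorem mult_rn (e : ℕ) (B : Set ℤ) (a t : ℤ) : mult 1 (rn e B a) t = mult e B (a + e * t) := by
  unfold mult; rw [nb_rn, ng_rn]

theorem lev_rn (e : ℕ) (B : Set ℤ) (a t : ℤ) : lev 1 (rn e B a) t = lev e B (a + e * t) := by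
  unfold lev; rw [nb_rn, ng_rn]

theorem ch_rn (e : ℕ) (B : Set ℤ) (a t : ℤ) : ch (rn e B a) t = ch B (a + e * t) := rfl

theorem Maya.rn {e : ℕ} (he : 0 < e) {B : Set ℤ} (hB : Maya B) (a : ℤ) : Maya (rn e B a) := by
  obtain ⟨⟨lo, hlo⟩, hi, hhi⟩ := hB
  have b0 := abs_nonneg a
  refine ⟨⟨-|lo| - |a|, fun t ht => hlo _ ?_⟩, |hi| + |a|, fun t ht => hhi _ ?_⟩
  · have b1 := abs_nonneg lo
    have b2 := neg_abs_le lo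
    have b3 := le_abs_self a
    have : e * t ≤ t := by nlinarith
    omega
  · have b1 := abs_nonneg hi
    have b2 := le_abs_self hi
    have b3 := neg_abs_le a
    have : t ≤ e * t := by nlinarith
    omega

theorem row_eq (e : ℕ) (B : Set ℤ) (a i : ℤ) :
    row e B a i = nb 1 (rn e B a) i - nb 1 (rn e B (a - 1)) i := by
  rw [nb_rn, nb_rn]; unfold row ht; rw [show a + (e : ℤ) * i - 1 = a - 1 + e * i by ring]

/-- `B'` is obtained from `B` by `n` good moves on the runner of `a`. -/
inductive EP (e : ℕ) (a : ℤ) : ℕ → Set ℤ → Set ℤ → Prop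
  | nil (B : Set ℤ) : EP e a 0 B B
  | cons (n : ℕ) (B B' : Set ℤ) (p : ℤ) : Good e B (a + e * p) → EP e a n (mv B (a + e * p)) B' →
      EP e a (n + 1) B B'

theorem EP.snoc {e : ℕ} {a : ℤ} {n : ℕ} {B B' : Set ℤ} (h : EP e a n B B') {p : ℤ}
    (hp : Good e B' (a + e * p)) : EP e a (n + 1) B (mv B' (a + e * p)) := by
  induction h with
  | nil B => exact .cons 0 _ _ p hp (.nil _)
  | cons n B B' q hq _ ih => exact .cons _ _ _ q hq (ih hp)

theorem Maya.ep {e : ℕ} {a : ℤ} {n : ℕ} {B B' : Set ℤ} (hB : Maya B) (h : EP e a n B B') : Maya B' := by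
  induction h with
  | nil B => exact hB
  | cons n B B' q hq _ ih => exact ih (hB.mv _)

theorem Maya.of_ep {e : ℕ} {a : ℤ} {n : ℕ} {B B' : Set ℤ} (h : EP e a n B B') (hB : Maya B') : Maya B := by
  induction h with
  | nil B => exact hB
  | cons n B B' q hq _ ih => exact (ih hB).of_mv

/-- Adding a good node. -/
def up (B : Set ℤ) (x : ℤ) : Set ℤ := {y | (y ∈ B ∧ y ≠ x - 1) ∨ y = x}

theorem mv_up {B : Set ℤ} {x : ℤ} (h1 : x ∉ B) (h2 : x - 1 ∈ B) : mv (up B x) x = B := by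
  ext y
  show ((y ∈ B ∧ y ≠ x - 1) ∨ y = x) ∧ y ≠ x ∨ y = x - 1 ↔ y ∈ B
  constructor
  · rintro (⟨⟨h, -⟩ | h, h'⟩ | rfl)
    · exact h
    · exact absurd h h'
    · exact h2
  · intro hy
    by_cases hc : y = x - 1
    · exact Or.inr hc
    · exact Or.inl ⟨Or.inl ⟨hy, hc⟩, by rintro rfl; exact h1 hy⟩

theorem up_mv {B : Set ℤ} {x : ℤ} (h1 : x ∈ B) (h2 : x - 1 ∉ B) : up (mv B x) x = B := by
  ext y
  show ((y ∈ B ∧ y ≠ x) ∨ y = x - 1) ∧ y ≠ x - 1 ∨ y = x ↔ y ∈ B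
  constructor
  · rintro (⟨⟨h, -⟩ | h, h'⟩ | rfl)
    · exact h
    · exact absurd h h'
    · exact h1
  · intro hy
    by_cases hc : y = x
    · exact Or.inr hc
    · exact Or.inl ⟨Or.inl ⟨hy, hc⟩, by rintro rfl; exact h2 hy⟩

/-! ### Existence, reversal and effect of chains of good moves. -/

section

variable {e : ℕ} (he : 2 ≤ e)
include he

/-- Far to the left there are no gaps above, so `nb` equals the level. The level difference is thus
a value of the height function, which supplies that many good moves. -/
theorem row_left {B : Set ℤ} (hB : Maya B) (a : ℤ) :
    ∃ lo, ∀ i ≤ lo, row e B a i = lev e B a - lev e B (a - 1) := by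
  obtain ⟨lo, hlo⟩ := (hB.rn (by omega : 0 < e) a).1
  obtain ⟨lo', hlo'⟩ := (hB.rn (by omega : 0 < e) (a - 1)).1
  refine ⟨min lo lo', fun i hi => ?_⟩
  have h1 := lev_add_mul (by omega : 0 < e) hB a i
  have h2 := lev_add_mul (by omega : 0 < e) hB (a - 1) i
  have h3 := ng_eq_zero (e := 1) hlo (x := i) (by push_cast; omega)
  have h4 := ng_eq_zero (e := 1) hlo' (x := i) (by push_cast; omega)
  rw [ng_rn] at h3 h4
  rw [row_eq, nb_rn, nb_rn]
  unfold lev at *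
  omega

theorem row_succ_ge {B : Set ℤ} (hB : Maya B) (a i : ℤ) : row e B a i - 1 ≤ row e B a (i + 1) := by
  have h1 := row_step he hB a i
  have h2 := ch_le_one B (a + e * i)
  have h3 := ch_nonneg B (a + e * i - 1)
  omega

theorem exists_ep_of_row {a : ℤ} (n : ℕ) : ∀ {B : Set ℤ}, Maya B → (∃ i, (n : ℤ) ≤ row e B a i) →
    ∃ B', EP e a n B B' := by
  induction n with
  | zero => exact fun {B} _ _ => ⟨B, .nil B⟩
  | succ n ih =>
    rintro B hB ⟨i, hi⟩
    push_cast at hi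
    obtain ⟨p, hp, hpi⟩ := exists_good he hB (a := a) (i := i) (by omega)
    have h1 := row_succ_ge he hB a p
    obtain ⟨B', hB'⟩ := ih (hB.mv _) ⟨p + 1, by
      rw [row_mv_self he hB hp, dn_gt _ (by omega)]; omega⟩
    exact ⟨B', .cons _ _ _ p hp hB'⟩

theorem exists_ep {B : Set ℤ} (hB : Maya B) {a : ℤ} {n : ℕ} (hn : (n : ℤ) = lev e B a - lev e B (a - 1)) :
    ∃ B', EP e a n B B' := by
  obtain ⟨lo, hlo⟩ := row_left he hB a
  exact exists_ep_of_row he n hB ⟨lo, by rw [hlo lo le_rfl, hn]⟩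

/-- The largest height exceeds the height far to the left: a node can be added. -/
theorem exists_up {B : Set ℤ} (hB : Maya B) {a i lo v : ℤ} (hlo : ∀ j ≤ lo, row e B a j = v)
    (hv : v < 0 ∨ v < row e B a i) :
    ∃ p C, Maya C ∧ Good e C (a + e * p) ∧ mv C (a + e * p) = B ∧
      (∀ j, row e B a j ≤ row e C a p - 1) ∧ row e C a = fun j => row e B a j + if j ≤ p then 2 else 0 := by
  obtain ⟨⟨M, hM⟩, hi, hhi⟩ := row_bounded he hB a
  -- the maximum of the heights
  obtain ⟨m, ⟨j, hj⟩, hmax⟩ := Int.exists_greatest_of_bdd (P := fun m => ∃ j, row e B a j = m)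
    ⟨M, by rintro _ ⟨j, rfl⟩; exact hM j⟩ ⟨_, i, rfl⟩
  have hmax' : ∀ j, row e B a j ≤ m := fun j => hmax _ ⟨j, rfl⟩
  have h0 := hmax' hi
  rw [hhi hi le_rfl] at h0
  have h0' := hmax' i
  -- At the first row with maximal height the height has just risen, so a node can be added in row
  -- `q - 1`. The hypothesis `hv` keeps the maximum away from the far left.
  obtain ⟨q, hq, hqmin⟩ := Int.exists_least_of_bdd (P := fun j => row e B a j = m)
    ⟨lo + 1, fun z hz => by by_contra hc; rw [hlo z (by omega)] at hz; omega⟩ ⟨j, hj⟩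
  have hlt : ∀ z < q, row e B a z < m := fun z hz => by
    refine lt_of_le_of_ne (hmax' z) fun hc => ?_
    have := hqmin z hc; omega
  have hst := row_step he hB a (q - 1)
  rw [sub_add_cancel] at hst
  have h1 := hlt (q - 1) (by omega)
  have c1 := ch_cases B (a + e * (q - 1))
  have c2 := ch_cases B (a + e * (q - 1) - 1)
  have hm1 : a + e * (q - 1) ∉ B := by
    rcases c1 with c1 | c1
    · rcases c2 with c2 | c2 <;> omega
    · exact c1.1
  have hm2 : a + e * (q - 1) - 1 ∈ B := by
    rcases c2 with c2 | c2
    · exact c2.1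
    · rcases c1 with c1 | c1 <;> omega
  have h2 := mv_up hm1 hm2
  have hC : Maya (up B (a + e * (q - 1))) := Maya.of_mv (x := a + e * (q - 1)) (by rwa [h2])
  have hrow := row_mv_of_mem he hC (a := a) (p := q - 1)
    ⟨Or.inr rfl, by
      show ¬ ((_ ∧ _) ∨ _)
      push Not
      exact ⟨fun _ => rfl, by omega⟩⟩
  rw [h2] at hrow
  have hrow' : row e (up B (a + e * (q - 1))) a = fun j => row e B a j + if j ≤ q - 1 then 2 else 0 := by
    funext j
    rw [hrow]; unfold dn; ring
  have hp : row e (up B (a + e * (q - 1))) a (q - 1) = m + 1 := by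
    rw [hrow']; simp only [le_refl, if_true]
    rcases c1 with c1 | c1 <;> rcases c2 with c2 | c2 <;> omega
  refine ⟨q - 1, up B (a + e * (q - 1)), hC, (good_iff _ _ _ _).2 ⟨by omega, fun j => ?_, fun j hj => ?_⟩,
    h2, fun j => by rw [hp]; have := hmax' j; omega, hrow'⟩
  · rw [hp, hrow']
    have := hmax' j
    by_cases hjq : j ≤ q - 1
    · have := hlt j (by omega); simp only [hjq, if_true]; omega
    · simp only [hjq, if_false]; omega
  · rw [hp, hrow']
    have := hmax' j
    simp only [show ¬ j ≤ q - 1 by omega, if_false]; omega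

theorem exists_ep_to_of_row {a : ℤ} (n : ℕ) : ∀ {B : Set ℤ}, Maya B →
    (∃ i lo v, (∀ j ≤ lo, row e B a j = v) ∧ v + n ≤ row e B a i) → ∃ B', EP e a n B' B := by
  induction n with
  | zero => exact fun {B} _ _ => ⟨B, .nil B⟩
  | succ n ih =>
    rintro B hB ⟨i, lo, v, hlo, hi⟩
    push_cast at hi
    obtain ⟨p, C, hC, hg, hmv, hmax, hrow⟩ := exists_up he hB (i := i) hlo (by omega)
    have h1 := hmax i
    obtain ⟨B', hB'⟩ := ih hC ⟨p, min lo p, v + 2, fun j hj => by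
      rw [hrow]; simp only [show j ≤ p by omega, if_true]; rw [hlo j (by omega)], by omega⟩
    exact ⟨B', by simpa [hmv] using hB'.snoc hg⟩

theorem exists_ep_to {B : Set ℤ} (hB : Maya B) {a : ℤ} {n : ℕ}
    (hn : (n : ℤ) = lev e B (a - 1) - lev e B a) : ∃ B', EP e a n B' B := by
  obtain ⟨lo, hlo⟩ := row_left he hB a
  obtain ⟨-, hi, hhi⟩ := row_bounded he hB a
  exact exists_ep_to_of_row he n hB ⟨hi, lo, _, hlo, by rw [hhi hi le_rfl]; omega⟩

/-- A good move can be undone in only one way. -/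
theorem Good.inj {C C' : Set ℤ} (hC : Maya C) (hC' : Maya C') {u v : ℤ} (hu : Good e C u) (hv : Good e C' v)
    (h : mv C u = mv C' v) (huv : (e : ℤ) ∣ v - u) : C = C' := by
  obtain ⟨t, ht⟩ := huv
  obtain rfl : v = u + e * t := by omega
  have hu' : Good e C (u + e * 0) := by simpa using hu
  -- After a good move in row `p`, row `p + 1` is the first one with maximal height, so `p` can be
  -- read off from the result.
  have key : ∀ {C : Set ℤ} {p : ℤ}, Maya C → Good e C (u + e * p) →
      (∀ j, row e (mv C (u + e * p)) u j ≤ row e (mv C (u + e * p)) u (p + 1)) ∧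
      ∀ j ≤ p, row e (mv C (u + e * p)) u j < row e (mv C (u + e * p)) u (p + 1) := by
    intro C p hC hp
    have h1 := row_succ_ge he hC u p
    have h2 := (good_iff _ _ _ _).1 hp
    rw [row_mv_self he hC hp, dn_gt (i := p + 1) _ (by omega)]
    refine ⟨fun j => ?_, fun j hj => ?_⟩
    · rcases le_or_gt j p with hj | hj
      · rw [dn_le _ hj]; have := h2.2.1 j; omega
      · rw [dn_gt _ hj]; have := h2.2.2 j hj; omega
    · rw [dn_le _ hj]; have := h2.2.1 j; omega
  have k1 := key hC hu'
  have k2 := key hC' hv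
  rw [mul_zero, add_zero] at k1
  rw [← h] at k2
  have : t = 0 := by
    rcases lt_trichotomy t 0 with h1 | h1 | h1
    · have := k1.2 (t + 1) (by omega); have := k2.1 (0 + 1); omega
    · exact h1
    · have := k2.2 (0 + 1) (by omega); have := k1.1 (t + 1); omega
  subst this
  rw [mul_zero, add_zero] at h hv
  have m1 := hu.mem he hC
  have m2 := hv.mem he hC'
  rw [← up_mv m1.1 m1.2, ← up_mv m2.1 m2.2, h]

theorem MP.of_Iio {n : ℕ} {B C : Set ℤ} (h : MP e n B C) {c : ℤ} (hB : B = Set.Iio c) :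
    n = 0 ∧ C = Set.Iio (-c) := by
  cases h with
  | base c' => rw [Set.Iio_injective hB]; exact ⟨rfl, rfl⟩
  | step n _ _ x y hxy hx hy hmp =>
    subst hB
    have := hx.mem he (maya_Iio c)
    have h1 : x < c := this.1
    exact absurd (show x - 1 < c by omega) this.2

/-- Matching lets the second pair follow the path of the first one; at each step the right-hand move
can be undone in only one way. -/
theorem MP.unique (he3 : 3 ≤ e) {n n' : ℕ} {B C C' : Set ℤ} (h : MP e n B C) (h' : MP e n' B C') :
    n = n' ∧ C = C' := by
  induction h generalizing n' C' with
  | base c => obtain ⟨rfl, rfl⟩ := h'.of_Iio he rfl; exact ⟨rfl, rfl⟩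
  | step n B C x y hxy hx hy hmp ih =>
    obtain ⟨m, y', rfl, hxy', hy', hmp'⟩ := matched he3 n' B C' h' x hx
    obtain ⟨rfl, h2⟩ := ih hmp'
    refine ⟨rfl, Good.inj he hmp.maya.2.of_mv hmp'.maya.2.of_mv hy hy' h2 ?_⟩
    have := dvd_sub hxy' hxy
    rwa [show x + y' - (x + y) = y' - y by ring] at this

omit he in
theorem MP.ep (he3 : 3 ≤ e) {k : ℕ} {a : ℤ} {B B' : Set ℤ} (hk : EP e a k B B') :
    ∀ {n : ℕ} {C : Set ℤ}, MP e n B C → ∃ m C', n = m + k ∧ EP e (-a) k C C' ∧ MP e m B' C' := by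
  induction hk with
  | nil B => exact fun {n C} h => ⟨n, C, rfl, .nil C, h⟩
  | cons k B B' p hp _ ih =>
    intro n C h
    obtain ⟨m, y, rfl, hxy, hy, hmp⟩ := matched he3 n B C h _ hp
    obtain ⟨m', C', rfl, hep, hmp'⟩ := ih hmp
    obtain ⟨t, ht⟩ := hxy
    obtain rfl : y = -a + e * (t - p) := by linear_combination ht
    exact ⟨m', C', rfl, .cons _ _ _ _ hy hep, hmp'⟩

omit he in
theorem MP.of_ep {k : ℕ} {a : ℤ} {B B' : Set ℤ} (hk : EP e a k B B') :
    ∀ {m : ℕ} {C C' : Set ℤ}, EP e (-a) k C C' → MP e m B' C' → MP e (m + k) B C := by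
  induction hk with
  | nil B =>
    intro m C C' h hmp
    cases h
    exact hmp
  | cons k B B' p hp _ ih =>
    intro m C C' h hmp
    cases h with
    | cons _ _ _ q hq hep =>
      exact .step _ _ _ _ _ ⟨p + q, by ring⟩ hp hq (ih hep hmp)

/-- Iterated good moves flip the smallest records of the signature. -/
theorem EP.flips {n : ℕ} {a : ℤ} {B B' : Set ℤ} (h : EP e a n B B') (hB : Maya B) :
    ∃ F : Finset ℤ, F.card = n ∧ (∀ f ∈ F, a + e * f - 1 ∉ B ∧ a + e * f ∈ B) ∧
      (∀ x, x ∈ B' ↔ (x ∈ B ∧ ∀ f ∈ F, x ≠ a + e * f) ∨ ∃ f ∈ F, x = a + e * f - 1) ∧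
      (∀ f ∈ F, ∀ r, f < r → row e B a r < row e B a f) ∧
      ∀ f ∈ F, ∀ s < f, (∀ r, s < r → row e B a r < row e B a s) → s ∈ F := by
  induction h with
  | nil B => exact ⟨∅, by simp, by simp, by simp, by simp, by simp⟩
  | cons n B B' p hp _ ih =>
    obtain ⟨F, h1, h2, h3, h4, h5⟩ := ih (hB.mv _)
    have hm := hp.mem he hB
    have hg := (good_iff _ _ _ _).1 hp
    have hge := row_succ_ge he hB a p
    have hrow := row_mv_self he hB hp
    rw [hrow] at h4 h5
    -- the remaining records lie beyond `p`
    have hFp : ∀ f ∈ F, p < f := by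
      intro f hf
      by_contra hc
      have := h4 f hf (p + 1) (by omega)
      rw [dn_gt _ (by omega), dn_le _ (by omega)] at this
      have := hg.2.1 f
      omega
    have hpF : p ∉ F := fun hc => absurd (hFp p hc) (lt_irrefl p)
    have hcan : ∀ {f g : ℤ}, a + e * f = a + e * g → f = g := by
      intro f g hfg
      have : (e : ℤ) * f = e * g := by linarith
      exact mul_left_cancel₀ (by omega) this
    refine ⟨insert p F, by rw [Finset.card_insert_of_notMem hpF, h1], fun f hf => ?_, fun x => ?_,
      fun f hf r hr => ?_, fun f hf s hs hrec => ?_⟩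
    · rcases Finset.mem_insert.1 hf with rfl | hf
      · exact ⟨hm.2, hm.1⟩
      · obtain ⟨a1, a2⟩ := h2 f hf
        have := hFp f hf
        rcases a2 with a2 | a2
        · refine ⟨fun hc => a1 (Or.inl ⟨hc, fun hc' => ?_⟩), a2.1⟩
          have h6 : (e : ℤ) * (f - p) = 1 := by linarith
          have : (e : ℤ) ∣ 1 := ⟨_, h6.symm⟩
          have := Int.le_of_dvd one_pos this; omega
        · exfalso
          have h6 : (e : ℤ) * (p - f) = 1 := by linarith
          have : (e : ℤ) ∣ 1 := ⟨_, h6.symm⟩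
          have := Int.le_of_dvd one_pos this; omega
    · rw [h3]
      have hmv : x ∈ mv B (a + e * p) ↔ (x ∈ B ∧ x ≠ a + e * p) ∨ x = a + e * p - 1 := Iff.rfl
      rw [hmv]
      simp only [Finset.mem_insert, forall_eq_or_imp, exists_eq_or_imp]
      have hne : x = a + e * p - 1 → ∀ f ∈ F, x ≠ a + e * f := by
        rintro rfl f hf hc
        have h6 : (e : ℤ) * (p - f) = 1 := by linarith
        have : (e : ℤ) ∣ 1 := ⟨_, h6.symm⟩
        have := Int.le_of_dvd one_pos this; omega
      constructor
      · rintro (⟨(⟨a1, a2⟩ | a1), a3⟩ | a1)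
        · exact Or.inl ⟨a1, a2, a3⟩
        · exact Or.inr (Or.inl a1)
        · exact Or.inr (Or.inr a1)
      · rintro (⟨a1, a2, a3⟩ | a1 | a1)
        · exact Or.inl ⟨Or.inl ⟨a1, a2⟩, a3⟩
        · exact Or.inl ⟨Or.inr a1, hne a1⟩
        · exact Or.inr a1
    · rcases Finset.mem_insert.1 hf with rfl | hf
      · exact hg.2.2 r hr
      · have h6 := h4 f hf r hr
        have := hFp f hf
        rwa [dn_gt _ this, dn_gt _ (by omega)] at h6
    · rcases Finset.mem_insert.1 hf with rfl | hf
      · have := hrec f hs; have := hg.2.1 s; omega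
      · rcases lt_trichotomy s p with h6 | rfl | h6
        · have := hrec p h6; have := hg.2.1 s; omega
        · exact Finset.mem_insert_self _ _
        · refine Finset.mem_insert_of_mem (h5 f hf s hs fun r hr => ?_)
          rw [dn_gt _ h6, dn_gt _ (by omega)]
          exact hrec r hr

theorem EP.flip {n : ℕ} {a : ℤ} {B B' : Set ℤ} (h : EP e a n B B') (hB : Maya B)
    (hn : (n : ℤ) = lev e B a - lev e B (a - 1)) :
    ∃ F, Flip (rn e B (a - 1)) (rn e B a) (rn e B' (a - 1)) (rn e B' a) F := by
  obtain ⟨F, h1, h2, h3, h4, h5⟩ := h.flips he hB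
  have he0 : 0 < e := by omega
  have hB' := hB.ep h
  have hcan : ∀ {f g : ℤ}, a + e * f = a + e * g → f = g := by
    intro f g hfg
    have : (e : ℤ) * f = e * g := by linarith
    exact mul_left_cancel₀ (by omega) this
  have hne : ∀ f g : ℤ, a + e * f ≠ a + e * g - 1 := by
    intro f g hfg
    have h6 : (e : ℤ) * (g - f) = 1 := by linarith
    have : (e : ℤ) ∣ 1 := ⟨_, h6.symm⟩
    have := Int.le_of_dvd one_pos this; omega
  have hs : ∀ t : ℤ, a - 1 + e * t = a + e * t - 1 := fun t => by ring
  simp only [row_eq] at h4 h5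
  refine ⟨F, hB.rn he0 _, hB.rn he0 _, hB'.rn he0 _, hB'.rn he0 _, fun f hf => ?_, fun x => ?_,
    fun x => ?_, h4, h5, ?_⟩
  · show a - 1 + e * f ∉ B ∧ a + e * f ∈ B
    rw [hs]; exact h2 f hf
  · show a - 1 + e * x ∈ B' ↔ a - 1 + e * x ∈ B ∨ x ∈ F
    rw [hs, h3]
    constructor
    · rintro (h6 | ⟨f, hf, h6⟩)
      · exact Or.inl h6.1
      · rw [sub_left_inj] at h6
        rw [hcan h6]; exact Or.inr hf
    · rintro (h6 | h6)
      · exact Or.inl ⟨h6, fun f _ => (hne f x).symm⟩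
      · exact Or.inr ⟨x, h6, rfl⟩
  · show a + e * x ∈ B' ↔ a + e * x ∈ B ∧ x ∉ F
    rw [h3]
    constructor
    · rintro (h6 | ⟨f, hf, h6⟩)
      · exact ⟨h6.1, fun hx => h6.2 x hx rfl⟩
      · exact absurd h6 (hne x f)
    · rintro ⟨h6, h7⟩
      exact Or.inl ⟨h6, fun f hf hc => h7 (by rwa [hcan hc])⟩
  · rw [lev_rn, lev_rn, h1, hn]; simp

theorem EP.mem_iff_of_not_dvd {n : ℕ} {a : ℤ} {B B' : Set ℤ} (h : EP e a n B B') (hB : Maya B) {x : ℤ}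
    (h1 : ¬ (e : ℤ) ∣ x - a) (h2 : ¬ (e : ℤ) ∣ x - (a - 1)) : x ∈ B' ↔ x ∈ B := by
  obtain ⟨F, -, -, h3, -, -⟩ := h.flips he hB
  rw [h3]
  constructor
  · rintro (h6 | ⟨f, hf, rfl⟩)
    · exact h6.1
    · exact absurd ⟨f, by ring⟩ h2
  · exact fun h6 => Or.inl ⟨h6, by rintro f hf rfl; exact h1 ⟨f, by ring⟩⟩

end

/-! ### The distribution of gap counts along the bead movements -/

/-- Gap counts increase along the starting positions of bead movements. -/
def Inc (e : ℕ) (B : Set ℤ) : Prop :=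
  ∀ x y, 0 < mult e B x → 0 < mult e B y → x < y → gp e B x ≤ gp e B y

/-- The number of bead movements whose starting position has gap count `v`. -/
def cnt (e : ℕ) (B : Set ℤ) (v : ℤ) : ℤ := ∑ᶠ x, if gp e B x = v then mult e B x else 0

theorem mult_support_finite {e : ℕ} {B : Set ℤ} (hB : Maya B) : {x | mult e B x ≠ 0}.Finite := by
  obtain ⟨⟨lo, hlo⟩, hi, hhi⟩ := hB
  refine (Set.finite_Icc lo hi).subset fun x hx => ?_
  rw [Set.mem_ofPred_eq] at hx
  rw [Set.mem_Icc]
  by_contra hc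
  apply hx
  have h1 := nb_nonneg e B x
  have h2 := ng_nonneg e B x
  unfold mult
  rcases le_or_gt x hi with h | h
  · rw [ng_eq_zero hlo (x := x) (by omega)]; omega
  · rw [nb_eq_zero hhi (x := x) (by omega)]; omega

theorem cnt_support_finite {e : ℕ} {B : Set ℤ} (hB : Maya B) (v : ℤ) :
    (Function.support fun x => if gp e B x = v then mult e B x else 0).Finite := by
  refine (mult_support_finite (e := e) hB).subset fun x hx => ?_
  simp only [Function.mem_support, ne_eq, ite_eq_right_iff, not_forall] at hx
  obtain ⟨-, h⟩ := hx
  exact h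

theorem cnt_tr (e : ℕ) (c : ℤ) (B : Set ℤ) (v : ℤ) : cnt e (tr c B) v = cnt e B v := by
  unfold cnt
  simp only [gp_tr, mult_tr]
  exact finsum_comp_equiv (Equiv.subRight c) (f := fun x => if gp e B x = v then mult e B x else 0)

theorem Inc.tr {e : ℕ} {B : Set ℤ} (h : Inc e B) (c : ℤ) : Inc e (tr c B) := by
  intro x y hx hy hxy
  rw [mult_tr] at hx hy
  rw [gp_tr, gp_tr]
  exact h _ _ hx hy (by omega)

/-- Two bead sets related by a reflection in two adjacent runners, as far as gap counts are concerned. -/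
structure Swap (e : ℕ) (a : ℤ) (B B' : Set ℤ) : Prop where
  maya : Maya B
  maya' : Maya B'
  mult_off : ∀ x, ¬ (e : ℤ) ∣ x - a → ¬ (e : ℤ) ∣ x - (a - 1) → mult e B' x = mult e B x
  gp_off : ∀ x, ¬ (e : ℤ) ∣ x - (a - 1) → gp e B' x = gp e B x
  mult_add : ∀ x, (e : ℤ) ∣ x - a →
    mult e B' (x - 1) + mult e B' x = mult e B (x - 1) + mult e B x
  gp_of_lt : ∀ x, (e : ℤ) ∣ x - a → mult e B x < mult e B' x → gp e B (x - 1) = gp e B x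
  gp_of_gt : ∀ x, (e : ℤ) ∣ x - a → mult e B' x < mult e B x → gp e B' (x - 1) = gp e B' x
  gp_left : ∀ x, (e : ℤ) ∣ x - a → 0 < mult e B (x - 1) → 0 < mult e B' (x - 1) →
    gp e B' (x - 1) = gp e B (x - 1)
  mono' : ∀ x, (e : ℤ) ∣ x - a → 0 < mult e B' (x - 1) → 0 < mult e B' x →
    gp e B' (x - 1) ≤ gp e B' x
  mono : ∀ x, (e : ℤ) ∣ x - a → 0 < mult e B (x - 1) → 0 < mult e B x →
    gp e B (x - 1) ≤ gp e B x

namespace Swap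

theorem symm {e : ℕ} {a : ℤ} {B B' : Set ℤ} (h : Swap e a B B') : Swap e a B' B where
  maya := h.maya'
  maya' := h.maya
  mult_off x h1 h2 := (h.mult_off x h1 h2).symm
  gp_off x h1 := (h.gp_off x h1).symm
  mult_add x h1 := (h.mult_add x h1).symm
  gp_of_lt := h.gp_of_gt
  gp_of_gt := h.gp_of_lt
  gp_left x h1 h2 h3 := (h.gp_left x h1 h3 h2).symm
  mono' := h.mono
  mono := h.mono'

theorem not_dvd_pred {e : ℕ} (he : 2 ≤ e) {a x : ℤ} (h : (e : ℤ) ∣ x - a) : ¬ (e : ℤ) ∣ x - (a - 1) := by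
  intro h'
  have := Int.le_of_dvd (by norm_num) (show (e : ℤ) ∣ 1 by
    have := dvd_sub h' h; rwa [show x - (a - 1) - (x - a) = 1 by ring] at this)
  omega

variable {e : ℕ} (he : 2 ≤ e) {a : ℤ} {B B' : Set ℤ} (h : Swap e a B B')
include he h

/-- If a movement of `B'` starts where none of `B` does, it came from the neighbouring runner in the
same row, and movements cross only between equal gap counts. -/
theorem exists_active {x : ℤ} (hx : 0 < mult e B' x) : ∃ y, 0 < mult e B y ∧ gp e B y = gp e B' x ∧
    (y = x ∨ ((e : ℤ) ∣ x - a ∧ y = x - 1) ∨ ((e : ℤ) ∣ x - (a - 1) ∧ y = x + 1)) := by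
  by_cases h1 : (e : ℤ) ∣ x - a
  · have h2 := h.mult_add x h1
    have h3 := h.gp_off x (not_dvd_pred he h1)
    by_cases h4 : 0 < mult e B x
    · exact ⟨x, h4, h3.symm, Or.inl rfl⟩
    · have := mult_nonneg e B' (x - 1)
      exact ⟨x - 1, by omega, by rw [h.gp_of_lt x h1 (by omega), h3], Or.inr (Or.inl ⟨h1, rfl⟩)⟩
  by_cases h2 : (e : ℤ) ∣ x - (a - 1)
  · have h1' : (e : ℤ) ∣ x + 1 - a := by rwa [show x + 1 - a = x - (a - 1) by ring]
    have h3 := h.mult_add (x + 1) h1'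
    have h4 := h.gp_off (x + 1) (not_dvd_pred he h1')
    have h6 := h.gp_of_gt (x + 1) h1'
    have h7 := h.gp_left (x + 1) h1'
    rw [add_sub_cancel_right] at *
    by_cases h5 : 0 < mult e B x
    · exact ⟨x, h5, (h7 h5 hx).symm, Or.inl rfl⟩
    · have := mult_nonneg e B' (x + 1)
      exact ⟨x + 1, by omega, by rw [h6 (by omega), h4], Or.inr (Or.inr ⟨h2, rfl⟩)⟩
  · exact ⟨x, by rwa [← h.mult_off x h1 h2], (h.gp_off x h2).symm, Or.inl rfl⟩

/-- Positions are replaced by active positions of `B` with the same gap counts. Only two neighbours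
in the same row can change order, and for them `mono'` applies. -/
theorem inc (hinc : Inc e B) : Inc e B' := by
  intro x y hx hy hxy
  obtain ⟨x', hx1, hx2, hx3⟩ := h.exists_active he hx
  obtain ⟨y', hy1, hy2, hy3⟩ := h.exists_active he hy
  by_cases hp : y = x + 1 ∧ (e : ℤ) ∣ y - a
  · obtain ⟨rfl, hd⟩ := hp
    have := h.mono' (x + 1) hd
    rw [add_sub_cancel_right] at this
    exact this hx hy
  have h2 : (e : ℤ) ∣ x - (a - 1) → y ≠ x + 1 := by
    rintro h1 rfl
    exact hp ⟨rfl, by rwa [show x + 1 - a = x - (a - 1) by ring]⟩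
  have h3 : (e : ℤ) ∣ y - a → y ≠ x + 1 := fun h1 h2 => hp ⟨h2, h1⟩
  have h4 : (e : ℤ) ∣ x - (a - 1) → (e : ℤ) ∣ y - a → y ≠ x + 2 := by
    rintro h1 h2 rfl
    have := Int.le_of_dvd (by norm_num) (show (e : ℤ) ∣ 1 by
      have := dvd_sub h2 h1; rwa [show x + 2 - a - (x - (a - 1)) = 1 by ring] at this)
    omega
  rw [← hx2, ← hy2]
  refine hinc x' y' hx1 hy1 ?_
  rcases hx3 with rfl | ⟨a1, rfl⟩ | ⟨a1, rfl⟩ <;> rcases hy3 with rfl | ⟨a2, rfl⟩ | ⟨a2, rfl⟩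
  · exact hxy
  · have := h3 a2; omega
  · omega
  · omega
  · omega
  · omega
  · have := h2 a1; omega
  · have := h2 a1; have := h3 a2; have := h4 a1 a2; omega
  · have := h2 a1; omega

/-- Contributions balance on every pair of neighbouring positions `x - 1`, `x`. -/
theorem cnt_eq (v : ℤ) : cnt e B' v = cnt e B v := by
  set f : ℤ → ℤ := fun x => if gp e B x = v then mult e B x else 0 with hf
  set f' : ℤ → ℤ := fun x => if gp e B' x = v then mult e B' x else 0 with hf'
  have fin := cnt_support_finite (e := e) h.maya v
  have fin' := cnt_support_finite (e := e) h.maya' v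
  have pair : ∀ x, (e : ℤ) ∣ x - a → f' (x - 1) + f' x = f (x - 1) + f x := by
    intro x hx
    have h1 := h.mult_add x hx
    have h2 := h.gp_off x (not_dvd_pred he hx)
    have h3 := h.gp_of_lt x hx
    have h4 := h.gp_of_gt x hx
    have h5 := h.gp_left x hx
    have p1 := mult_nonneg e B x
    have p2 := mult_nonneg e B (x - 1)
    have p3 := mult_nonneg e B' x
    have p4 := mult_nonneg e B' (x - 1)
    simp only [hf, hf']
    rw [h2] at h4 ⊢
    rcases lt_trichotomy (mult e B x) (mult e B' x) with hlt | heq | hgt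
    · have h6 := h3 hlt
      by_cases hz : 0 < mult e B' (x - 1)
      · rw [h5 (by omega) hz, h6]; split_ifs <;> omega
      · rw [h6]; split_ifs <;> omega
    · by_cases hz : 0 < mult e B' (x - 1)
      · rw [h5 (by omega) hz]; split_ifs <;> omega
      · split_ifs <;> omega
    · have h6 := h4 hgt
      by_cases hz : 0 < mult e B (x - 1)
      · rw [← h5 hz (by omega), h6]; split_ifs <;> omega
      · rw [h6]; split_ifs <;> omega
  -- The involution exchanging the two runners negates the difference of the summands, so the total
  -- difference equals its own negative.
  set s : ℤ → ℤ := fun x => if (e : ℤ) ∣ x - a then x - 1 else if (e : ℤ) ∣ x - (a - 1) then x + 1 else x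
    with hs
  have hinv : Function.Involutive s := by
    intro x
    simp only [hs]
    by_cases h1 : (e : ℤ) ∣ x - a
    · have h2 : ¬ (e : ℤ) ∣ x - 1 - a := fun hc => by
        refine not_dvd_pred he hc ?_
        rwa [show x - 1 - (a - 1) = x - a by ring]
      rw [if_pos h1, if_neg h2, if_pos (by rwa [show x - 1 - (a - 1) = x - a by ring])]; ring
    · by_cases h2 : (e : ℤ) ∣ x - (a - 1)
      · rw [if_neg h1, if_pos h2, if_pos (by rwa [show x + 1 - a = x - (a - 1) by ring])]; ring
      · rw [if_neg h1, if_neg h2, if_neg h1, if_neg h2]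
  have hneg : ∀ x, f' (s x) - f (s x) = -(f' x - f x) := by
    intro x
    simp only [hs]
    by_cases h1 : (e : ℤ) ∣ x - a
    · rw [if_pos h1]; have := pair x h1; omega
    · by_cases h2 : (e : ℤ) ∣ x - (a - 1)
      · rw [if_neg h1, if_pos h2]
        have := pair (x + 1) (by rwa [show x + 1 - a = x - (a - 1) by ring])
        rw [add_sub_cancel_right] at this; omega
      · rw [if_neg h1, if_neg h2]
        have : f' x = f x := by simp only [hf, hf']; rw [h.gp_off x h2, h.mult_off x h1 h2]
        omega
  have h1 : ∑ᶠ x, (f' x - f x) = cnt e B' v - cnt e B v := finsum_sub_distrib fin' fin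
  have h2 : ∑ᶠ x, (f' (s x) - f (s x)) = ∑ᶠ x, (f' x - f x) :=
    finsum_comp_equiv hinv.toPerm (f := fun x => f' x - f x)
  simp only [hneg, finsum_neg_distrib] at h2
  omega

end Swap

/-! ### From flips of two runners to gap counts. -/

section

variable {e : ℕ} (he : 2 ≤ e) {a : ℤ} {B B' : Set ℤ} (hB : Maya B) (hB' : Maya B') {F : Finset ℤ}
  (hF : Flip (rn e B (a - 1)) (rn e B a) (rn e B' (a - 1)) (rn e B' a) F)
  (hoff : ∀ x, ¬ (e : ℤ) ∣ x - a → ¬ (e : ℤ) ∣ x - (a - 1) → (x ∈ B' ↔ x ∈ B))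

/-- By `gp_sub`, `Star` says precisely that gap counts do not decrease from runner `a - 1` to runner
`a` in a common active row. -/
theorem Inc.star (h : Inc e B) (a : ℤ) : Star (rn e B (a - 1)) (rn e B a) := by
  intro t hL hR h1
  rw [mult_rn] at hL hR
  have h2 := h _ _ hL hR (by omega)
  have h3 := gp_sub e B (a + e * t)
  rw [show a + (e : ℤ) * t - 1 = a - 1 + e * t by ring, show a + (e : ℤ) * t - e = a + e * (t - 1) by ring,
    ch_of_notMem (show a + (e : ℤ) * (t - 1) ∉ B from h1)] at h3
  have h4 := ch_nonneg B (a + e * t)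
  show a + e * t ∉ B
  rw [← ch_eq_zero]; omega

include he hB hB' hF hoff

/-- Unless it ends on runner `a - 1`, a window of length `e` meets the runners `a - 1` and `a` in
the same row, where a flip moves a bead without changing the total. -/
theorem gp_eq_of_flip {x : ℤ} (hx : ¬ (e : ℤ) ∣ x - (a - 1)) : gp e B' x = gp e B x := by
  obtain ⟨lo, hlo⟩ := hB.1
  obtain ⟨lo', hlo'⟩ := hB'.1
  set d : ℤ → ℤ := fun x => ch B' x - ch B x with hd
  have hpair : ∀ x, (e : ℤ) ∣ x - a → d (x - 1) = - d x := by
    rintro x ⟨t, ht⟩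
    obtain rfl : x = a + e * t := by linarith
    have h1 := hF.ch_R' t
    have h2 := hF.ch_L' t
    rw [ch_rn, ch_rn, show a - 1 + (e : ℤ) * t = a + e * t - 1 by ring] at h2
    rw [ch_rn, ch_rn] at h1
    simp only [hd]; omega
  have h0 : ∀ x, ¬ (e : ℤ) ∣ x - a → ¬ (e : ℤ) ∣ x - (a - 1) → d x = 0 := by
    intro x h1 h2
    simp only [hd, ch, hoff x h1 h2, sub_self]
  have key := eq_of_step_left (e := 1) one_pos (f := fun x => gp e B' x - gp e B x)
    (g := fun x => if (e : ℤ) ∣ x - (a - 1) then d (x - e) - d x else 0) (lo := min lo lo') (fun x => ?_)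
    (fun x hx => ?_) x
  · simp only [hx, if_false] at key; omega
  · have g1 := gp_sub e B (x + 1)
    have g2 := gp_sub e B' (x + 1)
    have e1 : (e : ℤ) ∣ x + 1 - e - a ↔ (e : ℤ) ∣ x + 1 - a := by
      rw [show x + 1 - (e : ℤ) - a = x + 1 - a - e by ring]; exact dvd_sub_self_right
    have e2 : (e : ℤ) ∣ x + 1 - e - (a - 1) ↔ (e : ℤ) ∣ x + 1 - (a - 1) := by
      rw [show x + 1 - (e : ℤ) - (a - 1) = x + 1 - (a - 1) - e by ring]; exact dvd_sub_self_right
    rw [add_sub_cancel_right] at g1 g2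
    rw [Nat.cast_one]
    have goal : (if (e : ℤ) ∣ x + 1 - (a - 1) then d (x + 1 - e) - d (x + 1) else 0) -
        (if (e : ℤ) ∣ x - (a - 1) then d (x - e) - d x else 0) = d (x + 1 - e) - d (x + 1) := by
      by_cases h1 : (e : ℤ) ∣ x + 1 - a
      · have h2 : (e : ℤ) ∣ x - (a - 1) := by rwa [show x - (a - 1) = x + 1 - a by ring]
        rw [if_pos h2, if_neg (Swap.not_dvd_pred he h1)]
        have h3 := hpair _ h1
        have h4 := hpair _ (e1.2 h1)
        rw [add_sub_cancel_right] at h3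
        rw [show x + 1 - (e : ℤ) - 1 = x - e by ring] at h4
        omega
      · have h2 : ¬ (e : ℤ) ∣ x - (a - 1) := by rwa [show x - (a - 1) = x + 1 - a by ring]
        rw [if_neg h2]
        by_cases h3 : (e : ℤ) ∣ x + 1 - (a - 1)
        · rw [if_pos h3]; ring
        · rw [if_neg h3, h0 _ h1 h3, h0 _ (fun hc => h1 (e1.1 hc)) (fun hc => h3 (e2.1 hc))]
    simp only [hd] at goal ⊢
    omega
  · have g1 : ∀ y ≤ x, d y = 0 := fun y hy => by
      simp only [hd]; rw [ch_of_mem (hlo y (by omega)), ch_of_mem (hlo' y (by omega))]; rfl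
    rw [g1 x le_rfl, g1 (x - e) (by omega)]
    have : gp e B' x = gp e B x := by
      unfold gp
      refine Finset.sum_congr rfl fun j _ => ?_
      have := g1 (x - j) (by omega)
      simp only [hd] at this; omega
    rw [this]; simp

theorem swap_of_flip (hst : Star (rn e B (a - 1)) (rn e B a)) : Swap e a B B' := by
  have he0 : 0 < e := by omega
  have hgp : ∀ x, ¬ (e : ℤ) ∣ x - (a - 1) → gp e B' x = gp e B x :=
    fun x hx => gp_eq_of_flip he hB hB' hF hoff hx
  have hl : ∀ t : ℤ, a + e * t - 1 = a - 1 + e * t := fun t => by ring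
  have gstep : ∀ (B : Set ℤ) (t : ℤ), gp e B (a + e * t) - gp e B (a - 1 + e * t) =
      ch (rn e B a) (t - 1) - ch (rn e B a) t := by
    intro B t
    have := gp_sub e B (a + e * t)
    rw [hl, show a + (e : ℤ) * t - e = a + e * (t - 1) by ring] at this
    rwa [ch_rn, ch_rn]
  have mono : ∀ B : Set ℤ, Star (rn e B (a - 1)) (rn e B a) → ∀ t : ℤ, 0 < mult e B (a - 1 + e * t) →
      0 < mult e B (a + e * t) → gp e B (a - 1 + e * t) ≤ gp e B (a + e * t) := by
    intro B hst t h1 h2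
    have h3 := hst t (by rwa [mult_rn]) (by rwa [mult_rn])
    have h4 := gstep B t
    have c1 := ch_cases (rn e B a) (t - 1)
    have c2 := ch_cases (rn e B a) t
    rcases c1 with c1 | c1
    · have := ch_le_one (rn e B a) t; omega
    · have := ch_of_notMem (h3 c1.1); omega
  have param : ∀ x, (e : ℤ) ∣ x - a → ∃ t, x = a + e * t := by
    rintro x ⟨t, ht⟩; exact ⟨t, by linarith⟩
  refine ⟨hB, hB', fun x h1 h2 => ?_, hgp, fun x hx => ?_, fun x hx => ?_, fun x hx => ?_,
    fun x hx => ?_, fun x hx => ?_, fun x hx => ?_⟩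
  · have : rn e B' x = rn e B x := by
      ext t
      refine hoff _ (fun hc => h1 ?_) (fun hc => h2 ?_)
      · have := dvd_sub hc (dvd_mul_right (e : ℤ) t)
        rwa [show x + e * t - a - e * t = x - a by ring] at this
      · have := dvd_sub hc (dvd_mul_right (e : ℤ) t)
        rwa [show x + e * t - (a - 1) - e * t = x - (a - 1) by ring] at this
    have h3 := mult_rn e B x 0
    have h4 := mult_rn e B' x 0
    rw [mul_zero, add_zero] at h3 h4
    rw [← h3, ← h4, this]
  all_goals
    have hx0 := Swap.not_dvd_pred he hx
    obtain ⟨t, rfl⟩ := param x hx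
    rw [hl]
  · have := hF.mult_add t
    simpa only [mult_rn] using this
  · intro h1
    have := hF.const_of_lt hst (t := t) (by rwa [mult_rn, mult_rn])
    have := gstep B t; omega
  · intro h1
    have := hF.const_of_gt hst (t := t) (by rwa [mult_rn, mult_rn])
    have := gstep B' t; omega
  · intro h1 h2
    have := hF.ch_sub hst (t := t) (by rwa [mult_rn]) (by rwa [mult_rn])
    have := gstep B t
    have := gstep B' t
    have := hgp _ hx0
    omega
  · exact mono B' (hF.star hst) t
  · exact mono B hst t

end

section

variable {e : ℕ} (he : 2 ≤ e) {a : ℤ}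
include he

theorem lev_of_flip {B B' : Set ℤ} {F : Finset ℤ} (hB : Maya B) (hB' : Maya B')
    (hF : Flip (rn e B (a - 1)) (rn e B a) (rn e B' (a - 1)) (rn e B' a) F)
    (hoff : ∀ x, ¬ (e : ℤ) ∣ x - a → ¬ (e : ℤ) ∣ x - (a - 1) → (x ∈ B' ↔ x ∈ B)) (x : ℤ) :
    lev e B' x = if (e : ℤ) ∣ x - a then lev e B (x - 1) else
      if (e : ℤ) ∣ x - (a - 1) then lev e B (x + 1) else lev e B x := by
  have h1 := hF.nbL' 0
  have h2 := hF.nbR' 0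
  have h3 := hF.ngL' 0
  have h4 := hF.ngR' 0
  have h5 := Flip.card_split (F := F) 0
  have h6 := hF.card
  have he0 : 0 < e := by omega
  have hLR : lev e B' a = lev e B (a - 1) ∧ lev e B' (a - 1) = lev e B a := by
    have e1 := lev_rn e B a 0
    have e2 := lev_rn e B (a - 1) 0
    have e3 := lev_rn e B' a 0
    have e4 := lev_rn e B' (a - 1) 0
    rw [mul_zero, add_zero] at e1 e2 e3 e4
    unfold lev at h6 e1 e2 e3 e4 ⊢
    omega
  split_ifs with c1 c2
  · obtain ⟨t, ht⟩ := c1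
    obtain rfl : x = a + e * t := by linarith
    rw [lev_add_mul he0 hB', show a + (e : ℤ) * t - 1 = a - 1 + e * t by ring, lev_add_mul he0 hB, hLR.1]
  · obtain ⟨t, ht⟩ := c2
    obtain rfl : x = a - 1 + e * t := by linarith
    rw [lev_add_mul he0 hB', show a - 1 + (e : ℤ) * t + 1 = a + e * t by ring, lev_add_mul he0 hB, hLR.2]
  · have : rn e B' x = rn e B x := by
      ext t
      refine hoff _ (fun hc => c1 ?_) (fun hc => c2 ?_)
      · have := dvd_sub hc (dvd_mul_right (e : ℤ) t)
        rwa [show x + e * t - a - e * t = x - a by ring] at this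
      · have := dvd_sub hc (dvd_mul_right (e : ℤ) t)
        rwa [show x + e * t - (a - 1) - e * t = x - (a - 1) by ring] at this
    have h3 := lev_rn e B x 0
    have h4 := lev_rn e B' x 0
    rw [mul_zero, add_zero] at h3 h4
    rw [← h3, ← h4, this]

end

/-- Each good move lowers the height far to the left, which is the level difference, by two. -/
theorem EP.lev_sub {e : ℕ} (he : 2 ≤ e) {a : ℤ} {n : ℕ} {B B' : Set ℤ} (h : EP e a n B B') (hB : Maya B) :
    lev e B' a - lev e B' (a - 1) = lev e B a - lev e B (a - 1) - 2 * n := by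
  induction h with
  | nil B => simp
  | cons n B B' p hp _ ih =>
    rw [ih (hB.mv _)]
    obtain ⟨lo, hlo⟩ := row_left he hB a
    obtain ⟨lo', hlo'⟩ := row_left he (hB.mv (a + e * p)) a
    have h1 := hlo' (min (min lo lo') p) (by omega)
    rw [row_mv_self he hB hp, dn_le _ (by omega), hlo _ (by omega)] at h1
    push_cast
    omega

/-- The bead sets with given levels of the runners, increasing gap counts and a given distribution of
gap counts. -/
structure Cls (e : ℕ) (D ℓ : ℤ → ℤ) (B : Set ℤ) : Prop where
  maya : Maya B
  lev : ∀ x, lev e B x = D x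
  inc : Inc e B
  cnt : ∀ v, cnt e B v = ℓ v

/-- Exchange of the levels of two adjacent runners. -/
def swapLev (e : ℕ) (a : ℤ) (D : ℤ → ℤ) (x : ℤ) : ℤ :=
  if (e : ℤ) ∣ x - a then D (x - 1) else if (e : ℤ) ∣ x - (a - 1) then D (x + 1) else D x

theorem swapLev_self {e : ℕ} (a : ℤ) (D : ℤ → ℤ) : swapLev e a D a = D (a - 1) := by simp [swapLev]

theorem swapLev_pred {e : ℕ} (he : 2 ≤ e) (a : ℤ) (D : ℤ → ℤ) : swapLev e a D (a - 1) = D a := by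
  have : ¬ (e : ℤ) ∣ a - 1 - a := fun hc => Swap.not_dvd_pred he hc (by simp)
  rw [swapLev, if_neg this, if_pos (by simp), sub_add_cancel]

theorem swapLev_swapLev {e : ℕ} (he : 2 ≤ e) (a : ℤ) (D : ℤ → ℤ) : swapLev e a (swapLev e a D) = D := by
  funext x
  unfold swapLev
  by_cases h1 : (e : ℤ) ∣ x - a
  · have h2 : ¬ (e : ℤ) ∣ x - 1 - a := fun hc => by
      refine Swap.not_dvd_pred he hc ?_
      rwa [show x - 1 - (a - 1) = x - a by ring]
    rw [if_pos h1, if_neg h2, if_pos (by rwa [show x - 1 - (a - 1) = x - a by ring]), sub_add_cancel]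
  · by_cases h2 : (e : ℤ) ∣ x - (a - 1)
    · rw [if_neg h1, if_pos h2, if_pos (by rwa [show x + 1 - a = x - (a - 1) by ring]), add_sub_cancel_right]
    · rw [if_neg h1, if_neg h2, if_neg h1, if_neg h2]

section

variable {e : ℕ} (he : 2 ≤ e) {a : ℤ} {n : ℕ} {D ℓ : ℤ → ℤ} {B B' : Set ℤ}
include he

/-- The chosen number of moves is exactly what exchanges the levels, so the moves form a `Flip`;
`Inc` supplies the condition `Star` that makes it a `Swap`. -/
theorem Cls.ep (h : Cls e D ℓ B) (hn : (n : ℤ) = D a - D (a - 1)) (hep : EP e a n B B') :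
    Cls e (swapLev e a D) ℓ B' := by
  have hB' := h.maya.ep hep
  rw [← h.lev, ← h.lev] at hn
  obtain ⟨F, hF⟩ := hep.flip he h.maya hn
  have hoff : ∀ x, ¬ (e : ℤ) ∣ x - a → ¬ (e : ℤ) ∣ x - (a - 1) → (x ∈ B' ↔ x ∈ B) :=
    fun x h1 h2 => hep.mem_iff_of_not_dvd he h.maya h1 h2
  have hsw := swap_of_flip he h.maya hB' hF hoff (h.inc.star a)
  refine ⟨hB', fun x => ?_, hsw.inc he h.inc, fun v => by rw [hsw.cnt_eq he, h.cnt]⟩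
  rw [lev_of_flip he h.maya hB' hF hoff]
  simp only [swapLev, h.lev]

/-- Here `Inc` is known only after the moves; `Flip.star_iff` carries `Star` back to their start. -/
theorem Cls.of_ep (h : Cls e D ℓ B') (hn : (n : ℤ) = D (a - 1) - D a) (hep : EP e a n B B') :
    Cls e (swapLev e a D) ℓ B := by
  have hB := Maya.of_ep hep h.maya
  have hoff : ∀ x, ¬ (e : ℤ) ∣ x - a → ¬ (e : ℤ) ∣ x - (a - 1) → (x ∈ B' ↔ x ∈ B) :=
    fun x h1 h2 => hep.mem_iff_of_not_dvd he hB h1 h2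
  -- the levels on the two runners are determined by the number of moves
  have hn' : (n : ℤ) = Abacus.lev e B a - Abacus.lev e B (a - 1) := by
    have h1 := hep.lev_sub he hB
    rw [h.lev, h.lev] at h1
    omega
  obtain ⟨F, hF⟩ := hep.flip he hB hn'
  have hst : Star (rn e B (a - 1)) (rn e B a) := hF.star_iff.1 (h.inc.star a)
  have hsw := swap_of_flip he hB h.maya hF hoff hst
  refine ⟨hB, fun x => ?_, hsw.symm.inc he h.inc, fun v => by rw [← hsw.cnt_eq he, h.cnt]⟩
  have h1 := lev_of_flip he hB h.maya hF hoff
  have h2 : D = swapLev e a (Abacus.lev e B) := by funext y; rw [← h.lev, h1]; rfl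
  rw [h2, swapLev_swapLev he]

end

/-! ### Connectedness of the levels under reflections -/

/-- The energy of a set of beads. -/
def energy (B : Set ℤ) : ℤ := ∑ᶠ x : ℤ, x * (ch B x - ch (Set.Iio 0) x)

theorem energy_support_finite {B : Set ℤ} (hB : Maya B) :
    (Function.support fun x : ℤ => x * (ch B x - ch (Set.Iio 0) x)).Finite := by
  obtain ⟨⟨lo, hlo⟩, hi, hhi⟩ := hB
  refine (Set.finite_Icc (min lo 0) (max hi 0)).subset fun x hx => ?_
  rw [Function.mem_support] at hx
  rw [Set.mem_Icc]
  by_contra hc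
  apply hx
  rcases le_or_gt (min lo 0) x with h | h
  · rw [ch_of_notMem (hhi x (by omega)), ch_of_notMem (show x ∉ Set.Iio 0 from fun h' => by have : x < 0 := h'; omega)]; ring
  · rw [ch_of_mem (hlo x (by omega)), ch_of_mem (show x ∈ Set.Iio 0 from (by omega : x < 0))]; ring

theorem energy_nonneg (B : Set ℤ) : 0 ≤ energy B := by
  refine finsum_nonneg fun x => ?_
  rcases lt_or_ge x 0 with h | h
  · rw [ch_of_mem (show x ∈ Set.Iio 0 from h)]
    have := ch_le_one B x
    exact mul_nonneg_of_nonpos_of_nonpos h.le (by omega)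
  · rw [ch_of_notMem (show x ∉ Set.Iio 0 from not_lt.2 h)]
    have := ch_nonneg B x
    exact mul_nonneg h (by omega)

theorem energy_mv {B : Set ℤ} (hB : Maya B) {x : ℤ} (h1 : x ∈ B) (h2 : x - 1 ∉ B) :
    energy (mv B x) = energy B - 1 := by
  have h3 : energy (mv B x) - energy B = ∑ᶠ y : ℤ, (y * (ch (mv B x) y - ch B y)) := by
    unfold energy
    rw [← finsum_sub_distrib (energy_support_finite (hB.mv x)) (energy_support_finite hB)]
    refine finsum_congr fun y => by ring
  have h4 : ∑ᶠ y : ℤ, (y * (ch (mv B x) y - ch B y)) = ∑ y ∈ {x, x - 1}, (y * (ch (mv B x) y - ch B y)) := by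
    refine finsum_eq_sum_of_support_subset _ fun y hy => ?_
    rw [Function.mem_support, ch_mv h1 h2] at hy
    simp only [Finset.coe_insert, Finset.coe_singleton, Set.mem_insert_iff, Set.mem_singleton_iff]
    by_contra hc
    push Not at hc
    simp [hc.1, hc.2] at hy
  rw [h4, Finset.sum_pair (by omega), ch_mv h1 h2, ch_mv h1 h2] at h3
  have h5 : x ≠ x - 1 := by omega
  have h6 : x - 1 ≠ x := by omega
  simp only [h5, h6, if_true, if_false] at h3
  linarith

theorem EP.energy {e : ℕ} (he : 2 ≤ e) {a : ℤ} {n : ℕ} {B B' : Set ℤ} (h : EP e a n B B') (hB : Maya B) :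
    energy B' = energy B - n := by
  induction h with
  | nil B => simp
  | cons n B B' p hp _ ih =>
    have hm := hp.mem he hB
    rw [ih (hB.mv _), energy_mv hB hm.1 hm.2]; push_cast; ring

/-- The level functions of bead sets. -/
def IsLev (e : ℕ) (D : ℤ → ℤ) : Prop := ∀ x, D (x + e) = D x - 1

theorem isLev_lev {e : ℕ} (he : 0 < e) {B : Set ℤ} (hB : Maya B) : IsLev e (lev e B) := lev_add he hB

theorem IsLev.add_mul {e : ℕ} {D : ℤ → ℤ} (hD : IsLev e D) (x t : ℤ) : D (x + e * t) = D x - t := by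
  induction t using Int.induction_on with
  | zero => simp
  | succ i ih => rw [show x + (e : ℤ) * (i + 1) = x + e * i + e by ring, hD, ih]; ring
  | pred i ih =>
    have := hD (x + e * (-i - 1))
    rw [show x + (e : ℤ) * (-i - 1) + e = x + e * -i by ring, ih] at this
    omega

theorem IsLev.exists_lo {e : ℕ} (he : 0 < e) {D : ℤ → ℤ} (hD : IsLev e D) (M : ℤ) :
    (∃ lo, ∀ x < lo, M < D x) ∧ ∃ hi, ∀ x ≥ hi, D x < M := by
  -- bounds on one period
  have hper : ∀ x, D x = D (x % e) - x / e := fun x => by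
    have := hD.add_mul (x % e) (x / e)
    rwa [Int.emod_add_mul_ediv] at this
  set S := (Finset.Ico (0 : ℤ) e).image D with hS
  have hne : S.Nonempty := ⟨D 0, Finset.mem_image.2 ⟨0, Finset.mem_Ico.2 (by omega), rfl⟩⟩
  have hmem : ∀ x : ℤ, D (x % e) ∈ S := fun x => Finset.mem_image.2
    ⟨x % e, Finset.mem_Ico.2 ⟨Int.emod_nonneg _ (by omega), Int.emod_lt_of_pos _ (by omega)⟩, rfl⟩
  refine ⟨⟨e * (S.min' hne - M - 1), fun x hx => ?_⟩, e * (S.max' hne - M + 1), fun x hx => ?_⟩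
  · have h1 := S.min'_le _ (hmem x)
    have h2 : x / e < S.min' hne - M - 1 := Int.ediv_lt_of_lt_mul (by omega) (by rwa [mul_comm])
    rw [hper]; omega
  · have h1 := S.le_max' _ (hmem x)
    have h2 : S.max' hne - M + 1 ≤ x / e := (Int.le_ediv_iff_mul_le (by omega)).2 (by rwa [mul_comm])
    rw [hper]; omega

/-- The core with given levels. -/
def core (D : ℤ → ℤ) : Set ℤ := {x | 0 < D x}

theorem maya_core {e : ℕ} (he : 0 < e) {D : ℤ → ℤ} (hD : IsLev e D) : Maya (core D) := by
  obtain ⟨⟨lo, hlo⟩, hi, hhi⟩ := hD.exists_lo he 0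
  exact ⟨⟨lo, hlo⟩, hi, fun x hx => not_lt.2 (hhi x hx).le⟩

theorem lev_core {e : ℕ} (he : 0 < e) {D : ℤ → ℤ} (hD : IsLev e D) (x : ℤ) : lev e (core D) x = D x := by
  have hm := maya_core he hD
  obtain ⟨⟨lo, hlo⟩, hi, hhi⟩ := hD.exists_lo he 0
  have h1 : nb e (core D) x = max (D x) 0 := by
    refine eq_of_step_right he (f := nb e (core D)) (g := fun x => max (D x) 0) (fun x => ?_) (hi := hi)
      (fun x hx => ?_) x
    · have := nb_rec he hm x
      have h2 := hD x
      rcases ch_cases (core D) x with ⟨h, h'⟩ | ⟨h, h'⟩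
      · have : 0 < D x := h
        omega
      · have : ¬ 0 < D x := h
        omega
    · rw [nb_eq_zero (B := core D) (hi := hi) (fun y hy => not_lt.2 (hhi y hy).le) hx]
      have := hhi x hx
      omega
  have h2 : ng e (core D) x = max (-D x) 0 := by
    refine eq_of_step_left he (f := ng e (core D)) (g := fun x => max (-D x) 0) (fun x => ?_) (lo := lo)
      (fun x hx => ?_) x
    · have := ng_rec he hm x
      have h2 := hD x
      rcases ch_cases (core D) x with ⟨h, h'⟩ | ⟨h, h'⟩
      · have : 0 < D x := h
        omega
      · have : ¬ 0 < D x := h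
        omega
    · rw [ng_eq_zero (B := core D) (e := e) (lo := lo) (x := x) (fun y hy => hlo y hy) (by omega)]
      have := hlo x hx
      omega
  unfold lev; omega

theorem EP.lev {e : ℕ} (he : 2 ≤ e) {a : ℤ} {n : ℕ} {B B' : Set ℤ} (h : EP e a n B B') (hB : Maya B)
    (hn : (n : ℤ) = lev e B a - lev e B (a - 1)) : lev e B' = swapLev e a (lev e B) := by
  obtain ⟨F, hF⟩ := h.flip he hB hn
  funext x
  exact lev_of_flip he hB (hB.ep h) hF (fun x h1 h2 => h.mem_iff_of_not_dvd he hB h1 h2) x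

/-- `D x ≤ k` is `D (x + e * k) ≤ 0`, so a decreasing level function is determined by the single
position where it stops being positive. -/
theorem exists_translate {e : ℕ} (he : 0 < e) {D K : ℤ → ℤ} (hD : IsLev e D) (hK : IsLev e K)
    (h1 : ∀ x, D x ≤ D (x - 1)) (h2 : ∀ x, K x ≤ K (x - 1)) : ∃ t, D = fun x => K (x - t) := by
  have anti : ∀ {D : ℤ → ℤ}, IsLev e D → (∀ x, D x ≤ D (x - 1)) → ∃ c, ∀ x, D x ≤ 0 ↔ c ≤ x := by
    intro D hD h1
    obtain ⟨⟨lo, hlo⟩, hi, hhi⟩ := hD.exists_lo he 0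
    obtain ⟨c, hc, hmin⟩ := Int.exists_least_of_bdd (P := fun x => D x ≤ 0)
      ⟨lo, fun x hx => by by_contra hc; have := hlo x (by omega); omega⟩ ⟨hi, (hhi hi le_rfl).le⟩
    refine ⟨c, fun x => ⟨hmin x, fun hx => ?_⟩⟩
    have : ∀ n : ℕ, D (c + n) ≤ 0 := by
      intro n
      induction n with
      | zero => simpa using hc
      | succ n ih =>
        have := h1 (c + (n + 1 : ℕ))
        rw [show c + ((n + 1 : ℕ) : ℤ) - 1 = c + n by push_cast; ring] at this
        omega
    have := this (x - c).toNat
    rwa [show c + ((x - c).toNat : ℤ) = x by omega] at this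
  obtain ⟨c, hc⟩ := anti hD h1
  obtain ⟨c', hc'⟩ := anti hK h2
  refine ⟨c - c', funext fun x => ?_⟩
  have key : ∀ k : ℤ, D x ≤ k ↔ K (x - (c - c')) ≤ k := by
    intro k
    have a1 := hc (x + e * k)
    have a2 := hc' (x - (c - c') + e * k)
    rw [hD.add_mul] at a1
    rw [hK.add_mul] at a2
    omega
  exact le_antisymm ((key _).2 le_rfl) ((key _).1 le_rfl)

/-- A property of levels that is invariant under reflections and translations and holds once
holds always. -/
theorem lev_induction {e : ℕ} (he : 2 ≤ e) {Q : (ℤ → ℤ) → Prop}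
    (hswap : ∀ D a, IsLev e D → Q D → Q (swapLev e a D))
    (htr : ∀ D t, IsLev e D → Q D → Q fun x => D (x - t)) {K : ℤ → ℤ} (hK : IsLev e K) (hQ : Q K)
    {D : ℤ → ℤ} (hD : IsLev e D) : Q D := by
  have he0 : 0 < e := by omega
  -- descent to a weakly decreasing level function
  have desc : ∀ n : ℕ, ∀ B : Set ℤ, Maya B → energy B ≤ n →
      ∃ A : ℤ → ℤ, IsLev e A ∧ (∀ x, A x ≤ A (x - 1)) ∧ (Q A ↔ Q (lev e B)) := by
    intro n
    induction n with
    | zero =>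
      intro B hB h0
      refine ⟨_, isLev_lev he0 hB, fun x => ?_, Iff.rfl⟩
      by_contra hc
      obtain ⟨B', hB'⟩ := exists_ep he hB (a := x) (n := (lev e B x - lev e B (x - 1)).toNat) (by omega)
      have h1 := hB'.energy he hB
      have h2 := energy_nonneg B'
      push_cast at h0
      omega
    | succ n ih =>
      intro B hB h0
      by_cases hc : ∀ x, lev e B x ≤ lev e B (x - 1)
      · exact ⟨_, isLev_lev he0 hB, hc, Iff.rfl⟩
      push Not at hc
      obtain ⟨x, hx⟩ := hc
      obtain ⟨B', hB'⟩ := exists_ep he hB (a := x) (n := (lev e B x - lev e B (x - 1)).toNat) (by omega)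
      have h1 := hB'.energy he hB
      obtain ⟨A, hA, hA1, hA2⟩ := ih B' (hB.ep hB') (by push_cast at h0; omega)
      refine ⟨A, hA, hA1, hA2.trans ?_⟩
      have h3 := hB'.lev he hB (by omega)
      refine ⟨fun h => ?_, fun h => ?_⟩
      · have := hswap _ x (isLev_lev he0 (hB.ep hB')) h
        rwa [h3, swapLev_swapLev he] at this
      · rw [h3]; exact hswap _ _ (isLev_lev he0 hB) h
  have desc' : ∀ D, IsLev e D → ∃ A : ℤ → ℤ, IsLev e A ∧ (∀ x, A x ≤ A (x - 1)) ∧ (Q A ↔ Q D) := by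
    intro D hD
    have := desc (energy (core D)).toNat (core D) (maya_core he0 hD) (by omega)
    rwa [show lev e (core D) = D from funext (lev_core he0 hD)] at this
  obtain ⟨A, hA, hA1, hA2⟩ := desc' D hD
  obtain ⟨A', hA', hA1', hA2'⟩ := desc' K hK
  obtain ⟨t, rfl⟩ := exists_translate he0 hA hA' hA1 hA1'
  exact hA2.1 (htr A' t hA' (hA2'.2 hQ))

/-! ### Reflections act on the classes -/

theorem EP.det {e : ℕ} {a : ℤ} {n : ℕ} {B B' : Set ℤ} (h : EP e a n B B') :
    ∀ {C : Set ℤ}, EP e a n B C → B' = C := by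
  induction h with
  | nil B => intro C h; cases h; rfl
  | cons n B B' p hp _ ih =>
    intro C h
    cases h with
    | cons _ _ _ q hq h =>
      have : a + e * p = a + e * q := hp.unique hq ⟨q - p, by ring⟩
      rw [← this] at h
      exact ih h

theorem EP.inj {e : ℕ} (he : 2 ≤ e) {a : ℤ} {n : ℕ} {B B' : Set ℤ} (h : EP e a n B B') (hB' : Maya B') :
    ∀ {C : Set ℤ}, EP e a n C B' → B = C := by
  induction h with
  | nil B => intro C h; cases h; rfl
  | cons n B B' p hp hep ih =>
    intro C h
    cases h with
    | cons _ _ _ q hq h =>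
      exact hp.inj he (Maya.of_mv (Maya.of_ep hep hB')) (Maya.of_mv (Maya.of_ep h hB')) hq (ih hB' h)
        ⟨q - p, by ring⟩

/-- Chains of good moves of given length are deterministic in both directions, so two members of the
reflected class come from the same member of the original one. -/
theorem cls_unique_swap {e : ℕ} (he : 2 ≤ e) {ℓ : ℤ → ℤ} {D : ℤ → ℤ} {a : ℤ}
    (h : ∀ B C, Cls e D ℓ B → Cls e D ℓ C → B = C) :
    ∀ B C, Cls e (swapLev e a D) ℓ B → Cls e (swapLev e a D) ℓ C → B = C := by
  intro B C hB hC
  have s1 := swapLev_self (e := e) a D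
  have s2 := swapLev_pred he a D
  rcases le_total (D a) (D (a - 1)) with h1 | h1
  · have hn : (((D (a - 1) - D a).toNat : ℕ) : ℤ) = swapLev e a D a - swapLev e a D (a - 1) := by omega
    obtain ⟨B', hB'⟩ := exists_ep he hB.maya (a := a) (n := (D (a - 1) - D a).toNat)
      (by rw [hB.lev, hB.lev, hn])
    obtain ⟨C', hC'⟩ := exists_ep he hC.maya (a := a) (n := (D (a - 1) - D a).toNat)
      (by rw [hC.lev, hC.lev, hn])
    have k1 := hB.ep he hn hB'
    have k2 := hC.ep he hn hC'
    rw [swapLev_swapLev he] at k1 k2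
    have := h _ _ k1 k2
    subst this
    exact hB'.inj he k1.maya hC'
  · have hn : (((D a - D (a - 1)).toNat : ℕ) : ℤ) = swapLev e a D (a - 1) - swapLev e a D a := by omega
    obtain ⟨B', hB'⟩ := exists_ep_to he hB.maya (a := a) (n := (D a - D (a - 1)).toNat)
      (by rw [hB.lev, hB.lev, hn])
    obtain ⟨C', hC'⟩ := exists_ep_to he hC.maya (a := a) (n := (D a - D (a - 1)).toNat)
      (by rw [hC.lev, hC.lev, hn])
    have k1 := hB.of_ep he hn hB'
    have k2 := hC.of_ep he hn hC'
    rw [swapLev_swapLev he] at k1 k2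
    have := h _ _ k1 k2
    subst this
    exact hB'.det hC'

theorem Cls.tr {e : ℕ} {D ℓ : ℤ → ℤ} {B : Set ℤ} (h : Cls e D ℓ B) (t : ℤ) :
    Cls e (fun x => D (x - t)) ℓ (tr t B) :=
  ⟨h.maya.tr t, fun x => by rw [lev_tr, h.lev], h.inc.tr t, fun v => by rw [cnt_tr, h.cnt]⟩

theorem cls_unique_of {e : ℕ} (he : 2 ≤ e) {ℓ K D : ℤ → ℤ} (hK : IsLev e K) (hD : IsLev e D)
    (h : ∀ B C, Cls e K ℓ B → Cls e K ℓ C → B = C) :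
    ∀ B C, Cls e D ℓ B → Cls e D ℓ C → B = C := by
  refine lev_induction he (Q := fun D => ∀ B C, Cls e D ℓ B → Cls e D ℓ C → B = C)
    (fun D a _ h => cls_unique_swap he h) (fun D t _ h B C hB hC => ?_) hK h hD
  have := h _ _ (by simpa using hB.tr (-t)) (by simpa using hC.tr (-t))
  have := congrArg (Abacus.tr t) this
  rwa [tr_tr, tr_tr, add_neg_cancel, tr_zero, tr_zero] at this

/-! ### Column-shaped quotients on well separated cores -/

/-- The level function with level `d r` on runner `r`, for `0 ≤ r < e`. -/
def levOf (e : ℕ) (d : ℤ → ℤ) (x : ℤ) : ℤ := d (x % e) - x / e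

/-- The bead set with levels `d` and with a column of length `c r` on runner `r`. -/
def col (e : ℕ) (d c : ℤ → ℤ) : Set ℤ := {x | 0 ≤ levOf e d x ∧ levOf e d x ≠ c (x % e)}

section

variable {e : ℕ} (he : 0 < e)
include he

omit he in
theorem emod_of_lt {r : ℤ} (h0 : 0 ≤ r) (h1 : r < e) (t : ℤ) : (r + e * t) % e = r := by
  rw [Int.add_mul_emod_self_left, Int.emod_eq_of_lt h0 h1]

theorem ediv_of_lt {r : ℤ} (h0 : 0 ≤ r) (h1 : r < e) (t : ℤ) : (r + e * t) / e = t := by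
  rw [Int.add_mul_ediv_left _ _ (by omega), Int.ediv_eq_zero_of_lt h0 h1, zero_add]

theorem exists_row (x : ℤ) : ∃ r t : ℤ, 0 ≤ r ∧ r < e ∧ x = r + e * t :=
  ⟨x % e, x / e, Int.emod_nonneg _ (by omega), Int.emod_lt_of_pos _ (by omega),
    (Int.emod_add_mul_ediv x e).symm⟩

theorem levOf_row {r : ℤ} (h0 : 0 ≤ r) (h1 : r < e) (d : ℤ → ℤ) (t : ℤ) :
    levOf e d (r + e * t) = d r - t := by
  unfold levOf; rw [emod_of_lt h0 h1, ediv_of_lt he h0 h1]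

theorem isLev_levOf (d : ℤ → ℤ) : IsLev e (levOf e d) := by
  intro x
  obtain ⟨r, t, h0, h1, rfl⟩ := exists_row he x
  rw [show r + (e : ℤ) * t + e = r + e * (t + 1) by ring, levOf_row he h0 h1, levOf_row he h0 h1]; ring

theorem mem_col {r : ℤ} (h0 : 0 ≤ r) (h1 : r < e) (d c : ℤ → ℤ) (t : ℤ) :
    r + e * t ∈ col e d c ↔ t ≤ d r ∧ d r - t ≠ c r := by
  unfold col
  rw [Set.mem_ofPred_eq, levOf_row he h0 h1, emod_of_lt h0 h1, sub_nonneg]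

omit he in
theorem emod_add_self (x : ℤ) : (x + e) % e = x % e := by simp

variable {d c : ℤ → ℤ} (hc : ∀ r, 0 ≤ c r) {W : ℤ} (hW : ∀ r, c r ≤ W)
include hW

theorem maya_col : Maya (col e d c) := by
  obtain ⟨⟨lo, hlo⟩, -⟩ := (isLev_levOf he d).exists_lo he (max 0 W)
  obtain ⟨-, hi, hhi⟩ := (isLev_levOf he d).exists_lo he 0
  refine ⟨⟨lo, fun x hx => ?_⟩, hi, fun x hx h => ?_⟩
  · have h1 := hlo x hx
    have h2 := hW (x % e)
    exact ⟨by omega, by omega⟩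
  · have h1 := hhi x hx
    have := h.1
    omega

omit he hW in
theorem ch_col (x : ℤ) : ch (col e d c) x =
    if 0 ≤ levOf e d x ∧ levOf e d x ≠ c (x % e) then 1 else 0 := by
  unfold ch
  exact if_congr Iff.rfl rfl rfl

include hc

theorem nb_col (x : ℤ) : nb e (col e d c) x =
    max (levOf e d x + 1) 0 - if c (x % e) ≤ levOf e d x then 1 else 0 := by
  have hm := maya_col he hW (d := d)
  obtain ⟨-, hi, hhi⟩ := (isLev_levOf he d).exists_lo he 0
  refine eq_of_step_right he (f := nb e (col e d c))
    (g := fun x => max (levOf e d x + 1) 0 - if c (x % e) ≤ levOf e d x then 1 else 0)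
    (fun x => ?_) (hi := hi) (fun x hx => ?_) x
  · have h1 := nb_rec he hm x
    have h2 := isLev_levOf he d x
    have h3 := hc (x % e)
    rw [ch_col] at h1
    simp only [emod_add_self, h2]
    split_ifs at h1 ⊢ <;> omega
  · have h1 := hhi x hx
    have h3 := hc (x % e)
    rw [nb_eq_zero (B := col e d c) (hi := hi) (fun y hy h => by
      have := hhi y hy; have := h.1; omega) hx, if_neg (by omega)]
    omega

theorem ng_col (x : ℤ) : ng e (col e d c) x =
    max 1 (-levOf e d x) - if c (x % e) ≤ levOf e d x then 1 else 0 := by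
  have hm := maya_col he hW (d := d)
  obtain ⟨⟨lo, hlo⟩, -⟩ := (isLev_levOf he d).exists_lo he (max 0 W)
  refine eq_of_step_left he (f := ng e (col e d c))
    (g := fun x => max 1 (-levOf e d x) - if c (x % e) ≤ levOf e d x then 1 else 0)
    (fun x => ?_) (lo := lo) (fun x hx => ?_) x
  · have h1 := ng_rec he hm x
    have h2 := isLev_levOf he d x
    have h3 := hc (x % e)
    rw [ch_col] at h1
    simp only [emod_add_self, h2]
    split_ifs at h1 ⊢ <;> omega
  · have h1 := hlo x hx
    have h3 := hW (x % e)
    rw [ng_eq_zero (B := col e d c) (e := e) (lo := lo) (x := x) (fun y hy => by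
      have := hlo y hy; have := hW (y % e); exact ⟨by omega, by omega⟩) (by omega), if_pos (by omega)]
    omega

theorem lev_col (x : ℤ) : lev e (col e d c) x = levOf e d x := by
  have h3 := hc (x % e)
  unfold lev
  rw [nb_col he hc hW, ng_col he hc hW]
  omega

theorem mult_col (x : ℤ) : mult e (col e d c) x =
    if 0 ≤ levOf e d x ∧ levOf e d x < c (x % e) then 1 else 0 := by
  have h3 := hc (x % e)
  unfold mult
  rw [nb_col he hc hW, ng_col he hc hW]
  split_ifs <;> omega

end

/-- The window ending on runner `r` in row `t` meets the runners up to `r` in row `t` and the later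
ones in row `t - 1`. -/
theorem gp_eq_sum {e : ℕ} (B : Set ℤ) {r : ℤ} (h0 : 0 ≤ r) (h1 : r < e) (t : ℤ) :
    gp e B (r + e * t) =
      ∑ i ∈ Finset.Ico (0 : ℤ) e, (1 - ch B (i + e * (t - if r < i then 1 else 0))) := by
  unfold gp
  refine Finset.sum_bij' (fun j _ => if (j : ℤ) ≤ r then r - j else r - j + e)
    (fun i _ => (if i ≤ r then r - i else r - i + e).toNat) ?_ ?_ ?_ ?_ ?_
  · intro j hj
    rw [Finset.mem_range] at hj
    rw [Finset.mem_Ico]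
    split_ifs <;> omega
  · intro i hi
    rw [Finset.mem_Ico] at hi
    rw [Finset.mem_range]
    split_ifs <;> omega
  · intro j hj
    rw [Finset.mem_range] at hj
    by_cases h : (j : ℤ) ≤ r
    · simp only [h, if_true]; rw [if_pos (by omega)]; omega
    · simp only [h, if_false]; rw [if_neg (by omega)]; omega
  · intro i hi
    rw [Finset.mem_Ico] at hi
    by_cases h : i ≤ r
    · simp only [h, if_true]; rw [if_pos (by omega)]; omega
    · simp only [h, if_false]; rw [if_neg (by omega)]; omega
  · intro j hj
    rw [Finset.mem_range] at hj
    congr 2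
    by_cases h : (j : ℤ) ≤ r
    · simp only [h, if_true]; rw [if_neg (by omega)]; ring
    · simp only [h, if_false]; rw [if_pos (by omega)]; ring

/-- The gap count at the position of level `s` on runner `r`. -/
def gcol (e : ℕ) (d c : ℤ → ℤ) (r s : ℤ) : ℤ :=
  ∑ i ∈ Finset.Ico (0 : ℤ) e, if 0 ≤ d i - d r + s + (if r < i then 1 else 0) ∧
    d i - d r + s + (if r < i then 1 else 0) ≠ c i then 0 else 1

theorem gp_col {e : ℕ} (he : 0 < e) {r : ℤ} (h0 : 0 ≤ r) (h1 : r < e) (d c : ℤ → ℤ) (t : ℤ) :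
    gp e (col e d c) (r + e * t) = gcol e d c r (d r - t) := by
  rw [gp_eq_sum _ h0 h1]
  refine Finset.sum_congr rfl fun i hi => ?_
  rw [Finset.mem_Ico] at hi
  have h2 := mem_col he hi.1 hi.2 d c (t - if r < i then 1 else 0)
  have h3 : d i - d r + (d r - t) + (if r < i then 1 else 0) = d i - (t - if r < i then 1 else 0) := by ring
  simp only [h3, sub_nonneg]
  unfold ch
  simp only [h2]
  split_ifs <;> rfl

theorem cnt_col {e : ℕ} (he : 0 < e) {d c : ℤ → ℤ} (hc : ∀ r, 0 ≤ c r) {W : ℤ} (hW : ∀ r, c r ≤ W) (v : ℤ) :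
    cnt e (col e d c) v = ∑ r ∈ Finset.Ico (0 : ℤ) e, ∑ s ∈ Finset.Ico (0 : ℤ) (c r),
      if gcol e d c r s = v then 1 else 0 := by
  rw [Finset.sum_sigma']
  set T := (Finset.Ico (0 : ℤ) e).sigma fun r => Finset.Ico (0 : ℤ) (c r) with hT
  have hinj : Set.InjOn (fun p : (_ : ℤ) × ℤ => p.1 + e * (d p.1 - p.2)) T := by
    rintro ⟨r, s⟩ hp ⟨r', s'⟩ hp' h
    simp only [hT, Finset.coe_sigma, Set.mem_sigma_iff, Finset.coe_Ico, Set.mem_Ico] at hp hp' h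
    have h1 : r = r' := by
      have := congrArg (· % (e : ℤ)) h
      simpa only [emod_of_lt hp.1.1 hp.1.2, emod_of_lt hp'.1.1 hp'.1.2] using this
    subst h1
    have h2 : d r - s = d r - s' := by
      have := congrArg (· / (e : ℤ)) h
      simpa only [ediv_of_lt he hp.1.1 hp.1.2] using this
    obtain rfl : s = s' := by omega
    rfl
  have hmem : ∀ x, (∃ p ∈ T, p.1 + e * (d p.1 - p.2) = x) ↔
      0 ≤ levOf e d x ∧ levOf e d x < c (x % e) := by
    intro x
    obtain ⟨r, t, h0, h1, rfl⟩ := exists_row he x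
    rw [levOf_row he h0 h1, emod_of_lt h0 h1]
    constructor
    · rintro ⟨⟨r', s⟩, hp, h⟩
      simp only [hT, Finset.mem_sigma, Finset.mem_Ico] at hp h
      have h2 : r' = r := by
        have := congrArg (· % (e : ℤ)) h
        simpa only [emod_of_lt hp.1.1 hp.1.2, emod_of_lt h0 h1] using this
      subst h2
      have h3 : d r' - s = t := by
        have := congrArg (· / (e : ℤ)) h
        simpa only [ediv_of_lt he h0 h1] using this
      constructor <;> omega
    · intro h
      refine ⟨⟨r, d r - t⟩, ?_, by simp⟩
      simp only [hT, Finset.mem_sigma, Finset.mem_Ico]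
      exact ⟨⟨h0, h1⟩, h⟩
  unfold cnt
  rw [finsum_eq_sum_of_support_subset (s := T.image fun p => p.1 + e * (d p.1 - p.2)),
    Finset.sum_image hinj]
  · refine Finset.sum_congr rfl fun p hp => ?_
    have h1 := (hmem _).1 ⟨p, hp, rfl⟩
    rw [mult_col he hc hW, if_pos h1]
    simp only [hT, Finset.mem_sigma, Finset.mem_Ico] at hp
    rw [gp_col he hp.1.1 hp.1.2, sub_sub_cancel]
  · intro x hx
    rw [Function.mem_support, mult_col he hc hW] at hx
    rw [Finset.coe_image]
    have h1 : 0 ≤ levOf e d x ∧ levOf e d x < c (x % e) := by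
      by_contra hc'
      rw [if_neg hc'] at hx
      simp at hx
    exact (hmem x).2 h1

/-- `hsep` puts the active rows of an earlier runner above those of a later one, so the order of
positions is the order of runners. -/
theorem inc_col {e : ℕ} (he : 0 < e) {d c : ℤ → ℤ} (hc : ∀ r, 0 ≤ c r) {W : ℤ} (hW : ∀ r, c r ≤ W)
    (hsep : ∀ r r' : ℤ, 0 ≤ r → r < r' → r' < e → 0 < c r → 0 < c r' → d r + c r' ≤ d r')
    (hg : ∀ r s s' : ℤ, 0 ≤ r → r < e → 0 ≤ s' → s' ≤ s → s < c r → gcol e d c r s ≤ gcol e d c r s')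
    (hg' : ∀ r s r' s' : ℤ, 0 ≤ r → r < r' → r' < e → 0 ≤ s → s < c r → 0 ≤ s' → s' < c r' →
      gcol e d c r s ≤ gcol e d c r' s') : Inc e (col e d c) := by
  intro x y hx hy hxy
  obtain ⟨r, t, h0, h1, rfl⟩ := exists_row he x
  obtain ⟨r', t', h0', h1', rfl⟩ := exists_row he y
  rw [mult_col he hc hW, levOf_row he h0 h1, emod_of_lt h0 h1] at hx
  rw [mult_col he hc hW, levOf_row he h0' h1', emod_of_lt h0' h1'] at hy
  have hx : 0 ≤ d r - t ∧ d r - t < c r := by by_contra hc'; rw [if_neg hc'] at hx; omega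
  have hy : 0 ≤ d r' - t' ∧ d r' - t' < c r' := by by_contra hc'; rw [if_neg hc'] at hy; omega
  rw [gp_col he h0 h1, gp_col he h0' h1']
  rcases lt_trichotomy r r' with h | rfl | h
  · exact hg' _ _ _ _ h0 h h1' hx.1 hx.2 hy.1 hy.2
  · have : t < t' := by
      have h2 : (e : ℤ) * t < e * t' := by omega
      exact lt_of_mul_lt_mul_left h2 (by omega)
    exact hg _ _ _ h0 h1 hy.1 (by omega) hx.2
  · exfalso
    have h2 := hsep r' r h0' h h1 (by omega) (by omega)
    have h3 : t' ≤ t := by omega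
    have h4 : (e : ℤ) * t' ≤ e * t := mul_le_mul_of_nonneg_left h3 (by omega)
    omega

/-! ### Removing one value of the gap count -/

/-- Column lengths for the distribution `ℓ` when the runners `v - 1` and `v` are close. -/
def colLen (v : ℤ) (ℓ : ℤ → ℤ) (r : ℤ) : ℤ :=
  if r = v - 1 then 0 else if r = v then ℓ (v - 1) + ℓ v else ℓ r

/-- All levels are separated by at least `N`, except for those of the runners `v - 1` and `v`. -/
def Far (e : ℕ) (d : ℤ → ℤ) (N v : ℤ) : Prop :=
  ∀ i j : ℤ, 0 ≤ i → i < j → j < e → ¬ (i = v - 1 ∧ j = v) → d i + N ≤ d j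

section

variable {e : ℕ} {d ℓ : ℤ → ℤ} {N v : ℤ} (hv : 1 ≤ v) (hve : v < e) (hd : Far e d N v)
  (hℓ : ∀ i, 0 ≤ ℓ i) (hN : ∀ i, colLen v ℓ i < N)

theorem colLen_nonneg (hℓ : ∀ i, 0 ≤ ℓ i) (i : ℤ) : 0 ≤ colLen v ℓ i := by
  unfold colLen
  have h1 := hℓ (v - 1); have h2 := hℓ v; have h3 := hℓ i
  split_ifs <;> omega

-- Seen from an active position of runner `r`, the runners before `r` are empty, `r` itself has a
-- bead and the later runners are full, which gives `r` gaps. The only exception is the close pair: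
-- runner `v - 1` may still have a bead beside runner `v`.
include hv hve hd hN in
theorem gcol_far {r s : ℤ} (h0 : 0 ≤ r) (h1 : r < e) (hs : 0 ≤ s) (hsr : s < colLen v ℓ r) :
    gcol e d (colLen v ℓ) r s = r - if r = v ∧ 0 < d (v - 1) - d v + s then 1 else 0 := by
  have hr : r ≠ v - 1 := by
    rintro rfl
    simp [colLen] at hsr; omega
  have hterm : ∀ i ∈ Finset.Ico (0 : ℤ) e, (if 0 ≤ d i - d r + s + (if r < i then 1 else 0) ∧
      d i - d r + s + (if r < i then 1 else 0) ≠ colLen v ℓ i then (0 : ℤ) else 1) =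
      (if i < r then 1 else 0) - if i = v - 1 then
        (if r = v ∧ 0 < d (v - 1) - d v + s then 1 else 0) else 0 := by
    intro i hi
    rw [Finset.mem_Ico] at hi
    have hNi := hN i
    have hNr := hN r
    by_cases hp : i = v - 1 ∧ r = v
    · obtain ⟨rfl, rfl⟩ := hp
      have : colLen r ℓ (r - 1) = 0 := by simp [colLen]
      rw [this, if_neg (show ¬ r < r - 1 by omega), if_pos (show r - 1 < r by omega), if_pos rfl]
      split_ifs <;> omega
    · have h2 : (if i = v - 1 then (if r = v ∧ 0 < d (v - 1) - d v + s then (1 : ℤ) else 0) else 0) = 0 := by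
        split_ifs with a1 a2
        · exact absurd ⟨a1, a2.1⟩ hp
        · rfl
        · rfl
      rw [h2]
      rcases lt_trichotomy i r with h | rfl | h
      · have := hd i r hi.1 h h1 hp
        rw [if_neg (show ¬ r < i by omega), if_pos h, if_neg (by omega)]; rfl
      · rw [if_neg (lt_irrefl i), if_pos ⟨by omega, by omega⟩]; rfl
      · have := hd r i h0 h hi.2 (fun hc => hr hc.1)
        rw [if_pos h, if_neg (show ¬ i < r by omega), if_pos ⟨by omega, by omega⟩]; rfl
  unfold gcol
  rw [Finset.sum_congr rfl hterm, Finset.sum_sub_distrib, Finset.sum_ite_eq', if_pos (by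
    rw [Finset.mem_Ico]; omega)]
  congr 1
  rw [Finset.sum_boole, show (Finset.Ico (0 : ℤ) e).filter (· < r) = Finset.Ico 0 r by
    ext i; simp only [Finset.mem_filter, Finset.mem_Ico]; omega]
  simp only [Int.card_Ico]; omega

-- The close runner `v` serves two gap counts: by `hT` its first `ℓ v` levels have gap count `v` and
-- the remaining `ℓ (v - 1)` ones have `v - 1`. This is why its column has length `ℓ (v - 1) + ℓ v`
-- and runner `v - 1` carries none.
include hv hve hd hℓ hN in
theorem cls_far (he : 2 ≤ e) (hT : ∀ s, 0 ≤ s → (0 < d (v - 1) - d v + s ↔ ℓ v ≤ s))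
    (hsupp : ∀ i : ℤ, ¬ (0 ≤ i ∧ i < e) → ℓ i = 0) :
    Cls e (levOf e d) ℓ (col e d (colLen v ℓ)) := by
  have he0 : 0 < e := by omega
  have hc := colLen_nonneg (v := v) hℓ
  have hW : ∀ i, colLen v ℓ i ≤ N := fun i => (hN i).le
  have hgc : ∀ r s : ℤ, 0 ≤ r → r < e → 0 ≤ s → s < colLen v ℓ r →
      gcol e d (colLen v ℓ) r s = r - if r = v ∧ ℓ v ≤ s then 1 else 0 := by
    intro r s h0 h1 h2 h3
    rw [gcol_far hv hve hd hN h0 h1 h2 h3]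
    simp only [hT s h2]
  refine ⟨maya_col he0 hW, lev_col he0 hc hW, inc_col he0 hc hW ?_ ?_ ?_, fun u => ?_⟩
  · intro r r' h0 h h1 hr hr'
    have := hd r r' h0 h h1 (by rintro ⟨rfl, -⟩; simp [colLen] at hr)
    have := hN r'
    omega
  · intro r s s' h0 h1 h2 h3 h4
    rw [hgc r s h0 h1 (by omega) h4, hgc r s' h0 h1 h2 (by omega)]
    split_ifs <;> omega
  · intro r s r' s' h0 h h1 h2 h3 h4 h5
    rw [hgc r s h0 (by omega) h2 h3, hgc r' s' (by omega) h1 h4 h5]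
    split_ifs <;> omega
  · rw [cnt_col he0 hc hW]
    have hterm : ∀ r ∈ Finset.Ico (0 : ℤ) e, (∑ s ∈ Finset.Ico (0 : ℤ) (colLen v ℓ r),
        if gcol e d (colLen v ℓ) r s = u then (1 : ℤ) else 0) =
        (if r = u then ℓ r else 0) + (if r = v then (if u = v - 1 then ℓ (v - 1) else 0) else 0) -
          (if r = v - 1 then (if u = v - 1 then ℓ (v - 1) else 0) else 0) := by
      intro r hr
      rw [Finset.mem_Ico] at hr
      have hs : (∑ s ∈ Finset.Ico (0 : ℤ) (colLen v ℓ r),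
          if gcol e d (colLen v ℓ) r s = u then (1 : ℤ) else 0) =
          ((Finset.Ico (0 : ℤ) (colLen v ℓ r)).filter
            fun s => r - (if r = v ∧ ℓ v ≤ s then (1 : ℤ) else 0) = u).card := by
        rw [← Finset.sum_boole]
        refine Finset.sum_congr rfl fun s hs => ?_
        rw [Finset.mem_Ico] at hs
        rw [hgc r s hr.1 hr.2 hs.1 hs.2]
      rw [hs]
      have p1 := hℓ (v - 1)
      have p2 := hℓ v
      have p3 := hℓ r
      by_cases h1 : r = v - 1
      · have : colLen v ℓ r = 0 := by simp [colLen, h1]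
        rw [this, Finset.Ico_self, Finset.filter_empty, Finset.card_empty]
        subst h1
        split_ifs <;> omega
      by_cases h2 : r = v
      · subst h2
        have : colLen r ℓ r = ℓ (r - 1) + ℓ r := by
          unfold colLen; rw [if_neg h1, if_pos rfl]
        rw [this, if_neg h1, if_pos rfl]
        rcases eq_or_ne u r with rfl | h3
        · rw [show (Finset.Ico (0 : ℤ) (ℓ (u - 1) + ℓ u)).filter
            (fun s => u - (if u = u ∧ ℓ u ≤ s then 1 else 0) = u) = Finset.Ico 0 (ℓ u) by
            ext s; simp only [Finset.mem_filter, Finset.mem_Ico, true_and]; split_ifs <;> omega]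
          rw [Int.card_Ico, if_pos rfl, if_neg (by omega)]; omega
        rcases eq_or_ne u (r - 1) with rfl | h4
        · rw [show (Finset.Ico (0 : ℤ) (ℓ (r - 1) + ℓ r)).filter
            (fun s => r - (if r = r ∧ ℓ r ≤ s then 1 else 0) = r - 1) =
              Finset.Ico (ℓ r) (ℓ (r - 1) + ℓ r) by
            ext s; simp only [Finset.mem_filter, Finset.mem_Ico, true_and]; split_ifs <;> omega]
          rw [Int.card_Ico, if_neg (by omega), if_pos rfl]; omega
        · rw [Finset.filter_false_of_mem, if_neg h3.symm, if_neg h4]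
          · simp
          · intro s _; split_ifs <;> omega
      · have : colLen v ℓ r = ℓ r := by simp [colLen, h1, h2]
        rw [this, if_neg h1, if_neg h2]
        by_cases h3 : r = u
        · rw [Finset.filter_true_of_mem, Int.card_Ico, if_pos h3]
          · omega
          · intro s _; rw [if_neg fun hc => h2 hc.1]; omega
        · rw [Finset.filter_false_of_mem, if_neg h3]
          · simp
          · intro s _; rw [if_neg fun hc => h2 hc.1]; omega
    rw [Finset.sum_congr rfl hterm, Finset.sum_sub_distrib, Finset.sum_add_distrib, Finset.sum_ite_eq',
      Finset.sum_ite_eq', Finset.sum_ite_eq', if_pos (show v ∈ _ by rw [Finset.mem_Ico]; omega),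
      if_pos (show v - 1 ∈ _ by rw [Finset.mem_Ico]; omega), add_sub_cancel_right]
    split_ifs with h
    · rfl
    · rw [Finset.mem_Ico] at h
      rw [hsupp u h]

/-- The levels after exchanging the runners `v - 1` and `v` with one bead too many. -/
def stepLev (d : ℤ → ℤ) (v : ℤ) (r : ℤ) : ℤ :=
  if r = v - 1 then d v + 1 else if r = v then d (v - 1) - 1 else d r

include hv hve in
theorem Far.step (hd : Far e d (N + 1) v) : Far e (stepLev d v) N v := by
  intro i j h0 h h1 hp
  have h2 := hd i j h0 h h1 hp
  unfold stepLev
  by_cases j1 : j = v - 1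
  · subst j1
    have := hd i v h0 (by omega) hve (by omega)
    rw [if_neg (by omega), if_neg (by omega), if_pos rfl]; omega
  by_cases j2 : j = v
  · subst j2
    have := hd i (j - 1) h0 (by omega) (by omega) (by omega)
    rw [if_neg (by omega), if_neg (by omega), if_neg (by omega), if_pos rfl]; omega
  rw [if_neg j1, if_neg j2]
  by_cases i1 : i = v - 1
  · subst i1
    have := hd v j (by omega) (by omega) h1 (by omega)
    rw [if_pos rfl]; omega
  by_cases i2 : i = v
  · subst i2
    have := hd (i - 1) j (by omega) (by omega) h1 (by omega)
    rw [if_neg (by omega), if_pos rfl]; omega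
  · rw [if_neg i1, if_neg i2]; omega

end

theorem row_inj {e : ℕ} {r r' t t' : ℤ} (h0 : 0 ≤ r) (h1 : r < e) (h0' : 0 ≤ r') (h1' : r' < e)
    (h : r + e * t = r' + e * t') : r = r' ∧ t = t' := by
  have he : 0 < e := by omega
  have a1 := congrArg (· % (e : ℤ)) h
  have a2 := congrArg (· / (e : ℤ)) h
  simp only [emod_of_lt h0 h1, emod_of_lt h0' h1'] at a1
  simp only [ediv_of_lt he h0 h1, ediv_of_lt he h0' h1'] at a2
  exact ⟨a1, a2⟩

/-- In the `ℓ v` rows from `d (v - 1)` to `d v` runner `v` has beads and runner `v - 1` has gaps.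
Moving all of them removes precisely the movements with gap count `v`; this is one more move than
the level difference, so it is not a reflection and the distribution may change. -/
theorem ep_col {e : ℕ} (he : 2 ≤ e) {d ℓ : ℤ → ℤ} {N v : ℤ} (hv : 1 ≤ v) (hve : v < e)
    (hℓ : ∀ i, 0 ≤ ℓ i) (hN : ∀ i, colLen v ℓ i < N) (hd : d v = d (v - 1) + ℓ v - 1) (hpos : 0 < ℓ v) :
    EP e v (ℓ v).toNat (col e d (colLen v ℓ))
      (col e (stepLev d v) (colLen v (Function.update ℓ v 0))) := by
  have he0 : 0 < e := by omega
  have hc := colLen_nonneg (v := v) hℓ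
  have hW : ∀ i, colLen v ℓ i ≤ N := fun i => (hN i).le
  have hX : Maya (col e d (colLen v ℓ)) := maya_col he0 hW
  have c1 : colLen v ℓ (v - 1) = 0 := by simp [colLen]
  have c2 : colLen v ℓ v = ℓ (v - 1) + ℓ v := by
    unfold colLen; rw [if_neg (by omega), if_pos rfl]
  have p1 := hℓ (v - 1)
  have hs : ∀ t : ℤ, v + e * t - 1 = v - 1 + e * t := fun t => by ring
  obtain ⟨B', hB'⟩ := exists_ep_of_row he (a := v) (ℓ v).toNat hX ⟨d (v - 1), by
    unfold row ht
    rw [nb_col he0 hc hW, nb_col he0 hc hW, hs, levOf_row he0 (by omega) hve,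
      levOf_row he0 (by omega) (by omega), emod_of_lt (by omega) hve,
      emod_of_lt (by omega) (by omega), c1, c2, if_neg (by omega), if_pos (by omega)]
    omega⟩
  obtain ⟨F, h1, h2, h3, -, -⟩ := hB'.flips he hX
  -- No other rows are removable, and there are as many of these as moves.
  have hF : F = Finset.Icc (d (v - 1)) (d v) := by
    refine Finset.eq_of_subset_of_card_le (fun f hf => ?_) ?_
    · obtain ⟨a1, a2⟩ := h2 f hf
      rw [hs, mem_col he0 (by omega) (by omega), c1] at a1
      rw [mem_col he0 (by omega) hve] at a2
      rw [Finset.mem_Icc]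
      exact ⟨by by_contra hc'; exact a1 ⟨by omega, by omega⟩, a2.1⟩
    · rw [h1, Int.card_Icc]; omega
  suffices B' = col e (stepLev d v) (colLen v (Function.update ℓ v 0)) by rwa [← this]
  ext x
  obtain ⟨r, t, h0, h1', rfl⟩ := exists_row he0 x
  rw [h3, hF, mem_col he0 h0 h1', mem_col he0 h0 h1']
  have e1 : (∀ f ∈ Finset.Icc (d (v - 1)) (d v), r + (e : ℤ) * t ≠ v + e * f) ↔
      ¬ (r = v ∧ d (v - 1) ≤ t ∧ t ≤ d v) := by
    constructor
    · rintro h ⟨rfl, h4, h5⟩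
      exact h t (Finset.mem_Icc.2 ⟨h4, h5⟩) rfl
    · intro h f hf hc'
      obtain ⟨rfl, rfl⟩ := row_inj h0 h1' (by omega) hve hc'
      exact h ⟨rfl, Finset.mem_Icc.1 hf⟩
  have e2 : (∃ f ∈ Finset.Icc (d (v - 1)) (d v), r + (e : ℤ) * t = v + e * f - 1) ↔
      r = v - 1 ∧ d (v - 1) ≤ t ∧ t ≤ d v := by
    constructor
    · rintro ⟨f, hf, h⟩
      rw [hs] at h
      obtain ⟨rfl, rfl⟩ := row_inj h0 h1' (by omega) (by omega) h
      exact ⟨rfl, Finset.mem_Icc.1 hf⟩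
    · rintro ⟨rfl, h⟩
      exact ⟨t, Finset.mem_Icc.2 h, by ring⟩
  rw [e1, e2]
  by_cases r1 : r = v - 1
  · subst r1
    have : colLen v (Function.update ℓ v 0) (v - 1) = 0 := by simp [colLen]
    rw [c1, this]
    simp only [stepLev, if_true, true_and]
    omega
  by_cases r2 : r = v
  · subst r2
    have : colLen r (Function.update ℓ r 0) r = ℓ (r - 1) := by
      unfold colLen
      rw [if_neg r1, if_pos rfl, Function.update_self, Function.update_of_ne (by omega), add_zero]
    rw [c2, this]
    simp only [stepLev, if_neg r1, if_true, true_and]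
    omega
  · have : colLen v (Function.update ℓ v 0) r = colLen v ℓ r := by
      unfold colLen
      rw [if_neg r1, if_neg r2, if_neg r1, if_neg r2, Function.update_of_ne r2]
    rw [this]
    simp only [stepLev, if_neg r1, if_neg r2]
    tauto

theorem EP.shift {e : ℕ} {a : ℤ} {n : ℕ} {B B' : Set ℤ} (h : EP e a n B B') (k : ℤ) : EP e (a - e * k) n B B' := by
  induction h with
  | nil B => exact .nil B
  | cons n B B' p hp _ ih =>
    have : a + (e : ℤ) * p = a - e * k + e * (p + k) := by ring
    rw [this] at hp ih
    exact .cons _ _ _ _ hp ih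

/-! ### Duality of levels and distributions -/

/-- The levels of the conjugate bead set. -/
def dualLev (D : ℤ → ℤ) (x : ℤ) : ℤ := 1 - D (-1 - x)

/-- The distribution of gap counts of the image under the Mullineux map. -/
def dualCnt (e : ℕ) (ℓ : ℤ → ℤ) (v : ℤ) : ℤ := ℓ (e - v)

/-- The levels of the conjugate bead set, runner by runner. -/
def dualRun (e : ℕ) (d : ℤ → ℤ) (r : ℤ) : ℤ := -d (e - 1 - r)

theorem lev_conj' {e : ℕ} (he : 0 < e) {B : Set ℤ} (hB : Maya B) :
    lev e (conj B) = dualLev (lev e B) := by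
  funext x
  rw [lev_conj, lev_add he hB]; unfold dualLev; ring

theorem isLev_dualLev {e : ℕ} {D : ℤ → ℤ} (hD : IsLev e D) : IsLev e (dualLev D) := by
  intro x
  have := hD (-1 - (x + e))
  unfold dualLev
  rw [show -1 - (x + (e : ℤ)) + e = -1 - x by ring] at this
  omega

theorem dualLev_levOf {e : ℕ} (he : 0 < e) (d : ℤ → ℤ) :
    dualLev (levOf e d) = levOf e (dualRun e d) := by
  funext x
  obtain ⟨r, t, h0, h1, rfl⟩ := exists_row he x
  unfold dualLev
  rw [show -1 - (r + (e : ℤ) * t) = e - 1 - r + e * (-t - 1) by ring, levOf_row he (by omega) (by omega),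
    levOf_row he h0 h1]
  unfold dualRun; ring

theorem dualLev_swapLev {e : ℕ} (he : 2 ≤ e) (a : ℤ) (D : ℤ → ℤ) :
    dualLev (swapLev e a D) = swapLev e (-a) (dualLev D) := by
  funext x
  unfold dualLev swapLev
  have e1 : (e : ℤ) ∣ -1 - x - a ↔ (e : ℤ) ∣ x - (-a - 1) := by
    rw [show -1 - x - a = -(x - (-a - 1)) by ring, dvd_neg]
  have e2 : (e : ℤ) ∣ -1 - x - (a - 1) ↔ (e : ℤ) ∣ x - -a := by
    rw [show -1 - x - (a - 1) = -(x - -a) by ring, dvd_neg]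
  simp only [e1, e2]
  by_cases h1 : (e : ℤ) ∣ x - -a
  · rw [if_neg (Swap.not_dvd_pred he h1), if_pos h1, if_pos h1]; ring_nf
  · by_cases h2 : (e : ℤ) ∣ x - (-a - 1)
    · rw [if_pos h2, if_neg h1, if_pos h2]; ring_nf
    · rw [if_neg h2, if_neg h1, if_neg h1, if_neg h2]

theorem dualRun_stepLev {e : ℕ} (d : ℤ → ℤ) (v : ℤ) :
    dualRun e (stepLev d v) = stepLev (dualRun e d) (e - v) := by
  funext r
  unfold dualRun stepLev
  by_cases h1 : r = e - v - 1
  · subst h1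
    rw [if_neg (by omega), if_pos (by omega), if_pos rfl]
    show -(d (v - 1) - 1) = -d (e - 1 - (e - v)) + 1
    rw [show (e : ℤ) - 1 - (e - v) = v - 1 by ring]; ring
  by_cases h2 : r = e - v
  · subst h2
    rw [if_pos (by omega), if_neg h1, if_pos rfl]
    show -(d v + 1) = -d (e - 1 - (e - v - 1)) - 1
    rw [show (e : ℤ) - 1 - (e - v - 1) = v by ring]; ring
  · rw [if_neg (by omega), if_neg (by omega), if_neg h1, if_neg h2]

theorem dualCnt_update {e : ℕ} (ℓ : ℤ → ℤ) (v : ℤ) :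
    dualCnt e (Function.update ℓ v 0) = Function.update (dualCnt e ℓ) (e - v) 0 := by
  funext u
  unfold dualCnt
  by_cases h : u = e - v
  · subst h; simp
  · rw [Function.update_of_ne h, Function.update_of_ne (by omega)]

theorem Far.dual {e : ℕ} {d : ℤ → ℤ} {N v : ℤ} (h : Far e d N v) : Far e (dualRun e d) N (e - v) := by
  intro i j h0 h1 h2 hp
  have := h (e - 1 - j) (e - 1 - i) (by omega) (by omega) (by omega) (by omega)
  unfold dualRun; omega

theorem dualLev_translate (D : ℤ → ℤ) (t : ℤ) :
    dualLev (fun x => D (x - t)) = fun x => dualLev D (x - -t) := by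
  funext x; unfold dualLev; ring_nf

/-! ### Translation of matched pairs -/

theorem ht_tr (e : ℕ) (c : ℤ) (B : Set ℤ) (x : ℤ) : ht e (tr c B) (x + c) = ht e B x := by
  unfold ht; rw [nb_tr, nb_tr]; ring_nf

theorem Good.tr {e : ℕ} {B : Set ℤ} {x : ℤ} (h : Good e B x) (c : ℤ) : Good e (tr c B) (x + c) := by
  refine ⟨by rw [ht_tr]; exact h.1, fun t => ?_, fun t ht' => ?_⟩
  · rw [ht_tr, show x + c + (e : ℤ) * t = x + e * t + c by ring, ht_tr]; exact h.2.1 t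
  · rw [ht_tr, show x + c + (e : ℤ) * t = x + e * t + c by ring, ht_tr]; exact h.2.2 t ht'

theorem mv_tr (B : Set ℤ) (x c : ℤ) : mv (tr c B) (x + c) = tr c (mv B x) := by
  ext y
  show (y - c ∈ B ∧ y ≠ x + c) ∨ y = x + c - 1 ↔ (y - c ∈ B ∧ y - c ≠ x) ∨ y - c = x - 1
  have : y ≠ x + c ↔ y - c ≠ x := by omega
  have : y = x + c - 1 ↔ y - c = x - 1 := by omega
  tauto

theorem MP.tr {e n : ℕ} {B C : Set ℤ} (h : MP e n B C) (c : ℤ) : MP e n (tr c B) (tr (-c) C) := by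
  have hI : ∀ a c : ℤ, Abacus.tr c (Set.Iio a) = Set.Iio (a + c) := fun a c => by
    ext x; show x - c < a ↔ x < a + c; omega
  induction h with
  | base a =>
    rw [hI, hI, show -a + -c = -(a + c) by ring]
    exact .base _
  | step n B C x y hxy hx hy _ ih =>
    refine .step n _ _ (x + c) (y + -c) (by rwa [show x + c + (y + -c) = x + y by ring]) (hx.tr c) (hy.tr _) ?_
    rwa [mv_tr, mv_tr]

/-! ### Uniqueness in a class -/

theorem gp_nonneg (e : ℕ) (B : Set ℤ) (x : ℤ) : 0 ≤ gp e B x :=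
  Finset.sum_nonneg fun j _ => by have := ch_le_one B (x - j); omega

theorem gp_le (e : ℕ) (B : Set ℤ) (x : ℤ) : gp e B x ≤ e := by
  unfold gp
  calc _ ≤ ∑ j ∈ Finset.range e, (1 : ℤ) := Finset.sum_le_sum fun j _ => by
        have := ch_nonneg B (x - j); omega
    _ = e := by simp

/-- The starting positions of the bead movements. -/
def activeSet (e : ℕ) {B : Set ℤ} (hB : Maya B) : Finset ℤ := (mult_support_finite (e := e) hB).toFinset

theorem mem_activeSet {e : ℕ} {B : Set ℤ} (hB : Maya B) {x : ℤ} : x ∈ activeSet e hB ↔ 0 < mult e B x := by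
  unfold activeSet
  rw [Set.Finite.mem_toFinset, Set.mem_ofPred_eq]
  have := mult_nonneg e B x
  omega

theorem cnt_eq_sum {e : ℕ} {B : Set ℤ} (hB : Maya B) (v : ℤ) :
    cnt e B v = ∑ x ∈ activeSet e hB, if gp e B x = v then mult e B x else 0 := by
  refine finsum_eq_sum_of_support_subset _ fun x hx => ?_
  rw [Function.mem_support] at hx
  rw [Finset.mem_coe, mem_activeSet]
  have := mult_nonneg e B x
  by_contra hc
  rw [show mult e B x = 0 by omega] at hx
  simp at hx

/-- A bound in terms of the class alone, so that a separation chosen from `ℓ` works for all members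
at once. -/
theorem card_activeSet_le {e : ℕ} {B : Set ℤ} (hB : Maya B) :
    ((activeSet e hB).card : ℤ) ≤ ∑ v ∈ Finset.Icc (0 : ℤ) e, cnt e B v := by
  simp only [cnt_eq_sum hB]
  rw [Finset.sum_comm, Finset.card_eq_sum_ones, Nat.cast_sum]
  refine Finset.sum_le_sum fun x hx => ?_
  rw [Finset.sum_ite_eq, if_pos (Finset.mem_Icc.2 ⟨gp_nonneg e B x, gp_le e B x⟩)]
  rw [mem_activeSet] at hx
  push_cast; omega

theorem mult_pos_iff' {e : ℕ} {B : Set ℤ} {x : ℤ} : 0 < mult e B x ↔ 0 < nb e B x ∧ 0 < ng e B x := by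
  unfold mult; exact lt_min_iff

/-! ### Positions with large level are not disturbed. -/

section

variable {e : ℕ} (he : 0 < e) {B : Set ℤ} (hB : Maya B)
include he hB

/-- Walking along the runner from an active position towards level zero stays in active positions,
one for each level. -/
theorem abs_lev_lt {x : ℤ} (hx : 0 < mult e B x) : |lev e B x| < (activeSet e hB).card := by
  rw [mult_pos_iff'] at hx
  have inj : ∀ σ : ℤ, σ ≠ 0 → Function.Injective fun j : ℕ => x + e * (σ * j) := by
    intro σ hσ i j hij
    have h1 : (e : ℤ) * (σ * i) = e * (σ * j) := by simpa using hij
    have h2 := mul_left_cancel₀ (show (e : ℤ) ≠ 0 by omega) h1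
    exact_mod_cast mul_left_cancel₀ hσ h2
  have key : ∀ σ : ℤ, σ ≠ 0 → (∀ j : ℕ, (j : ℤ) ≤ |lev e B x| → 0 < mult e B (x + e * (σ * j))) →
      |lev e B x| < (activeSet e hB).card := by
    intro σ hσ h
    have h1 : ((Finset.range (|lev e B x|.toNat + 1)).image fun j : ℕ => x + e * (σ * j)) ⊆ activeSet e hB := by
      intro y hy
      obtain ⟨j, hj, rfl⟩ := Finset.mem_image.1 hy
      rw [Finset.mem_range] at hj
      have := abs_nonneg (lev e B x)
      exact (mem_activeSet hB).2 (h j (by omega))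
    have h2 := Finset.card_le_card h1
    rw [Finset.card_image_of_injective _ (inj σ hσ), Finset.card_range] at h2
    omega
  rcases le_total 0 (lev e B x) with h | h
  · refine key 1 one_ne_zero fun j hj => ?_
    rw [abs_of_nonneg h] at hj
    have h1 := lev_add_mul he hB x j
    have h2 := ng_add_mul_le he hB x j
    rw [one_mul, mult_pos_iff']
    unfold lev at *
    constructor <;> omega
  · refine key (-1) (by norm_num) fun j hj => ?_
    rw [abs_of_nonpos h] at hj
    have h1 := lev_add_mul he hB x (-j)
    have h2 := nb_add_mul_le he hB (x + e * (-j)) j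
    rw [show x + (e : ℤ) * (-j) + e * j = x by ring] at h2
    rw [show (-1 : ℤ) * j = -j by ring, mult_pos_iff']
    unfold lev at *
    constructor <;> omega

theorem notMem_of_lev_le {x : ℤ} (h : lev e B x ≤ -(activeSet e hB).card) : x ∉ B := by
  intro hx
  have h1 := nb_rec he hB x
  rw [ch_of_mem hx] at h1
  have h2 := nb_nonneg e B (x + e)
  have h3 : 0 < mult e B x := (mult_pos_iff').2 ⟨by omega, by unfold lev at h; omega⟩
  have h4 := abs_lev_lt he hB h3
  have h5 := neg_abs_le (lev e B x)
  omega

theorem mem_of_le_lev {x : ℤ} (h : (activeSet e hB).card < lev e B x) : x ∈ B := by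
  by_contra hx
  have h1 := nb_rec he hB x
  have h2 := ng_rec he hB x
  rw [ch_of_notMem hx] at h1 h2
  have h3 := ng_nonneg e B x
  have h6 := lev_add he hB x
  have h3 : 0 < mult e B (x + e) := (mult_pos_iff').2 ⟨by unfold lev at h; omega, by omega⟩
  have h4 := abs_lev_lt he hB h3
  have h5 := le_abs_self (lev e B (x + e))
  omega

end

/-- With levels `N * r` an active position of runner `r` has gap count `r` if it carries a bead and
`r + 1` otherwise. Increasing gap counts therefore forbid a bead after an active gap, and as some
bead must follow, all active positions carry beads. This leaves one column per runner, and counting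
gap counts gives its length. -/
theorem exists_col {e : ℕ} (he : 0 < e) {N : ℤ} {ℓ : ℤ → ℤ} {B : Set ℤ} (h : Cls e (levOf e (N * ·)) ℓ B)
    (hN : 2 * ∑ v ∈ Finset.Icc (0 : ℤ) e, ℓ v < N) : ∀ r t : ℤ, 0 ≤ r → r < e →
      (r + e * t ∈ B ↔ t ≤ N * r ∧ N * r - t ≠ ℓ r) := by
  have hB := h.maya
  have hW := card_activeSet_le (e := e) hB
  simp only [h.cnt] at hW
  set W : ℤ := ((activeSet e hB).card : ℤ) with hWdef
  have hW0 : 0 ≤ W := by positivity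
  have hlev : ∀ r t : ℤ, 0 ≤ r → r < e → lev e B (r + e * t) = N * r - t := fun r t h0 h1 => by
    rw [h.lev, levOf_row he h0 h1]
  -- the gap count of an active position
  have hgp : ∀ r t : ℤ, 0 ≤ r → r < e → 0 < mult e B (r + e * t) →
      gp e B (r + e * t) = r + 1 - ch B (r + e * t) := by
    intro r t h0 h1 hx
    have hl := abs_lev_lt he hB hx
    rw [hlev r t h0 h1, abs_lt] at hl
    rw [gp_eq_sum _ h0 h1, Finset.sum_congr rfl (g := fun i => (if i < r then 1 else 0) +
      if i = r then 1 - ch B (r + e * t) else 0), Finset.sum_add_distrib, Finset.sum_ite_eq',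
      if_pos (by rw [Finset.mem_Ico]; omega), Finset.sum_boole,
      show (Finset.Ico (0 : ℤ) e).filter (· < r) = Finset.Ico 0 r by
        ext i; simp only [Finset.mem_filter, Finset.mem_Ico]; omega, Int.card_Ico]
    · omega
    · intro i hi
      rw [Finset.mem_Ico] at hi
      have hli := hlev i (t - if r < i then 1 else 0) hi.1 hi.2
      rcases lt_trichotomy i r with h2 | rfl | h2
      · rw [if_pos h2, if_neg h2.ne, ch_of_notMem]
        · rfl
        · refine notMem_of_lev_le he hB ?_
          rw [hli, if_neg (by omega)]
          have : N * i ≤ N * r - N := by nlinarith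
          omega
      · rw [if_neg (lt_irrefl i), if_pos rfl]; ring_nf
      · rw [if_neg (by omega : ¬ i < r), if_neg h2.ne', ch_of_mem]
        · rfl
        · refine mem_of_le_lev he hB ?_
          rw [hli, if_pos h2]
          have : N * r + N ≤ N * i := by nlinarith
          omega
  have active_iff : ∀ x, 0 < mult e B x ↔ 0 < nb e B x ∧ 0 < ng e B x := fun x => mult_pos_iff'
  -- active positions carry beads
  have hmem : ∀ x, 0 < mult e B x → x ∈ B := by
    intro x hx
    obtain ⟨r, t, h0, h1, rfl⟩ := exists_row he x
    by_contra hc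
    have all : ∀ j : ℕ, 0 < mult e B (r + e * (t + j)) ∧ r + e * (t + j) ∉ B := by
      intro j
      induction j with
      | zero => simpa using ⟨hx, hc⟩
      | succ j ih =>
        have a1 := nb_rec he hB (r + e * (t + j))
        have a2 := ng_rec he hB (r + e * (t + j))
        rw [ch_of_notMem ih.2, show r + (e : ℤ) * (t + j) + e = r + e * (t + (j + 1 : ℕ)) by push_cast; ring] at a1 a2
        have a3 := (active_iff _).1 ih.1
        have a4 := (active_iff (r + e * (t + (j + 1 : ℕ)))).2 ⟨by omega, by omega⟩
        refine ⟨a4, fun hc' => ?_⟩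
        have a5 := hgp _ _ h0 h1 ih.1
        have a6 := hgp _ _ h0 h1 a4
        rw [ch_of_notMem ih.2] at a5
        rw [ch_of_mem hc'] at a6
        have := h.inc _ _ ih.1 a4 (by push_cast; nlinarith)
        omega
    obtain ⟨i, hi⟩ := (nb_pos_iff he hB _).1 ((active_iff _).1 hx).1
    refine (all i).2 ?_
    rwa [show r + (e : ℤ) * (t + i) = r + e * t + e * i by ring]
  -- If there were two gaps above, the position one row higher would again be active, hence a bead
  -- with two gaps above it, and so on without end.
  have hng : ∀ x, 0 < mult e B x → ng e B x = 1 := by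
    intro x hx
    by_contra hc
    have h2 := (active_iff x).1 hx
    have all : ∀ j : ℕ, 2 ≤ ng e B (x - e * j) ∧ 0 < nb e B (x - e * j) := by
      intro j
      induction j with
      | zero => simp; omega
      | succ j ih =>
        have a1 := nb_rec he hB (x - e * (j + 1 : ℕ))
        have a2 := ng_rec he hB (x - e * (j + 1 : ℕ))
        rw [show x - (e : ℤ) * (j + 1 : ℕ) + e = x - e * j by push_cast; ring] at a1 a2
        have c0 := ch_nonneg B (x - e * (j + 1 : ℕ))
        have c1 := ch_le_one B (x - e * (j + 1 : ℕ))
        have := ch_of_mem (hmem _ ((active_iff (x - e * (j + 1 : ℕ))).2 ⟨by omega, by omega⟩))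
        omega
    obtain ⟨lo, hlo⟩ := hB.1
    have := (all (|x| + |lo|).toNat).1
    rw [ng_eq_zero hlo] at this
    · omega
    · have b1 := abs_nonneg x
      have b2 := abs_nonneg lo
      have b3 := le_abs_self x
      have b4 := neg_abs_le lo
      have b5 : (((|x| + |lo|).toNat : ℕ) : ℤ) = |x| + |lo| := by omega
      rw [b5]
      have : |x| + |lo| ≤ e * (|x| + |lo|) := by nlinarith
      omega
  have hnn : ∀ x, 0 < mult e B x → 0 ≤ lev e B x := fun x hx => by
    have := hng x hx
    have := (active_iff x).1 hx
    unfold lev; omega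
  -- the active positions on a runner form an initial segment
  have hc : ∀ r : ℤ, ∃ c : ℤ, 0 ≤ c ∧ c ≤ W ∧ (0 ≤ r → r < e → ∀ s : ℤ, 0 ≤ s →
      (0 < mult e B (r + e * (N * r - s)) ↔ s < c)) := by
    intro r
    by_cases hr : 0 ≤ r ∧ r < e
    swap
    · exact ⟨0, le_rfl, hW0, fun h0 h1 => absurd ⟨h0, h1⟩ hr⟩
    have hbig : ∀ s, W ≤ s → ¬ 0 < mult e B (r + e * (N * r - s)) := fun s hs hx => by
      have := abs_lev_lt he hB hx
      rw [hlev r _ hr.1 hr.2, sub_sub_cancel] at this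
      have := le_abs_self s
      omega
    obtain ⟨c, ⟨hc0, hc1⟩, hmin⟩ := Int.exists_least_of_bdd
      (P := fun s => 0 ≤ s ∧ ¬ 0 < mult e B (r + e * (N * r - s))) ⟨0, fun s hs => hs.1⟩
      ⟨W, hW0, hbig W le_rfl⟩
    refine ⟨c, hc0, hmin W ⟨hW0, hbig W le_rfl⟩, fun _ _ s hs => ⟨fun hx => ?_, fun hsc => ?_⟩⟩
    · by_contra hcs
      push Not at hcs
      have down : ∀ n : ℕ, c ≤ s - n → 0 < mult e B (r + e * (N * r - (s - n))) := by
        intro n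
        induction n with
        | zero => intro _; simpa using hx
        | succ n ih =>
          intro hn
          push_cast at hn ⊢
          have a0 := ih (by omega)
          have a1 := nb_rec he hB (r + e * (N * r - (s - n)))
          have a2 := ng_rec he hB (r + e * (N * r - (s - n)))
          rw [ch_of_mem (hmem _ a0), show r + (e : ℤ) * (N * r - (s - n)) + e =
            r + e * (N * r - (s - (n + 1))) by ring] at a1 a2
          have a3 := hlev r (N * r - (s - n)) hr.1 hr.2
          have a4 := hng _ a0
          unfold lev at a3
          exact (active_iff _).2 ⟨by omega, by omega⟩
      have := down (s - c).toNat (by omega)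
      rw [show s - ((s - c).toNat : ℤ) = c by omega] at this
      exact hc1 this
    · by_contra hx
      have := hmin s ⟨hs, hx⟩
      omega
  choose c hc0 hcW hc using hc
  have hcol : B = col e (N * ·) c := by
    ext x
    obtain ⟨r, t, h0, h1, rfl⟩ := exists_row he x
    rw [mem_col he h0 h1]
    have a1 := nb_rec he hB (r + e * t)
    have a2 := ng_rec he hB (r + e * t)
    rw [show r + (e : ℤ) * t + e = r + e * (t + 1) by ring] at a1 a2
    have a3 := hlev r t h0 h1
    have a4 := hlev r (t + 1) h0 h1
    have b1 := nb_nonneg e B (r + e * (t + 1))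
    have b2 := ng_nonneg e B (r + e * t)
    have b3 := active_iff (r + e * t)
    have b4 := active_iff (r + e * (t + 1))
    have b5 := hnn (r + e * t)
    have b6 := hng (r + e * (t + 1))
    have b7 := hmem (r + e * t)
    have k1 : 0 ≤ N * r - t → (0 < mult e B (r + e * t) ↔ N * r - t < c r) := fun hs => by
      have := hc r h0 h1 (N * r - t) hs
      rwa [sub_sub_cancel] at this
    have k2 : 0 ≤ N * r - t - 1 → (0 < mult e B (r + e * (t + 1)) ↔ N * r - t - 1 < c r) := fun hs => by
      have := hc r h0 h1 (N * r - t - 1) hs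
      rwa [show N * r - (N * r - t - 1) = t + 1 by ring] at this
    have hc0r := hc0 r
    unfold lev at a3 a4 b5
    rcases ch_cases B (r + e * t) with ⟨m, m'⟩ | ⟨m, m'⟩
    · simp only [m, true_iff]
      by_cases hs : 0 ≤ N * r - t
      · refine ⟨by omega, fun hsc => ?_⟩
        have := k1 hs
        omega
      · exfalso; omega
    · simp only [m, false_iff]
      rintro ⟨hs, hsc⟩
      have := k1 (by omega)
      by_cases hs' : 0 ≤ N * r - t - 1
      · have := k2 hs'; omega
      · omega
  have hcℓ : ∀ r : ℤ, 0 ≤ r → r < e → c r = ℓ r := by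
    intro v h0 h1
    rw [← h.cnt, hcol, cnt_col he hc0 hcW, Finset.sum_congr rfl (g := fun r => if r = v then c r else 0),
      Finset.sum_ite_eq', if_pos (Finset.mem_Ico.2 ⟨h0, h1⟩)]
    intro r hr
    rw [Finset.mem_Ico] at hr
    have : ∀ s ∈ Finset.Ico (0 : ℤ) (c r), (if gcol e (N * ·) c r s = v then (1 : ℤ) else 0) =
        if r = v then 1 else 0 := by
      intro s hs
      rw [Finset.mem_Ico] at hs
      have a1 := (hc r hr.1 hr.2 s hs.1).2 hs.2
      have a2 := hgp _ _ hr.1 hr.2 a1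
      rw [ch_of_mem (hmem _ a1), hcol, gp_col he hr.1 hr.2, sub_sub_cancel, add_sub_cancel_right] at a2
      rw [a2]
    rw [Finset.sum_congr rfl this]
    have := hc0 r
    split_ifs <;> simp; omega
  intro r t h0 h1
  rw [← hcℓ r h0 h1]
  conv_lhs => rw [hcol]
  exact mem_col he h0 h1 _ _ _

/-- Reflections reduce the question to a well separated core, where `exists_col` describes every
member. -/
theorem cls_unique {e : ℕ} (he : 2 ≤ e) {ℓ D : ℤ → ℤ} (hD : IsLev e D) {B C : Set ℤ} (hB : Cls e D ℓ B)
    (hC : Cls e D ℓ C) : B = C := by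
  have he0 : 0 < e := by omega
  refine cls_unique_of he (isLev_levOf he0 ((2 * ∑ v ∈ Finset.Icc (0 : ℤ) e, ℓ v + 1) * ·)) hD
    (fun B C hB hC => ?_) B C hB hC
  ext x
  obtain ⟨r, t, h0, h1, rfl⟩ := exists_row he0 x
  rw [exists_col he0 hB (by omega) r t h0 h1, exists_col he0 hC (by omega) r t h0 h1]

/-! ### Existence of matched pairs with prescribed distributions -/

/-- There is a matched pair with given levels and a given distribution of gap counts. -/
def HasPair (e : ℕ) (ℓ D : ℤ → ℤ) : Prop :=
  ∃ B C n, Cls e D ℓ B ∧ Cls e (dualLev D) (dualCnt e ℓ) C ∧ MP e n B C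

/-- The level difference at `-a` on the dual side equals the one at `a`, so matched chains of the
same length reflect both sides simultaneously. -/
theorem HasPair.swap {e : ℕ} (he : 3 ≤ e) {ℓ D : ℤ → ℤ} {a : ℤ} (h : HasPair e ℓ D) :
    HasPair e ℓ (swapLev e a D) := by
  have he2 : 2 ≤ e := by omega
  obtain ⟨B, C, n, hB, hC, hmp⟩ := h
  have hd : dualLev D (-a) - dualLev D (-a - 1) = D a - D (a - 1) := by
    unfold dualLev; rw [show -1 - -a = a - 1 by ring, show -1 - (-a - 1) = a by ring]; ring
  unfold HasPair
  rw [dualLev_swapLev he2]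
  rcases le_total (D (a - 1)) (D a) with h1 | h1
  · have hn : (((D a - D (a - 1)).toNat : ℕ) : ℤ) = D a - D (a - 1) := by omega
    obtain ⟨B', hB'⟩ := exists_ep he2 hB.maya (a := a) (n := (D a - D (a - 1)).toNat)
      (by rw [hB.lev, hB.lev, hn])
    obtain ⟨m, C', -, hC', hmp'⟩ := hmp.ep he hB'
    exact ⟨B', C', m, hB.ep he2 hn hB', hC.ep he2 (by rw [hn, hd]) hC', hmp'⟩
  · have hn : (((D (a - 1) - D a).toNat : ℕ) : ℤ) = D (a - 1) - D a := by omega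
    obtain ⟨B', hB'⟩ := exists_ep_to he2 hB.maya (a := a) (n := (D (a - 1) - D a).toNat)
      (by rw [hB.lev, hB.lev, hn])
    obtain ⟨C', hC'⟩ := exists_ep_to he2 hC.maya (a := -a) (n := (D (a - 1) - D a).toNat)
      (by rw [hC.lev, hC.lev, hn]; omega)
    exact ⟨B', C', _, hB.of_ep he2 hn hB', hC.of_ep he2 (by rw [hn]; omega) hC', hmp.of_ep hB' hC'⟩

theorem HasPair.of_one {e : ℕ} (he : 3 ≤ e) {ℓ K D : ℤ → ℤ} (hK : IsLev e K) (h : HasPair e ℓ K)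
    (hD : IsLev e D) : HasPair e ℓ D := by
  refine lev_induction (by omega) (fun D a _ h => h.swap he) (fun D t _ h => ?_) hK h hD
  obtain ⟨B, C, n, hB, hC, hmp⟩ := h
  refine ⟨tr t B, tr (-t) C, n, hB.tr t, ?_, hmp.tr t⟩
  rw [dualLev_translate]
  exact hC.tr (-t)

theorem cls_vacuum {e : ℕ} (he : 0 < e) : Cls e (lev e (Set.Iio 0)) 0 (Set.Iio 0) := by
  have hm : ∀ x, mult e (Set.Iio 0) x = 0 := by
    intro x
    have h0 := mult_nonneg e (Set.Iio 0) x
    by_contra hc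
    have := (mult_pos_iff' (e := e) (B := Set.Iio 0) (x := x)).1 (by omega)
    obtain ⟨i, hi⟩ := (nb_pos_iff he (maya_Iio 0) x).1 this.1
    obtain ⟨j, hj⟩ := (ng_pos_iff he (maya_Iio 0) x).1 this.2
    rw [Set.mem_Iio] at hi hj
    have h1 : (0 : ℤ) ≤ e * i := by positivity
    have h2 : (0 : ℤ) ≤ e * (j + 1) := by positivity
    omega
  refine ⟨maya_Iio 0, fun x => rfl, fun x y hx => ?_, fun v => ?_⟩
  · rw [hm] at hx; omega
  · unfold cnt; simp [hm]

theorem conj_Iio_zero : conj (Set.Iio 0) = Set.Iio 0 := by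
  ext x
  show ¬ (-1 - x < 0) ↔ x < 0
  omega

theorem hasPair_zero {e : ℕ} (he : 3 ≤ e) {D : ℤ → ℤ} (hD : IsLev e D) : HasPair e 0 D := by
  have he0 : 0 < e := by omega
  have h0 := cls_vacuum he0
  refine HasPair.of_one he (isLev_lev he0 (maya_Iio 0)) ⟨Set.Iio 0, Set.Iio 0, 0, h0, ?_, ?_⟩ hD
  · rw [← lev_conj' he0 (maya_Iio 0), conj_Iio_zero]; exact h0
  · simpa using MP.base (e := e) 0

theorem exists_cls_step {e : ℕ} (he : 2 ≤ e) {d ℓ : ℤ → ℤ} {N v : ℤ} (hv : 1 ≤ v) (hve : v < e)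
    (hℓ : ∀ i, 0 ≤ ℓ i) (hN : ∀ i, colLen v ℓ i < N) (hfar : Far e d (N + 1) v)
    (hd : d v = d (v - 1) + ℓ v - 1) (hpos : 0 < ℓ v) (hsupp : ∀ i : ℤ, ¬ (0 ≤ i ∧ i < e) → ℓ i = 0) :
    ∃ X Y, Cls e (levOf e d) ℓ X ∧ Cls e (levOf e (stepLev d v)) (Function.update ℓ v 0) Y ∧
      EP e v (ℓ v).toNat X Y := by
  have hℓ' : ∀ i, 0 ≤ Function.update ℓ v 0 i := fun i => by
    by_cases h : i = v
    · subst h; simp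
    · rw [Function.update_of_ne h]; exact hℓ i
  refine ⟨_, _, cls_far hv hve (N := N) (fun i j h0 h1 h2 h3 => by
      have := hfar i j h0 h1 h2 h3; omega) hℓ hN he (fun s hs => by omega) hsupp,
    cls_far hv hve (hfar.step hv hve) hℓ' (fun i => ?_) he (fun s hs => ?_) (fun i hi => ?_),
    ep_col he hv hve hℓ hN hd hpos⟩
  · have h1 := hN i
    have h2 := hℓ v
    unfold colLen at h1 ⊢
    split_ifs at h1 ⊢ with a1 a2
    · exact h1
    · rw [Function.update_self, Function.update_of_ne (by omega)]; omega
    · rwa [Function.update_of_ne a2]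
  · unfold stepLev
    rw [if_pos rfl, if_neg (by omega), if_pos rfl, Function.update_self]
    omega
  · rw [Function.update_of_ne (by omega)]; exact hsupp i hi

/-- Remove one gap count `v` from the support. On a suitable core explicit chains of `ℓ v` good
moves lead from both classes to the classes for the smaller support. Their ends form a matched pair
by induction and uniqueness, and the pair is pulled back along the chains. -/
theorem hasPair {e : ℕ} (he : 3 ≤ e) (S : Finset ℤ) (hS : ∀ v ∈ S, 1 ≤ v ∧ v < e) :
    ∀ {ℓ : ℤ → ℤ}, (∀ v, 0 ≤ ℓ v) → (∀ v, v ∉ S → ℓ v = 0) → ∀ {D : ℤ → ℤ}, IsLev e D → HasPair e ℓ D := by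
  have he2 : 2 ≤ e := by omega
  have he0 : 0 < e := by omega
  induction S using Finset.induction with
  | empty =>
    intro ℓ _ h D hD
    rw [show ℓ = 0 from funext fun v => h v (by simp)]
    exact hasPair_zero he hD
  | insert v S hvS ih =>
    intro ℓ hℓ h D hD
    have ih' := @ih fun u hu => hS u (Finset.mem_insert_of_mem hu)
    obtain ⟨hv, hve⟩ := hS v (Finset.mem_insert_self _ _)
    by_cases hz : ℓ v = 0
    · exact ih' hℓ (fun u hu => by
        by_cases huv : u = v
        · rw [huv, hz]
        · exact h u (by simp [huv, hu])) hD
    have hpos : 0 < ℓ v := lt_of_le_of_ne (hℓ v) (Ne.symm hz)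
    have hsupp : ∀ i : ℤ, ¬ (0 ≤ i ∧ i < e) → ℓ i = 0 := fun i hi => h i fun hc => by
      have := hS i hc; omega
    set W := ∑ i ∈ Finset.Ico (0 : ℤ) e, ℓ i with hW
    have hle : ∀ i, ℓ i ≤ W := by
      intro i
      have hW0 : 0 ≤ W := Finset.sum_nonneg fun i _ => hℓ i
      by_cases hi : 0 ≤ i ∧ i < e
      · exact Finset.single_le_sum (f := ℓ) (fun j _ => hℓ j) (Finset.mem_Ico.2 hi)
      · rw [hsupp i hi]; exact hW0
    set N := 2 * W + 1 with hNdef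
    have hN : ∀ i, colLen v ℓ i < N := fun i => by
      have h1 := hle i; have h2 := hle v; have h3 := hle (v - 1); have h4 := hℓ i
      unfold colLen; split_ifs <;> omega
    -- a well separated core
    set d : ℤ → ℤ := fun r => if r = v then (N + 1) * (v - 1) + ℓ v - 1 else (N + 1) * r with hd
    have hdv : d v = d (v - 1) + ℓ v - 1 := by simp only [hd, if_true]; rw [if_neg (by omega)]
    have hfar : Far e d (N + 1) v := by
      intro i j h0 h1 h2 h3
      have hv1 := hle v
      simp only [hd]
      by_cases j1 : j = v
      · subst j1
        rw [if_neg (by omega), if_pos rfl]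
        have : (N + 1) * i ≤ (N + 1) * (j - 2) := mul_le_mul_of_nonneg_left (by omega) (by omega)
        linarith
      rw [if_neg j1]
      by_cases i1 : i = v
      · subst i1
        rw [if_pos rfl]
        have : (N + 1) * (i + 1) ≤ (N + 1) * j := mul_le_mul_of_nonneg_left (by omega) (by omega)
        linarith
      · rw [if_neg i1]
        have : (N + 1) * (i + 1) ≤ (N + 1) * j := mul_le_mul_of_nonneg_left (by omega) (by omega)
        linarith
    obtain ⟨X, Y, hX, hY, hXY⟩ := exists_cls_step he2 hv hve hℓ hN hfar hdv hpos hsupp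
    -- the dual side
    have hcd : ∀ i, colLen (e - v) (dualCnt e ℓ) i < N := fun i => by
      have h1 := hle (e - i); have h2 := hle v; have h3 := hle (e - (e - v - 1))
      have h4 := hle (e - (e - v)); have h5 := hℓ (e - i)
      unfold colLen dualCnt; split_ifs <;> omega
    have hℓv : dualCnt e ℓ (e - v) = ℓ v := by unfold dualCnt; rw [sub_sub_cancel]
    obtain ⟨X', Y', hX', hY', hXY'⟩ := exists_cls_step (ℓ := dualCnt e ℓ) he2 (v := e - v) (by omega) (by omega)
      (fun i => hℓ _) hcd hfar.dual (by
        rw [hℓv]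
        show -d (e - 1 - (e - v)) = -d (e - 1 - (e - v - 1)) + ℓ v - 1
        rw [show (e : ℤ) - 1 - (e - v) = v - 1 by ring, show (e : ℤ) - 1 - (e - v - 1) = v by ring]
        omega) (by rwa [hℓv]) (fun i hi => h _ fun hc => by
          have := hS _ hc; omega)
    rw [hℓv] at hXY'
    -- On the dual side the close runners are `e - v - 1` and `e - v`, and the colour `e - v` is
    -- `-v`.
    have hXY'' := hXY'.shift 1
    rw [mul_one, show (e : ℤ) - v - e = -v by ring] at hXY''
    rw [← dualLev_levOf he0] at hX'
    rw [← dualRun_stepLev, ← dualLev_levOf he0, ← dualCnt_update] at hY'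
    -- the smaller pair
    have hlY := isLev_levOf he0 (stepLev d v)
    obtain ⟨Y₁, Y₁', n, h1, h2, h3⟩ := ih' (ℓ := Function.update ℓ v 0) (fun i => by
        by_cases hi : i = v
        · subst hi; simp
        · rw [Function.update_of_ne hi]; exact hℓ i) (fun u hu => by
        by_cases hi : u = v
        · subst hi; simp
        · rw [Function.update_of_ne hi]; exact h u (by simp [hi, hu])) hlY
    -- The induction provides some matched pair; uniqueness identifies it with the ends of the
    -- explicit chains.
    obtain rfl := cls_unique he2 hlY h1 hY
    obtain rfl := cls_unique he2 (isLev_dualLev hlY) h2 hY'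
    exact HasPair.of_one he (isLev_levOf he0 d) ⟨X, X', _, hX, hX', h3.of_ep hXY hXY''⟩ hD

/-! ### Partitions and bead sets -/

theorem maya_betaSet (lam : YoungDiagram) : Maya (betaSet lam) :=
  ⟨⟨_, fun _ h => mem_betaSet_of_lt lam h⟩, lam.rowLen 0 + 1, fun x hx h => by
    have := le_of_mem_betaSet lam h; omega⟩

theorem beta_anti (lam : YoungDiagram) {i j : ℕ} (h : i < j) :
    (lam.rowLen j : ℤ) - (j + 1) < lam.rowLen i - (i + 1) := by
  have := lam.rowLen_anti i j h.le; omega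

theorem beta_inj (lam : YoungDiagram) {i j : ℕ}
    (h : (lam.rowLen j : ℤ) - (j + 1) = lam.rowLen i - (i + 1)) : j = i := by
  rcases lt_trichotomy i j with h1 | h1 | h1
  · have := beta_anti lam h1; omega
  · exact h1.symm
  · have := beta_anti lam h1; omega

/-- The bead sets of partitions. -/
def IsBeta (B : Set ℤ) : Prop := ∃ lam, betaSet lam = B

theorem IsBeta.maya {B : Set ℤ} (h : IsBeta B) : Maya B := by
  obtain ⟨lam, rfl⟩ := h; exact maya_betaSet lam

theorem IsBeta.up {B : Set ℤ} (h : IsBeta B) {x : ℤ} (h1 : x ∉ B) (h2 : x - 1 ∈ B) : IsBeta (up B x) := by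
  obtain ⟨lam, rfl⟩ := h
  obtain ⟨i, hi⟩ := h2
  have hlt : ∀ j < i, lam.rowLen i < lam.rowLen j := by
    intro j hj
    have h3 := lam.rowLen_anti j (i - 1) (by omega)
    have h4 := lam.rowLen_anti (i - 1) i (by omega)
    have h5 : lam.rowLen (i - 1) ≠ lam.rowLen i := fun hc => h1 ⟨i - 1, by omega⟩
    omega
  let mu : YoungDiagram := ⟨insert (i, lam.rowLen i) lam.cells, by
    rintro ⟨a, b⟩ ⟨a', b'⟩ hle hab
    rw [Finset.mem_coe, Finset.mem_insert, YoungDiagram.mem_cells] at hab ⊢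
    obtain ⟨h3, h4⟩ : a' ≤ a ∧ b' ≤ b := hle
    rcases hab with hab | hab
    · rw [Prod.mk.injEq] at hab
      obtain ⟨rfl, rfl⟩ := hab
      rcases h3.eq_or_lt with rfl | h5
      · rcases h4.eq_or_lt with rfl | h6
        · exact Or.inl rfl
        · exact Or.inr (YoungDiagram.mem_iff_lt_rowLen.2 h6)
      · exact Or.inr (YoungDiagram.mem_iff_lt_rowLen.2 (h4.trans_lt (hlt a' h5)))
    · exact Or.inr (lam.up_left_mem h3 h4 hab)⟩
  have hrow : ∀ j, mu.rowLen j = lam.rowLen j + if j = i then 1 else 0 := by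
    intro j
    refine eq_of_forall_lt_iff fun b => ?_
    rw [← YoungDiagram.mem_iff_lt_rowLen]
    have : (j, b) ∈ mu ↔ (j, b) = (i, lam.rowLen i) ∨ b < lam.rowLen j := by
      rw [← YoungDiagram.mem_cells]
      show (j, b) ∈ insert (i, lam.rowLen i) lam.cells ↔ _
      rw [Finset.mem_insert, YoungDiagram.mem_cells, YoungDiagram.mem_iff_lt_rowLen]
    rw [this, Prod.mk.injEq]
    by_cases hj : j = i
    · subst hj; simp only [true_and, if_true]; omega
    · simp only [hj, false_and, false_or, if_false, add_zero]
  refine ⟨mu, ?_⟩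
  ext y
  show (∃ j : ℕ, _) ↔ ((∃ j : ℕ, _) ∧ y ≠ x - 1) ∨ y = x
  constructor
  · rintro ⟨j, rfl⟩
    rw [hrow]
    by_cases hj : j = i
    · subst hj; right; push_cast; simp only [if_true]; omega
    · left
      simp only [hj, if_false, add_zero]
      exact ⟨⟨j, rfl⟩, fun hc => hj (beta_inj lam (hc.trans hi))⟩
  · rintro (⟨⟨j, rfl⟩, hne⟩ | rfl)
    · refine ⟨j, ?_⟩
      have : j ≠ i := by rintro rfl; exact hne hi.symm
      rw [hrow, if_neg this, add_zero]
    · exact ⟨i, by rw [hrow, if_pos rfl]; push_cast; omega⟩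

theorem IsBeta.mv {B : Set ℤ} (h : IsBeta B) {x : ℤ} (h1 : x ∈ B) (h2 : x - 1 ∉ B) : IsBeta (mv B x) := by
  obtain ⟨lam, rfl⟩ := h
  obtain ⟨i, hi⟩ := h1
  have hlt : ∀ j > i, lam.rowLen j < lam.rowLen i := by
    intro j hj
    have h3 := lam.rowLen_anti (i + 1) j hj
    have h4 := lam.rowLen_anti i (i + 1) (by omega)
    have h5 : lam.rowLen (i + 1) ≠ lam.rowLen i := fun hc => h2 ⟨i + 1, by push_cast; omega⟩
    omega
  have hpos : 0 < lam.rowLen i := (Nat.zero_le _).trans_lt (hlt (i + 1) (by omega))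
  let mu : YoungDiagram := ⟨lam.cells.erase (i, lam.rowLen i - 1), by
    rintro ⟨a, b⟩ ⟨a', b'⟩ hle hab
    rw [Finset.mem_coe, Finset.mem_erase, YoungDiagram.mem_cells] at hab ⊢
    obtain ⟨h3, h4⟩ : a' ≤ a ∧ b' ≤ b := hle
    refine ⟨fun hc => ?_, lam.up_left_mem h3 h4 hab.2⟩
    rw [Prod.mk.injEq] at hc
    obtain ⟨rfl, rfl⟩ := hc
    have h5 := YoungDiagram.mem_iff_lt_rowLen.1 hab.2
    rcases h3.eq_or_lt with rfl | h6
    · exact hab.1 (by rw [Prod.mk.injEq]; exact ⟨rfl, by omega⟩)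
    · have := hlt a h6; omega⟩
  have hrow : ∀ j, mu.rowLen j = lam.rowLen j - if j = i then 1 else 0 := by
    intro j
    refine eq_of_forall_lt_iff fun b => ?_
    rw [← YoungDiagram.mem_iff_lt_rowLen]
    have : (j, b) ∈ mu ↔ (j, b) ≠ (i, lam.rowLen i - 1) ∧ b < lam.rowLen j := by
      rw [← YoungDiagram.mem_cells]
      show (j, b) ∈ lam.cells.erase (i, lam.rowLen i - 1) ↔ _
      rw [Finset.mem_erase, YoungDiagram.mem_cells, YoungDiagram.mem_iff_lt_rowLen]
    rw [this, ne_eq, Prod.mk.injEq]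
    by_cases hj : j = i
    · subst hj; simp only [true_and, if_true]; omega
    · simp only [hj, false_and, not_false_eq_true, true_and, if_false, Nat.sub_zero]
  refine ⟨mu, ?_⟩
  ext y
  show (∃ j : ℕ, _) ↔ ((∃ j : ℕ, _) ∧ y ≠ x) ∨ y = x - 1
  constructor
  · rintro ⟨j, rfl⟩
    rw [hrow]
    by_cases hj : j = i
    · subst hj; right; simp only [if_true]; omega
    · left
      simp only [hj, if_false, Nat.sub_zero]
      exact ⟨⟨j, rfl⟩, fun hc => hj (beta_inj lam (hc.trans hi))⟩
  · rintro (⟨⟨j, rfl⟩, hne⟩ | rfl)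
    · refine ⟨j, ?_⟩
      have : j ≠ i := by rintro rfl; exact hne hi.symm
      rw [hrow, if_neg this, Nat.sub_zero]
    · exact ⟨i, by rw [hrow, if_pos rfl]; omega⟩

theorem eq_bot_of_betaSet {lam : YoungDiagram} {c : ℤ} (h : betaSet lam = Set.Iio c) : c = 0 ∧ lam = ⊥ := by
  have h1 : -(lam.colLen 0 : ℤ) ∉ betaSet lam := by
    rintro ⟨i, hi⟩
    rcases lt_or_ge i (lam.colLen 0) with h2 | h2
    · have := YoungDiagram.mem_iff_lt_rowLen.1 (YoungDiagram.mem_iff_lt_colLen.2 h2)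
      omega
    · have : ¬ 0 < lam.rowLen i := fun hc => by
        have := YoungDiagram.mem_iff_lt_colLen.1 (YoungDiagram.mem_iff_lt_rowLen.2 hc); omega
      omega
  rw [h, Set.mem_Iio] at h1
  have h2 : (lam.rowLen 0 : ℤ) - 1 < c := by
    have : (lam.rowLen 0 : ℤ) - 1 ∈ betaSet lam := ⟨0, by push_cast; ring⟩
    rwa [h] at this
  have h3 : lam.rowLen 0 = 0 := by omega
  refine ⟨by omega, ?_⟩
  rw [eq_bot_iff]
  rintro ⟨i, j⟩ hij
  have := YoungDiagram.mem_iff_lt_rowLen.1 (lam.up_left_mem (Nat.zero_le i) le_rfl hij)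
  omega

theorem betaSet_bot : betaSet ⊥ = Set.Iio 0 := by
  have h : ∀ i, (⊥ : YoungDiagram).rowLen i = 0 := fun i => by
    by_contra hc
    exact YoungDiagram.notMem_bot _ (YoungDiagram.mem_iff_lt_rowLen.2 (Nat.pos_of_ne_zero hc))
  ext x
  constructor
  · rintro ⟨i, rfl⟩
    rw [h, Set.mem_Iio]; push_cast; omega
  · intro hx
    rw [Set.mem_Iio] at hx
    exact ⟨(-x - 1).toNat, by rw [h]; push_cast; omega⟩

/-- A vacuum of charge zero on the left has charge zero on the right, and undoing moves from there
only adds nodes to a partition. -/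
theorem MP.isBeta {e : ℕ} (he : 2 ≤ e) {n : ℕ} {B C : Set ℤ} (h : MP e n B C) (hB : IsBeta B) : IsBeta C := by
  induction h with
  | base c =>
    obtain ⟨lam, hlam⟩ := hB
    obtain ⟨rfl, -⟩ := eq_bot_of_betaSet hlam
    exact ⟨⊥, by rw [betaSet_bot, neg_zero]⟩
  | step n B C x y hxy hx hy hmp ih =>
    have m1 := hx.mem he hmp.maya.1.of_mv
    have m2 := hy.mem he hmp.maya.2.of_mv
    have := (ih (hB.mv m1.1 m1.2)).up (x := y) (by
      rintro (h | h)
      · exact h.2 rfl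
      · omega) (Or.inr rfl)
    rwa [up_mv m2.1 m2.2] at this

/-! ### Normal beads -/

theorem ncard_step {e : ℕ} (he : 0 < e) (P : ℤ → Prop) (x : ℤ) (k : ℕ) :
    ({t : ℤ | x < t ∧ t ≤ x + e * (k + 1 : ℕ) ∧ t ≡ x [ZMOD e] ∧ P t}.ncard : ℤ) =
      {t : ℤ | x < t ∧ t ≤ x + e * k ∧ t ≡ x [ZMOD e] ∧ P t}.ncard +
        if P (x + e * (k + 1 : ℕ)) then 1 else 0 := by
  have hfin : {t : ℤ | x < t ∧ t ≤ x + e * k ∧ t ≡ x [ZMOD e] ∧ P t}.Finite :=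
    (Set.finite_Ioc x (x + e * k)).subset fun t ht => ⟨ht.1, ht.2.1⟩
  have hlast : ∀ t : ℤ, t ≡ x [ZMOD e] → x + e * k < t → t ≤ x + e * (k + 1 : ℕ) →
      t = x + e * (k + 1 : ℕ) := by
    intro t ht h1 h2
    obtain ⟨s, hs⟩ := ht.symm.dvd
    obtain rfl : t = x + e * s := by linarith
    have a1 : (k : ℤ) < s := lt_of_mul_lt_mul_left (by linarith : (e : ℤ) * k < e * s) (by omega)
    have a2 : s ≤ (k + 1 : ℕ) := le_of_mul_le_mul_left (by linarith : (e : ℤ) * s ≤ e * (k + 1 : ℕ)) (by omega)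
    rw [show s = (k + 1 : ℕ) by omega]
  have hmono : x + (e : ℤ) * k < x + e * (k + 1 : ℕ) := by push_cast; nlinarith
  have hk0 : (0 : ℤ) ≤ e * k := by positivity
  split_ifs with hP
  · have : {t : ℤ | x < t ∧ t ≤ x + e * (k + 1 : ℕ) ∧ t ≡ x [ZMOD e] ∧ P t} =
        insert (x + e * (k + 1 : ℕ) : ℤ) {t : ℤ | x < t ∧ t ≤ x + e * k ∧ t ≡ x [ZMOD e] ∧ P t} := by
      ext t
      simp only [Set.mem_ofPred_eq, Set.mem_insert_iff]
      constructor
      · rintro ⟨h1, h2, h3, h4⟩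
        by_cases h5 : t ≤ x + e * k
        · exact Or.inr ⟨h1, h5, h3, h4⟩
        · exact Or.inl (hlast t h3 (by omega) h2)
      · rintro (rfl | ⟨h1, h2, h3, h4⟩)
        · refine ⟨by omega, le_rfl, ?_, hP⟩
          exact (Int.modEq_iff_dvd.2 ⟨-(k + 1 : ℕ), by ring⟩)
        · exact ⟨h1, by omega, h3, h4⟩
    rw [this, Set.ncard_insert_of_notMem _ hfin]
    · push_cast; ring
    · rintro ⟨-, h, -⟩; omega
  · rw [add_zero]
    congr 2
    ext t
    simp only [Set.mem_ofPred_eq]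
    constructor
    · rintro ⟨h1, h2, h3, h4⟩
      by_cases h5 : t ≤ x + e * k
      · exact ⟨h1, h5, h3, h4⟩
      · exact absurd h4 (by rw [hlast t h3 (by omega) h2]; exact hP)
    · rintro ⟨h1, h2, h3, h4⟩
      exact ⟨h1, by omega, h3, h4⟩

theorem ncard_sub {e : ℕ} (he : 2 ≤ e) {B : Set ℤ} (hB : Maya B) (x : ℤ) (k : ℕ) :
    ({t : ℤ | x < t ∧ t ≤ x + e * k ∧ t ≡ x [ZMOD e] ∧ t ∈ B ∧ t - 1 ∉ B}.ncard : ℤ) -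
      {t : ℤ | x < t ∧ t ≤ x + e * k ∧ t ≡ x [ZMOD e] ∧ t ∉ B ∧ t - 1 ∈ B}.ncard =
    ht e B (x + e) - ht e B (x + e * k + e) := by
  induction k with
  | zero =>
    have h0 : ∀ P : ℤ → Prop, {t : ℤ | x < t ∧ t ≤ x + e * (0 : ℕ) ∧ t ≡ x [ZMOD e] ∧ P t} = ∅ := fun P => by
      ext t
      simp only [Set.mem_ofPred_eq, Set.mem_empty_iff_false, iff_false]
      rintro ⟨h1, h2, -⟩
      simp at h2; omega
    rw [h0, h0]; simp
  | succ k ih =>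
    have he0 : 0 < e := by omega
    rw [ncard_step he0 (fun t => t ∈ B ∧ t - 1 ∉ B), ncard_step he0 (fun t => t ∉ B ∧ t - 1 ∈ B)]
    have h1 := ht_step he hB (x + e * (k + 1 : ℕ))
    rw [show x + (e : ℤ) * k + e = x + e * (k + 1 : ℕ) by push_cast; ring] at ih
    rcases ch_cases B (x + e * (k + 1 : ℕ)) with ⟨a, a'⟩ | ⟨a, a'⟩ <;>
    rcases ch_cases B (x + e * (k + 1 : ℕ) - 1) with ⟨b, b'⟩ | ⟨b, b'⟩ <;>
    simp only [a, b, not_true_eq_false, not_false_eq_true, and_true, and_false, if_true, if_false] <;> omega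

/-- The difference of the two counts up to `y` is a difference of heights, and the removable bead at
`x` itself turns the weak inequality into a strict one. -/
theorem isNormal_iff {e : ℕ} (he : 2 ≤ e) (lam : YoungDiagram) (x : ℤ) :
    IsNormal e lam x ↔ ∀ t : ℤ, 0 < t → ht e (betaSet lam) (x + e * t) < ht e (betaSet lam) x := by
  have hB := maya_betaSet lam
  have hst := ht_step he hB x
  have c1 := ch_cases (betaSet lam) x
  have c2 := ch_cases (betaSet lam) (x - 1)
  constructor
  · rintro ⟨⟨h1, h2⟩, h3⟩ t ht0
    rw [ch_of_mem h1, ch_of_notMem h2] at hst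
    rcases eq_or_lt_of_le (show 1 ≤ t from ht0) with rfl | ht1
    · rw [mul_one]; omega
    have h4 := h3 (x + e * ((t - 1).toNat : ℕ)) (by
        have : (0 : ℤ) < e * ((t - 1).toNat : ℕ) := by
          refine mul_pos (by omega) (by omega)
        omega) (Int.modEq_iff_dvd.2 ⟨-((t - 1).toNat : ℕ), by ring⟩)
    have h5 := ncard_sub he hB x (t - 1).toNat
    rw [show x + (e : ℤ) * ((t - 1).toNat : ℕ) + e = x + e * t by
      rw [show (((t - 1).toNat : ℕ) : ℤ) = t - 1 by omega]; ring] at h5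
    omega
  · intro h
    have h1 := h 1 one_pos
    rw [mul_one] at h1
    refine ⟨⟨?_, ?_⟩, fun y hxy hy => ?_⟩
    · rcases c1 with c1 | c1
      · exact c1.1
      · rcases c2 with c2 | c2 <;> omega
    · rcases c2 with c2 | c2
      · rcases c1 with c1 | c1 <;> omega
      · exact c2.1
    · obtain ⟨s, hs⟩ := hy.symm.dvd
      obtain rfl : y = x + e * s := by linarith
      have hs0 : 0 < s := by
        by_contra hc
        have : (e : ℤ) * s ≤ 0 := mul_nonpos_of_nonneg_of_nonpos (by omega) (by omega)
        omega
      lift s to ℕ using hs0.le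
      have h5 := ncard_sub he hB x s
      have h6 := h (s + 1) (by omega)
      rw [show x + (e : ℤ) * (s + 1) = x + e * s + e by ring] at h6
      have h7 : ch (betaSet lam) x - ch (betaSet lam) (x - 1) ≤ 1 := by
        rcases c1 with c1 | c1 <;> rcases c2 with c2 | c2 <;> omega
      omega

/-- Heights decrease strictly along the normal beads of a colour, so the smallest normal bead is
where the height is maximal for the last time. -/
theorem kashiwaraE_iff {e : ℕ} (he : 2 ≤ e) (a : ZMod e) (lam mu : YoungDiagram) :
    KashiwaraE e a lam mu ↔
      ∃ x : ℤ, (x : ZMod e) = a ∧ Good e (betaSet lam) x ∧ betaSet mu = mv (betaSet lam) x := by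
  have hB := maya_betaSet lam
  have hmv : ∀ x : ℤ, insert (x - 1) (betaSet lam \ {x}) = mv (betaSet lam) x := fun x => by
    ext y
    show y = x - 1 ∨ (y ∈ betaSet lam ∧ y ≠ x) ↔ (y ∈ betaSet lam ∧ y ≠ x) ∨ y = x - 1
    tauto
  constructor
  · rintro ⟨x, hx, hn, hmin, h1, h2, h3⟩
    refine ⟨x, hx, ?_, by rw [h3, hmv]⟩
    have hrec := (isNormal_iff he lam x).1 hn
    obtain ⟨-, hi, hhi⟩ := row_bounded he hB x
    have h4 := hhi (max hi 1) (by omega)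
    have h5 := hrec (max hi 1) (by omega)
    unfold row at h4
    refine ⟨by omega, fun t => ?_, hrec⟩
    by_contra hc
    push Not at hc
    obtain ⟨p, hp, hpt⟩ := exists_good he hB (a := x) (i := t) (by unfold row; omega)
    have h6 := hmin (x + e * p) (by push_cast; simp [hx])
      ((isNormal_iff he lam _).2 hp.2.2)
    unfold row at hpt
    have hp0 : 0 ≤ p := by
      by_contra hc'
      have : (e : ℤ) * p < 0 := mul_neg_of_pos_of_neg (by omega) (by omega)
      omega
    rcases hp0.eq_or_lt with rfl | h7
    · simp at hpt; omega
    · have := hrec p h7; omega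
  · rintro ⟨x, hx, hg, h3⟩
    have hm := hg.mem he hB
    refine ⟨x, hx, (isNormal_iff he lam x).2 hg.2.2, fun x' hx' hn => ?_, hm.1, hm.2, by rw [h3, hmv]⟩
    by_contra hc
    push Not at hc
    obtain ⟨s, hs⟩ := (ZMod.intCast_eq_intCast_iff_dvd_sub x' x e).1 (hx'.trans hx.symm)
    obtain rfl : x = x' + e * s := by linarith
    have hs0 : 0 < s := by
      by_contra hc'
      have : (e : ℤ) * s ≤ 0 := mul_nonpos_of_nonneg_of_nonpos (by omega) (by omega)
      omega
    have h4 := (isNormal_iff he lam x').1 hn s hs0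
    have h5 := hg.2.1 (-s)
    rw [show x' + (e : ℤ) * s + e * -s = x' by ring] at h5
    omega

theorem mullineuxPair_iff {e : ℕ} (he : 2 ≤ e) (mu nu : YoungDiagram) :
    MullineuxPair e mu nu ↔ ∃ n, MP e n (betaSet mu) (betaSet nu) := by
  constructor
  · intro h
    induction h with
    | empty => exact ⟨0, by simpa [betaSet_bot] using MP.base (e := e) 0⟩
    | step a mu nu mu' nu' h1 h2 _ ih =>
      obtain ⟨n, hn⟩ := ih
      obtain ⟨x, hx, hg, hmu⟩ := (kashiwaraE_iff he _ _ _).1 h1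
      obtain ⟨y, hy, hg', hnu⟩ := (kashiwaraE_iff he _ _ _).1 h2
      rw [hmu, hnu] at hn
      refine ⟨n + 1, .step n _ _ x y ?_ hg hg' hn⟩
      rw [← ZMod.intCast_zmod_eq_zero_iff_dvd]
      push_cast
      rw [hx, hy, add_neg_cancel]
  · rintro ⟨n, h⟩
    generalize hB : betaSet mu = B at h
    generalize hC : betaSet nu = C at h
    induction h generalizing mu nu with
    | base c =>
      obtain ⟨rfl, rfl⟩ := eq_bot_of_betaSet hB
      obtain ⟨-, rfl⟩ := eq_bot_of_betaSet hC
      exact .empty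
    | step n B C x y hxy hx hy hmp ih =>
      have m1 := hx.mem he hmp.maya.1.of_mv
      have m2 := hy.mem he hmp.maya.2.of_mv
      obtain ⟨mu', hmu'⟩ := IsBeta.mv ⟨mu, hB⟩ m1.1 m1.2
      obtain ⟨nu', hnu'⟩ := IsBeta.mv ⟨nu, hC⟩ m2.1 m2.2
      refine .step (x : ZMod e) mu nu mu' nu' ((kashiwaraE_iff he _ _ _).2 ⟨x, rfl, by rwa [hB], by rw [hB, hmu']⟩)
        ((kashiwaraE_iff he _ _ _).2 ⟨y, ?_, by rwa [hC], by rw [hC, hnu']⟩) (ih mu' nu' hmu' hnu')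
      rw [eq_neg_iff_add_eq_zero, add_comm, ← Int.cast_add, ZMod.intCast_zmod_eq_zero_iff_dvd]
      exact hxy

/-! ### Two runners -/

/-- The bead sets of `e`-regular partitions. -/
def Reg (e : ℕ) (B : Set ℤ) : Prop := ∀ x, (∀ j : ℤ, 0 ≤ j → j < e → x - j ∈ B) → ∀ y < x, y ∈ B

/-- The moved bead could only complete `e` consecutive beads ending at `x - 1`. Then `x - e` would
be removable too, with height one larger than at `x`, against the choice of a good bead. -/
theorem Reg.mv {e : ℕ} (he : 2 ≤ e) {B : Set ℤ} (hB : Maya B) (h : Reg e B) {x : ℤ} (hx : Good e B x) :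
    Reg e (mv B x) := by
  have hm := hx.mem he hB
  intro z hz y hy
  have hmv : ∀ t, t ∈ Abacus.mv B x ↔ (t ∈ B ∧ t ≠ x) ∨ t = x - 1 := fun _ => Iff.rfl
  by_contra hc
  rw [hmv] at hc
  push Not at hc
  have h1 : x - 1 ≤ z → x - 1 ≤ z - e ∨ z = x - 1 := by
    intro h2
    by_contra hc'
    push Not at hc'
    have := (hmv _).1 (hz (z - x) (by omega) (by omega))
    rw [sub_sub_cancel] at this
    rcases this with h3 | h3
    · exact h3.2 rfl
    · omega
  have h0 : ∀ j : ℤ, 0 ≤ j → j < e → z - j ≠ x - 1 → z - j ∈ B := fun j hj0 hj1 hne => by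
    have := (hmv _).1 (hz j hj0 hj1)
    tauto
  by_cases h2 : z = x - 1
  · -- the bead in row `x - e` would be removable as well
    subst h2
    have h3 : x - e ∈ B := by
      have := h0 (e - 1) (by omega) (by omega) (by omega)
      rwa [show x - 1 - ((e : ℤ) - 1) = x - e by ring] at this
    have h4 : x - e - 1 ∉ B := by
      intro h4
      have h5 := h (x - 2) (fun j hj0 hj1 => by
        rcases eq_or_lt_of_le (show j ≤ e - 1 by omega) with rfl | h6
        · rwa [show x - 2 - ((e : ℤ) - 1) = x - e - 1 by ring]
        · have := h0 (j + 1) (by omega) (by omega) (by omega)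
          rwa [show x - 1 - (j + 1) = x - 2 - j by ring] at this)
      rcases eq_or_lt_of_le (show y ≤ x - 2 by omega) with rfl | h6
      · have := h0 1 (by omega) (by omega) (by omega)
        rw [show x - 1 - 1 = x - 2 by ring] at this
        have := hc.1 this; omega
      · have := hc.1 (h5 y h6); omega
    have h5 := ht_step he hB (x - e)
    rw [ch_of_mem h3, ch_of_notMem h4, sub_add_cancel] at h5
    have h6 := hx.2.1 (-1)
    rw [show x + (e : ℤ) * -1 = x - e by ring] at h6
    omega
  · have h3 : ∀ j : ℤ, 0 ≤ j → j < e → z - j ∈ B := fun j hj0 hj1 => h0 j hj0 hj1 (by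
      intro h4
      rcases h1 (by omega) with h5 | h5 <;> omega)
    have h4 := h z h3
    have h5 := hc.1 (h4 y hy)
    subst h5
    exact hm.2 (h4 _ (by omega))

theorem exists_removable {B : Set ℤ} (hB : Maya B) :
    (∃ c, B = Set.Iio c) ∨ ∃ x, x ∈ B ∧ x - 1 ∉ B ∧ ∀ y, x < y → ¬ (y ∈ B ∧ y - 1 ∉ B) := by
  by_cases h : ∃ x, x ∈ B ∧ x - 1 ∉ B
  · right
    obtain ⟨-, hi, hhi⟩ := hB
    obtain ⟨x, hx, hmax⟩ := Int.exists_greatest_of_bdd (P := fun x => x ∈ B ∧ x - 1 ∉ B)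
      ⟨hi, fun x hx => by by_contra hc; exact hhi x (by omega) hx.1⟩ h
    exact ⟨x, hx.1, hx.2, fun y hxy hy => by have := hmax y hy; omega⟩
  · left
    push Not at h
    obtain ⟨⟨lo, hlo⟩, hi, hhi⟩ := hB
    have hlohi : lo ≤ hi := by
      by_contra hc
      exact hhi hi le_rfl (hlo hi (by omega))
    obtain ⟨c, hc, hmin⟩ := Int.exists_least_of_bdd (P := fun x => x ∉ B)
      ⟨lo, fun x hx => by by_contra hc; exact hx (hlo x (by omega))⟩ ⟨hi, hhi hi le_rfl⟩
    refine ⟨c, Set.ext fun x => ⟨fun hx => ?_, fun hx => ?_⟩⟩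
    · rw [Set.mem_Iio]
      by_contra hcx
      have : ∀ n : ℕ, c + n ∉ B := by
        intro n
        induction n with
        | zero => simpa using hc
        | succ n ih =>
          intro hc'
          have := h _ hc'
          rw [show c + ((n + 1 : ℕ) : ℤ) - 1 = c + n by push_cast; ring] at this
          exact ih this
      refine this (x - c).toNat ?_
      rwa [show c + ((x - c).toNat : ℤ) = x by omega]
    · by_contra hx'
      have := hmin x hx'
      rw [Set.mem_Iio] at hx; omega

/-- By regularity fewer than `e` beads lie from the last removable bead `x` on. Nothing cancels it,
so its colour has height one at `x`. -/
theorem Reg.exists_good {e : ℕ} (he : 2 ≤ e) {B : Set ℤ} (hB : Maya B) (h : Reg e B) {x : ℤ} (h1 : x ∈ B)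
    (h2 : x - 1 ∉ B) (h3 : ∀ y, x < y → ¬ (y ∈ B ∧ y - 1 ∉ B)) : ∃ p, Good e B p := by
  have he0 : 0 < e := by omega
  -- the beads from `x` on are consecutive, and there are fewer than `e` of them
  have hgap : ∀ z, x < z → z ∉ B → ∀ n : ℕ, z + n ∉ B := by
    intro z hz hzB n
    induction n with
    | zero => simpa using hzB
    | succ n ih =>
      intro hc
      refine h3 (z + (n + 1 : ℕ)) (by push_cast; omega) ⟨hc, ?_⟩
      rwa [show z + ((n + 1 : ℕ) : ℤ) - 1 = z + n by push_cast; ring]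
  have hfar : x + e - 1 ∉ B := by
    intro hc
    refine h2 (h (x + e - 1) (fun j hj0 hj1 => ?_) (x - 1) (by omega))
    by_contra hj
    by_cases hjx : x + e - 1 - j = x
    · rw [hjx] at hj; exact hj h1
    · have := hgap _ (by omega) hj j.toNat
      rw [show x + (e : ℤ) - 1 - j + (j.toNat : ℤ) = x + e - 1 by omega] at this
      exact this hc
  have hz : ∀ y, x + e - 1 ≤ y → y ∉ B := fun y hy => by
    have := hgap _ (by omega) hfar (y - (x + e - 1)).toNat
    rwa [show x + (e : ℤ) - 1 + ((y - (x + e - 1)).toNat : ℤ) = y by omega] at this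
  have hh : ht e B x = 1 := by
    have := ht_step he hB x
    rw [ch_of_mem h1, ch_of_notMem h2] at this
    unfold ht at this ⊢
    rw [nb_eq_zero hz (x := x + e) (by omega), nb_eq_zero hz (x := x + e - 1) le_rfl] at this
    omega
  obtain ⟨p, hp, -⟩ := Abacus.exists_good he hB (a := x) (i := 0) (by unfold row; simp [hh])
  exact ⟨_, hp⟩

/-- Modulo two a colour equals its negative, so any sequence of good moves to the vacuum can be
paired with itself. -/
theorem Reg.exists_self {B : Set ℤ} (hB : IsBeta B) (h : Reg 2 B) : ∃ n, MP 2 n B B := by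
  have key : ∀ m : ℕ, ∀ B : Set ℤ, IsBeta B → Reg 2 B → energy B ≤ m → ∃ n, MP 2 n B B := by
    intro m
    induction m with
    | zero =>
      intro B hB h hE
      rcases exists_removable hB.maya with ⟨c, rfl⟩ | ⟨x, h1, h2, h3⟩
      · obtain ⟨lam, hlam⟩ := hB
        obtain ⟨rfl, -⟩ := eq_bot_of_betaSet hlam
        exact ⟨0, by simpa using MP.base (e := 2) 0⟩
      · have := energy_mv hB.maya h1 h2
        have := energy_nonneg (Abacus.mv B x)
        push_cast at hE
        omega
    | succ m ih =>
      intro B hB h hE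
      rcases exists_removable hB.maya with ⟨c, rfl⟩ | ⟨x, h1, h2, h3⟩
      · obtain ⟨lam, hlam⟩ := hB
        obtain ⟨rfl, -⟩ := eq_bot_of_betaSet hlam
        exact ⟨0, by simpa using MP.base (e := 2) 0⟩
      · obtain ⟨p, hp⟩ := h.exists_good le_rfl hB.maya h1 h2 h3
        have hm := hp.mem le_rfl hB.maya
        obtain ⟨n, hn⟩ := ih (Abacus.mv B p) (hB.mv hm.1 hm.2) (h.mv le_rfl hB.maya hp) (by
          rw [energy_mv hB.maya hm.1 hm.2]; push_cast at hE; omega)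
        exact ⟨n + 1, .step n B B p p ⟨p, by push_cast; ring⟩ hp hp hn⟩
  have := energy_nonneg B
  exact key (energy B).toNat B hB h (by omega)

theorem MP.eq_of_two {n : ℕ} {B C : Set ℤ} (h : MP 2 n B C) (hB : IsBeta B) : C = B := by
  induction h with
  | base c =>
    obtain ⟨lam, hlam⟩ := hB
    obtain ⟨rfl, -⟩ := eq_bot_of_betaSet hlam
    rw [neg_zero]
  | step n B C x y hxy hx hy hmp ih =>
    have m1 := hx.mem le_rfl hmp.maya.1.of_mv
    refine hy.inj le_rfl hmp.maya.2.of_mv hmp.maya.1.of_mv hx (ih (hB.mv m1.1 m1.2)) ?_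
    push_cast at hxy ⊢
    omega

/-! ### Bead movements and gap counts -/

theorem natCast_gapCount (e : ℕ) (lam : YoungDiagram) (x : ℤ) :
    (gapCount e lam x : ℤ) = gp e (betaSet lam) x := by
  have h1 : {y : ℤ | x - e < y ∧ y ≤ x ∧ y ∉ betaSet lam} =
      (((Finset.range e).filter fun j : ℕ => x - j ∉ betaSet lam).image fun j : ℕ => x - (j : ℤ) : Finset ℤ) := by
    ext y
    simp only [Set.mem_ofPred_eq, Finset.coe_image, Finset.coe_filter, Set.mem_image, Finset.mem_range]
    constructor
    · rintro ⟨h1, h2, h3⟩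
      refine ⟨(x - y).toNat, ⟨by omega, ?_⟩, by omega⟩
      rwa [show x - ((x - y).toNat : ℤ) = y by omega]
    · rintro ⟨j, ⟨h1, h2⟩, rfl⟩
      exact ⟨by omega, by omega, h2⟩
  unfold gapCount gp
  rw [h1, Set.ncard_coe_finset, Finset.card_image_of_injective _ fun a b h => by simpa using h, Finset.card_filter]
  push_cast
  refine Finset.sum_congr rfl fun j _ => ?_
  rcases ch_cases (betaSet lam) (x - j) with h | h <;> simp [h]

theorem natCast_wt {e : ℕ} (he : 0 < e) (lam : YoungDiagram) (b : ℤ) :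
    (wt e lam b : ℤ) = ng e (betaSet lam) b := by
  unfold wt ng
  rw [← Set.ncard_image_of_injective (f := fun i : ℕ => b - (e : ℤ) * (i + 1)) {i : ℕ | b - e * ((i : ℤ) + 1) ∉ betaSet lam}
    fun a c h => by
      have : (e : ℤ) * (a + 1) = e * (c + 1) := by simpa using h
      have := mul_left_cancel₀ (by positivity) this
      omega]
  congr 2
  ext y
  simp only [Set.mem_ofPred_eq, Set.mem_image]
  constructor
  · rintro ⟨h1, h2, h3⟩
    obtain ⟨c, hc⟩ := h2.dvd
    have hc0 : 0 < c := by
      by_contra hcon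
      have : (e : ℤ) * c ≤ 0 := mul_nonpos_of_nonneg_of_nonpos (by positivity) (by omega)
      omega
    have h4 : b - (e : ℤ) * (((c - 1).toNat : ℤ) + 1) = y := by
      rw [show (((c - 1).toNat : ℤ) + 1) = c by omega]; omega
    exact ⟨(c - 1).toNat, h4 ▸ h3, h4⟩
  · rintro ⟨i, h1, rfl⟩
    have : 0 < (e : ℤ) * (i + 1) := by positivity
    exact ⟨by omega, Int.modEq_iff_dvd.2 ⟨i + 1, by ring⟩, h1⟩

/-- The level identity translates `i < wt b` into: the beads from `q` up to just before `b` are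
fewer than the gaps above `q`. -/
theorem mem_beadMovements {e : ℕ} (he : 0 < e) {lam : YoungDiagram} {q b : ℤ} :
    toLex (q, b) ∈ beadMovements e lam ↔ b ∈ betaSet lam ∧ ∃ i : ℕ, b = q + e * i ∧
      nb e (betaSet lam) q - nb e (betaSet lam) b < ng e (betaSet lam) q := by
  unfold beadMovements
  rw [Set.Finite.mem_toFinset]
  have key : ∀ i : ℕ, b = q + e * i → (i < wt e lam b ↔
      nb e (betaSet lam) q - nb e (betaSet lam) b < ng e (betaSet lam) q) := by
    intro i hi
    have h1 := natCast_wt he lam b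
    have h2 := lev_add_mul he (maya_betaSet lam) q i
    rw [← hi] at h2
    unfold lev at h2
    omega
  constructor
  · rintro ⟨b', hb', i, hi, h⟩
    have h' := toLex.injective h
    rw [Prod.mk.injEq] at h'
    obtain ⟨rfl, rfl⟩ := h'
    exact ⟨hb', i, by ring, (key i (by ring)).1 hi⟩
  · rintro ⟨hb, i, hi, h⟩
    refine ⟨b, hb, i, (key i hi).2 h, ?_⟩
    rw [hi]; congr 2; ring

/-- The quantity `nb q - nb b` numbers the beads at or below `q` by `0, 1, 2, …`, so the set
consists of the first `k` of them, if there are that many. -/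
theorem ncard_beads_lt {e : ℕ} (he : 0 < e) {B : Set ℤ} (hB : Maya B) (q k : ℤ) :
    ({i : ℕ | q + e * i ∈ B ∧ nb e B q - nb e B (q + e * i) < k}.ncard : ℤ) = max 0 (min (nb e B q) k) := by
  obtain ⟨hi, hhi⟩ := hB.2
  have key : ∀ n : ℕ, ∀ q k : ℤ, hi ≤ q + n →
      ({i : ℕ | q + e * i ∈ B ∧ nb e B q - nb e B (q + e * i) < k}.ncard : ℤ) = max 0 (min (nb e B q) k) := by
    intro n
    induction n with
    | zero =>
      intro q k hq
      rw [nb_eq_zero hhi (by simpa using hq)]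
      have : {i : ℕ | q + e * i ∈ B ∧ 0 - nb e B (q + e * i) < k} = ∅ := by
        ext i
        simp only [Set.mem_ofPred_eq, Set.mem_empty_iff_false, iff_false, not_and]
        intro h
        have : (0 : ℤ) ≤ e * i := by positivity
        exact absurd h (hhi _ (by push_cast at hq; omega))
      rw [this]; simp
    | succ n ih =>
      intro q k hq
      rw [ncard_succ_split _ ((nb_finite he hB q).subset fun i hi => hi.1)]
      have h1 := ih (q + e) (k - ch B q) (by push_cast at hq; omega)
      have h2 := nb_rec he hB q
      have h3 := nb_nonneg e B (q + e)
      have h4 : {i : ℕ | i + 1 ∈ {i : ℕ | q + e * i ∈ B ∧ nb e B q - nb e B (q + e * i) < k}} =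
          {i : ℕ | q + e + e * i ∈ B ∧ nb e B (q + e) - nb e B (q + e + e * i) < k - ch B q} := by
        ext i
        simp only [Set.mem_ofPred_eq]
        rw [show q + (e : ℤ) * ((i + 1 : ℕ) : ℤ) = q + e + e * i by push_cast; ring]
        constructor <;> rintro ⟨h, h'⟩ <;> exact ⟨h, by omega⟩
      rw [h4, h1]
      simp only [Set.mem_ofPred_eq, Nat.cast_zero, mul_zero, add_zero, sub_self]
      rcases ch_cases B q with ⟨h, h'⟩ | ⟨h, h'⟩
      · simp only [h, true_and]
        split_ifs <;> omega
      · simp only [h, false_and, if_false]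
        omega
  exact key (hi - q).toNat q k (by omega)

/-- The number of bead movements starting at `q`. -/
theorem card_beadMovements_fiber {e : ℕ} (he : 0 < e) (lam : YoungDiagram) (q : ℤ) :
    (((beadMovements e lam).filter fun m => (ofLex m).1 = q).card : ℤ) = mult e (betaSet lam) q := by
  have hB := maya_betaSet lam
  have h1 := ncard_beads_lt he hB q (ng e (betaSet lam) q)
  have h2 := nb_nonneg e (betaSet lam) q
  have h3 := ng_nonneg e (betaSet lam) q
  unfold mult
  rw [max_eq_right (by omega)] at h1
  rw [← h1, ← Set.ncard_coe_finset]
  rw [← Set.ncard_image_of_injective (f := fun i : ℕ => (toLex (q, q + (e : ℤ) * i) : ℤ ×ₗ ℤ)) (H := fun a c h => by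
      have := toLex.injective h
      rw [Prod.mk.injEq] at this
      have := mul_left_cancel₀ (by positivity) (add_left_cancel this.2)
      omega)]
  congr 2
  ext m
  obtain ⟨⟨q', b⟩, rfl⟩ := toLex.surjective m
  simp only [Finset.coe_filter, Set.mem_ofPred_eq, ofLex_toLex, Set.mem_image, mem_beadMovements he]
  constructor
  · rintro ⟨⟨hb, i, hi, h⟩, rfl⟩
    exact ⟨i, ⟨hi ▸ hb, hi ▸ h⟩, by rw [hi]⟩
  · rintro ⟨i, ⟨h, h'⟩, h''⟩
    have := toLex.injective h''
    rw [Prod.mk.injEq] at this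
    obtain ⟨rfl, rfl⟩ := this
    exact ⟨⟨h, i, rfl, h'⟩, rfl⟩

theorem movement_mem (e : ℕ) (lam : YoungDiagram) (i : Fin (weight e lam)) :
    movement e lam i ∈ beadMovements e lam := Finset.orderEmbOfFin_mem _ _ _

theorem movement_strictMono (e : ℕ) (lam : YoungDiagram) : StrictMono (movement e lam) :=
  (Finset.orderEmbOfFin (beadMovements e lam) rfl).strictMono

theorem exists_movement {e : ℕ} {lam : YoungDiagram} {m : ℤ ×ₗ ℤ} (h : m ∈ beadMovements e lam) :
    ∃ i, movement e lam i = m := by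
  have : m ∈ Set.range (Finset.orderEmbOfFin (beadMovements e lam) rfl) := by
    rw [Finset.range_orderEmbOfFin]; exact h
  exact this

theorem startPos_mono (e : ℕ) (lam : YoungDiagram) : Monotone (startPos e lam) := by
  intro i j h
  have := (movement_strictMono e lam).monotone h
  exact (Prod.Lex.le_iff'.1 this).1

theorem card_startPos {e : ℕ} (he : 0 < e) (lam : YoungDiagram) (q : ℤ) :
    ((Finset.univ.filter fun i => startPos e lam i = q).card : ℤ) = mult e (betaSet lam) q := by
  rw [← card_beadMovements_fiber he, ← Finset.card_image_of_injective _ (movement_strictMono e lam).injective]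
  congr 2
  ext m
  simp only [Finset.mem_image, Finset.mem_filter, Finset.mem_univ, true_and]
  constructor
  · rintro ⟨i, h, rfl⟩; exact ⟨movement_mem e lam i, h⟩
  · rintro ⟨h1, h2⟩
    obtain ⟨i, rfl⟩ := exists_movement h1
    exact ⟨i, h2, rfl⟩

theorem mult_startPos_pos {e : ℕ} (he : 0 < e) (lam : YoungDiagram) (i : Fin (weight e lam)) :
    0 < mult e (betaSet lam) (startPos e lam i) := by
  rw [← card_startPos he, Nat.cast_pos, Finset.card_pos]
  exact ⟨i, by simp⟩

theorem exists_startPos {e : ℕ} (he : 0 < e) {lam : YoungDiagram} {q : ℤ} (h : 0 < mult e (betaSet lam) q) :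
    ∃ i, startPos e lam i = q := by
  rw [← card_startPos he, Nat.cast_pos, Finset.card_pos] at h
  obtain ⟨i, hi⟩ := h
  exact ⟨i, by simpa using hi⟩

theorem z_apply (e : ℕ) (lam : YoungDiagram) (i : Fin (weight e lam)) :
    z e lam i = gp e (betaSet lam) (startPos e lam i) := natCast_gapCount e lam _

theorem IsIncreasing.inc {e : ℕ} (he : 0 < e) {lam : YoungDiagram} (h : IsIncreasing e 0 lam) :
    Inc e (betaSet lam) := by
  have hm : ∀ k : ℕ, ∀ i j : Fin (weight e lam), (j : ℕ) = i + k → z e lam i ≤ z e lam j := by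
    intro k
    induction k with
    | zero => intro i j hij; rw [Fin.ext (by simpa using hij : (j : ℕ) = i)]
    | succ k ih =>
      intro i j hij
      have h1 := ih i ⟨i + k, by omega⟩ rfl
      have h2 := h ⟨i + k, by omega⟩ j (by simpa [add_assoc] using hij)
      omega
  intro x y hx hy hxy
  obtain ⟨i, rfl⟩ := exists_startPos he hx
  obtain ⟨j, rfl⟩ := exists_startPos he hy
  rw [← z_apply, ← z_apply]
  have : i < j := (startPos_mono e lam).reflect_lt hxy
  exact hm (j - i) i j (by omega)

theorem Inc.z_mono {e : ℕ} (he : 0 < e) {lam : YoungDiagram} (h : Inc e (betaSet lam)) : Monotone (z e lam) := by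
  intro i j hij
  rw [z_apply, z_apply]
  rcases (startPos_mono e lam hij).lt_or_eq with h1 | h1
  · exact h _ _ (mult_startPos_pos he lam i) (mult_startPos_pos he lam j) h1
  · rw [h1]

theorem count_ofFn {n : ℕ} (f : Fin n → ℤ) (v : ℤ) :
    (List.ofFn f).count v = (Finset.univ.filter fun i => f i = v).card := by
  rw [List.ofFn_eq_map, ← Multiset.coe_count, ← Multiset.map_coe]
  rw [Multiset.count_map, Finset.card_def, Finset.filter_val]
  congr 1
  refine Multiset.filter_congr fun i _ => eq_comm

theorem count_zList {e : ℕ} (he : 0 < e) (lam : YoungDiagram) (v : ℤ) :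
    ((zList e lam).count v : ℤ) = cnt e (betaSet lam) v := by
  have hB := maya_betaSet lam
  rw [zList, count_ofFn, cnt_eq_sum hB]
  rw [Finset.card_eq_sum_card_fiberwise (f := startPos e lam) (t := activeSet e hB)
    fun i _ => (mem_activeSet hB).2 (mult_startPos_pos he lam i)]
  push_cast
  refine Finset.sum_congr rfl fun x _ => ?_
  split_ifs with h
  · rw [← card_startPos he, Finset.filter_filter]
    congr 2
    ext i
    simp only [Finset.mem_filter, Finset.mem_univ, true_and, z_apply, and_iff_right_iff_imp]
    rintro rfl; exact h
  · rw [Nat.cast_eq_zero, Finset.card_eq_zero, Finset.filter_filter, Finset.filter_eq_empty_iff]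
    rintro i - ⟨h1, rfl⟩
    exact h (by rw [← z_apply]; exact h1)

/-- Both lists are weakly increasing, so equal multiplicities suffice. -/
theorem zList_eq_reverse {e : ℕ} (he : 0 < e) {lam nu : YoungDiagram} (h1 : Inc e (betaSet lam))
    (h2 : Inc e (betaSet nu)) (h : ∀ v, cnt e (betaSet nu) v = cnt e (betaSet lam) (e - v)) :
    zList e nu = ((zList e lam).map fun v => (e : ℤ) - v).reverse := by
  have hinj : Function.Injective fun v : ℤ => (e : ℤ) - v := fun a b h => by simpa using h
  refine List.Perm.eq_of_pairwise (le := (· ≤ ·)) (fun a b _ _ => le_antisymm) ?_ ?_ ?_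
  · rw [zList, List.pairwise_ofFn]
    exact fun i j hij => h2.z_mono he hij.le
  · rw [List.pairwise_reverse, List.pairwise_map, zList, List.pairwise_ofFn]
    intro i j hij
    have := h1.z_mono he hij.le
    omega
  · rw [List.perm_iff_count]
    intro v
    rw [List.count_reverse]
    conv_rhs => rw [show v = (fun v : ℤ => (e : ℤ) - v) (e - v) by simp]
    rw [List.count_map_of_injective _ _ hinj]
    have h3 := count_zList he nu v
    have h4 := count_zList he lam (e - v)
    rw [h, ← h4] at h3
    exact_mod_cast h3

/-! ### The image of a 0-increasing regular partition -/

theorem betaSet_pred {lam : YoungDiagram} {i : ℕ}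
    (h : (lam.rowLen i : ℤ) - ((i : ℤ) + 1) - 1 ∈ betaSet lam) : lam.rowLen (i + 1) = lam.rowLen i := by
  obtain ⟨k, hk⟩ := h
  rcases lt_trichotomy k (i + 1) with h1 | rfl | h1
  · have := lam.rowLen_anti k i (by omega); omega
  · push_cast at hk; omega
  · have := lam.rowLen_anti (i + 1) k h1.le
    have := lam.rowLen_anti i (i + 1) (by omega)
    omega

theorem IsRegular.reg {e : ℕ} (he : 0 < e) {lam : YoungDiagram} (h : IsRegular e lam) : Reg e (betaSet lam) := by
  intro x hx y hy
  obtain ⟨i, hi⟩ := hx 0 le_rfl (by omega)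
  rw [sub_zero] at hi
  have hc : ∀ k : ℕ, k < e → lam.rowLen (i + k) = lam.rowLen i := by
    intro k
    induction k with
    | zero => intro _; rfl
    | succ k ih =>
      intro hk
      have h1 := ih (by omega)
      rw [← h1]
      refine betaSet_pred (i := i + k) ?_
      have := hx (k + 1) (by omega) (by omega)
      rw [h1]
      convert this using 1
      push_cast; omega
  have h0 : lam.rowLen i = 0 := by
    by_contra hne
    exact h ⟨i, hne, hc⟩
  refine ⟨(-1 - y).toNat, ?_⟩
  have : lam.rowLen (-1 - y).toNat = 0 := by
    have := lam.rowLen_anti i (-1 - y).toNat (by omega)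
    omega
  omega

theorem gp_eq_zero_iff {e : ℕ} {B : Set ℤ} {x : ℤ} : gp e B x = 0 ↔ ∀ j : ℕ, j < e → x - j ∈ B := by
  unfold gp
  rw [Finset.sum_eq_zero_iff_of_nonneg fun j _ => by have := ch_le_one B (x - j); omega]
  simp only [Finset.mem_range]
  refine forall₂_congr fun j _ => ?_
  rw [← ch_eq_one]; omega

/-- A window without gaps would force all earlier positions to be beads, and no movement could start
at its end. -/
theorem Reg.gp_pos {e : ℕ} (he : 0 < e) {B : Set ℤ} (hB : Maya B) (h : Reg e B) {x : ℤ} (hx : 0 < mult e B x) :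
    1 ≤ gp e B x := by
  by_contra hc
  have h0 : gp e B x = 0 := by have := gp_nonneg e B x; omega
  rw [gp_eq_zero_iff] at h0
  have h1 := h x fun j hj hje => by
    have := h0 j.toNat (by omega)
    rwa [show ((j.toNat : ℕ) : ℤ) = j by omega] at this
  obtain ⟨-, i, hi⟩ := (mult_pos_iff he hB x).1 hx
  have : 0 < (e : ℤ) * (i + 1) := by positivity
  exact hi (h1 _ (by omega))

/-- The last bead of the runner is again a starting position. Its window contains a bead, and its
gap count bounds the earlier ones. -/
theorem Inc.gp_lt {e : ℕ} (he : 0 < e) {B : Set ℤ} (hB : Maya B) (h : Inc e B) {x : ℤ} (hx : 0 < mult e B x) :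
    gp e B x < e := by
  obtain ⟨⟨i, hi⟩, k, hk⟩ := (mult_pos_iff he hB x).1 hx
  obtain ⟨m, hm, hmax⟩ := (nb_finite he hB x).exists_maximal ⟨i, hi⟩
  set b := x + (e : ℤ) * m with hb
  have hb' : b ∈ B := hm
  have hbm : 0 < mult e B b := by
    rw [mult_pos_iff he hB]
    refine ⟨⟨0, by simpa using hb'⟩, k + m, ?_⟩
    rwa [show b - (e : ℤ) * (((k + m : ℕ) : ℤ) + 1) = x - e * (k + 1) by rw [hb]; push_cast; ring]
  have h1 : gp e B x ≤ gp e B b := by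
    have : (0 : ℤ) ≤ e * m := by positivity
    rcases (show x ≤ b by omega).lt_or_eq with h2 | h2
    · exact h _ _ hx hbm h2
    · rw [← h2]
  have h2 : gp e B b < e := by
    unfold gp
    calc _ < ∑ j ∈ Finset.range e, (1 : ℤ) := Finset.sum_lt_sum (fun j _ => by
            have := ch_nonneg B (b - j); omega) ⟨0, Finset.mem_range.2 he, by
            simp [ch_of_mem hb']⟩
      _ = e := by simp
  omega

theorem cnt_eq_zero {e : ℕ} (he : 0 < e) {B : Set ℤ} (hB : Maya B) (h1 : Reg e B) (h2 : Inc e B) {v : ℤ}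
    (hv : v < 1 ∨ (e : ℤ) ≤ v) : cnt e B v = 0 := by
  rw [cnt_eq_sum hB]
  refine Finset.sum_eq_zero fun x hx => ?_
  rw [mem_activeSet] at hx
  have := h1.gp_pos he hB hx
  have := h2.gp_lt he hB hx
  rw [if_neg (by omega)]

theorem cnt_nonneg {e : ℕ} {B : Set ℤ} (hB : Maya B) (v : ℤ) : 0 ≤ cnt e B v := by
  rw [cnt_eq_sum hB]
  exact Finset.sum_nonneg fun x _ => by split_ifs; exacts [mult_nonneg _ _ _, le_rfl]

theorem mullineux_spec {e : ℕ} {mu nu : YoungDiagram} (h : MullineuxPair e mu nu) :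
    MullineuxPair e mu (mullineux e mu) := by
  have hex : ∃ nu, MullineuxPair e mu nu := ⟨nu, h⟩
  rw [mullineux, dif_pos hex]
  exact hex.choose_spec

/-- The image of a 0-increasing partition under the Mullineux map is 0-increasing, and its label is
obtained by reversal and complementation. -/
theorem zList_mullineux {e : ℕ} (he : 2 ≤ e) {mu : YoungDiagram} (hreg : IsRegular e mu)
    (hmu : IsIncreasing e 0 mu) :
    zList e (mullineux e mu) = ((zList e mu).map fun v => (e : ℤ) - v).reverse := by
  have he0 : 0 < e := by omega
  have hB := maya_betaSet mu
  have hr := hreg.reg he0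
  have hinc := hmu.inc he0
  rcases he.eq_or_lt with rfl | he3
  · obtain ⟨n, hn⟩ := Reg.exists_self ⟨mu, rfl⟩ hr
    have h1 := mullineux_spec ((mullineuxPair_iff le_rfl mu mu).2 ⟨n, hn⟩)
    obtain ⟨m, hm⟩ := (mullineuxPair_iff le_rfl _ _).1 h1
    have h2 := hm.eq_of_two ⟨mu, rfl⟩
    refine zList_eq_reverse he0 hinc (h2 ▸ hinc) fun v => ?_
    rw [h2]
    -- For `e = 2` the only possible gap count is one, which is fixed by `v ↦ 2 - v`.
    by_cases hv : v = 1
    · subst hv; norm_num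
    · rw [cnt_eq_zero he0 hB hr hinc (by omega), cnt_eq_zero he0 hB hr hinc (by omega)]
  · obtain ⟨B, C, n, h1, h2, h3⟩ := hasPair he3 (Finset.Ico 1 (e : ℤ)) (ℓ := cnt e (betaSet mu)) (by simp)
      (cnt_nonneg hB) (fun v hv => cnt_eq_zero he0 hB hr hinc (by
        by_contra hc
        exact hv (Finset.mem_Ico.2 (by omega)))) (isLev_lev he0 hB)
    obtain rfl := cls_unique he (isLev_lev he0 hB) h1 ⟨hB, fun _ => rfl, hinc, fun _ => rfl⟩
    obtain ⟨nu, rfl⟩ := h3.isBeta he ⟨mu, rfl⟩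
    have h4 := mullineux_spec ((mullineuxPair_iff he mu nu).2 ⟨n, h3⟩)
    obtain ⟨m, hm⟩ := (mullineuxPair_iff he _ _).1 h4
    have h5 := (h3.unique he he3 hm).2
    rw [h5] at h2
    exact zList_eq_reverse he0 hinc h2.inc h2.cnt

/-! ### The conjugate partition and hook quotients -/

theorem betaSet_transpose (lam : YoungDiagram) : betaSet lam.transpose = conj (betaSet lam) := by
  ext x
  unfold conj
  rw [Set.mem_ofPred_eq]
  constructor
  · rintro ⟨j, rfl⟩ ⟨i, hi⟩
    rw [YoungDiagram.rowLen_transpose] at hi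
    have h1 : (i, j) ∈ lam ↔ j < lam.rowLen i := YoungDiagram.mem_iff_lt_rowLen
    have h2 : (i, j) ∈ lam ↔ i < lam.colLen j := YoungDiagram.mem_iff_lt_colLen
    by_cases h : (i, j) ∈ lam
    · have := h1.1 h; have := h2.1 h; omega
    · have := mt h1.2 h; have := mt h2.2 h; omega
  · intro h
    obtain ⟨lo, hlo⟩ := (maya_betaSet lam).1
    have hex : ∃ i : ℕ, (lam.rowLen i : ℤ) - (i + 1) < -1 - x := by
      refine ⟨lam.rowLen 0 + (x + 1).toNat, ?_⟩
      have := lam.rowLen_anti 0 (lam.rowLen 0 + (x + 1).toNat) (Nat.zero_le _)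
      push_cast
      omega
    -- Row `i` is the first whose bead lies before `-1 - x`; the column belonging to `x` has length
    -- `i`.
    set i := Nat.find hex with hi
    have h1 : (lam.rowLen i : ℤ) - (i + 1) < -1 - x := Nat.find_spec hex
    refine ⟨(-1 - x + i).toNat, ?_⟩
    rw [YoungDiagram.rowLen_transpose]
    have h2 : (i, (-1 - x + i).toNat) ∉ lam := by
      rw [YoungDiagram.mem_iff_lt_rowLen]; omega
    rw [YoungDiagram.mem_iff_lt_colLen] at h2
    have h3 : i ≤ lam.colLen (-1 - x + i).toNat := by
      rcases Nat.eq_zero_or_pos i with h0 | h0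
      · omega
      · have h4 := Nat.find_min hex (show i - 1 < i by omega)
        have h5 : -1 - x ≠ (lam.rowLen (i - 1) : ℤ) - (((i - 1 : ℕ) : ℤ) + 1) := fun hc => h ⟨_, hc⟩
        have h6 : (i - 1, (-1 - x + i).toNat) ∈ lam := by
          rw [YoungDiagram.mem_iff_lt_rowLen]; omega
        rw [YoungDiagram.mem_iff_lt_colLen] at h6
        omega
    omega

theorem two_le_getElem_of_sorted {l : List ℕ} (hl : l.Pairwise (· ≥ ·)) (h : 2 ≤ l.countP (2 ≤ ·)) :
    ∃ h1 : 1 < l.length, 2 ≤ l[1] := by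
  match l, hl, h with
  | [], _, h => simp at h
  | [a], _, h => have h' := h.trans List.countP_le_length; simp at h'
  | a :: b :: t, hl, h =>
    refine ⟨by simp, ?_⟩
    by_contra hc
    simp only [List.getElem_cons_succ, List.getElem_cons_zero, not_le] at hc
    rw [List.pairwise_cons, List.pairwise_cons] at hl
    have h0 : (b :: t).countP (2 ≤ ·) = 0 := by
      rw [List.countP_eq_zero]
      intro x hx
      rcases List.mem_cons.1 hx with rfl | hx
      · simpa using hc
      · have := hl.2.1 x hx
        simp; omega
    rw [List.countP_cons, h0] at h
    split_ifs at h <;> omega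

/-- Two movements from `x` would give two beads of weight at least two on one runner, hence a second
part at least two in the quotient. -/
theorem IsHookQuotient.mult_le_one {e : ℕ} (he : 0 < e) {lam : YoungDiagram} (h : IsHookQuotient e lam) (x : ℤ) :
    mult e (betaSet lam) x ≤ 1 := by
  have hB := maya_betaSet lam
  by_contra hc
  have hnb : 2 ≤ nb e (betaSet lam) x := by have := min_le_left (nb e (betaSet lam) x) (ng e (betaSet lam) x); unfold mult at hc; omega
  have hng : 2 ≤ ng e (betaSet lam) x := by have := min_le_right (nb e (betaSet lam) x) (ng e (betaSet lam) x); unfold mult at hc; omega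
  have hcard : 1 < {i : ℕ | x + e * i ∈ betaSet lam}.ncard := by unfold nb at hnb; omega
  obtain ⟨i, hi, j, hj, hij⟩ := (Set.one_lt_ncard (nb_finite he hB x)).1 hcard
  have hx0 := Int.emod_nonneg x (show (e : ℤ) ≠ 0 by omega)
  have hx1 := Int.emod_lt_of_pos x (show (0 : ℤ) < e by omega)
  have hwt : ∀ k : ℕ, x + e * k ∈ betaSet lam →
      x + e * k ∈ ((activeBeads e lam).filter fun b => b ≡ x % e [ZMOD e]).filter fun b => 2 ≤ wt e lam b := by
    intro k hk
    have h1 := ng_add_mul_le he hB x k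
    have h2 := natCast_wt he lam (x + e * k)
    rw [Finset.mem_filter, Finset.mem_filter]
    refine ⟨⟨Finset.mem_image.2 ⟨toLex (x + e * k, x + e * k), (mem_beadMovements he).2 ⟨hk, 0, by simp, by omega⟩, rfl⟩, ?_⟩, by omega⟩
    simp [Int.ModEq]
  have h2 : 2 ≤ (quotientParts e lam (x % e)).countP (2 ≤ ·) := by
    unfold quotientParts
    rw [← Multiset.coe_countP, Multiset.sort_eq, Multiset.countP_map]
    refine le_trans ?_ (Finset.one_lt_card.2 ⟨_, hwt i hi, _, hwt j hj, fun h => hij ?_⟩)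
    · rfl
    · have := mul_left_cancel₀ (show (e : ℤ) ≠ 0 by omega) (add_left_cancel h)
      exact_mod_cast this
  obtain ⟨h3, h4⟩ := two_le_getElem_of_sorted (quotientParts_sorted e lam (x % e)).pairwise h2
  have h5 := h (x % e) hx0 hx1
  unfold IsHook eQuotient at h5
  have h6 := YoungDiagram.rowLen_ofRowLens (hw := quotientParts_sorted e lam (x % e)) ⟨1, h3⟩
  simp only at h6
  rw [h6] at h5
  exact absurd h4 (by simpa using h5)

/-! ### The modified basis vectors as functions of positions -/

/-- The modified basis vector of the bead movement starting at `x`, as a function of positions. -/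
def epsAt (e : ℕ) (B : Set ℤ) (x y : ℤ) : ℤ :=
  (if y = x then 1 else 0) - (if 2 ≤ nb e B x ∧ y = x + e then 1 else 0) -
    (if 2 ≤ ng e B x ∧ y = x - e then 1 else 0)

theorem epsAt_conj (e : ℕ) (B : Set ℤ) (x y : ℤ) :
    epsAt e (conj B) (e - 1 - x) (e - 1 - y) = epsAt e B x y := by
  unfold epsAt
  rw [nb_conj, ng_conj, show -1 - ((e : ℤ) - 1 - x) + e = x by ring]
  have h1 : (e : ℤ) - 1 - y = e - 1 - x ↔ y = x := by omega
  have h2 : (e : ℤ) - 1 - y = e - 1 - x + e ↔ y = x - e := by omega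
  have h3 : (e : ℤ) - 1 - y = e - 1 - x - e ↔ y = x + e := by omega
  rw [if_congr h1 rfl rfl, if_congr (and_congr_right' h2) rfl rfl, if_congr (and_congr_right' h3) rfl rfl]
  ring

/-! ### Sums of the modified basis vectors, when multiplicities are at most one. -/

section hooks

variable {e : ℕ} (he : 0 < e) {B : Set ℤ} (hB : Maya B) (hm : ∀ x, mult e B x ≤ 1)
include he hB hm

omit he hB in
theorem nb_or_ng (x : ℤ) : nb e B x ≤ 1 ∨ ng e B x ≤ 1 := by
  have := hm x
  unfold mult at this
  omega

/-- Besides `y` itself only its neighbours on the runner contribute: `y - e` exactly when it carries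
a bead and `y + e` exactly when `y` is a gap. Since multiplicities are at most one, the other
possibilities are not active. -/
theorem sum_epsAt {y : ℤ} (hy : 0 < mult e B y) :
    ∑ x ∈ activeSet e hB, epsAt e B x y = ch B y - ch B (y - e) := by
  have h1 := nb_rec he hB y
  have h2 := ng_rec he hB y
  have h3 := nb_rec he hB (y - e)
  have h4 := ng_rec he hB (y - e)
  rw [sub_add_cancel] at h3 h4
  have h5 := nb_or_ng hm y
  have h6 := nb_or_ng hm (y - e)
  have h7 := nb_or_ng hm (y + e)
  rw [mult_pos_iff'] at hy
  have e1 : ∑ x ∈ activeSet e hB, (if y = x then (1 : ℤ) else 0) = 1 := by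
    rw [Finset.sum_ite_eq, if_pos ((mem_activeSet hB).2 (mult_pos_iff'.2 hy))]
  have e2 : ∑ x ∈ activeSet e hB, (if 2 ≤ nb e B x ∧ y = x + e then (1 : ℤ) else 0) = ch B (y - e) := by
    have : ∀ x, (2 ≤ nb e B x ∧ y = x + e) ↔ (y - e = x ∧ 2 ≤ nb e B (y - e)) := fun x =>
      ⟨fun ⟨h, h'⟩ => ⟨by omega, by rwa [show y - e = x by omega]⟩, fun ⟨h, h'⟩ => ⟨h ▸ h', by omega⟩⟩
    simp only [this, ite_and]
    rw [Finset.sum_ite_eq]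
    simp only [mem_activeSet, mult_pos_iff']
    rcases ch_cases B (y - e) with ⟨-, h⟩ | ⟨-, h⟩
    · rw [if_pos (by omega), if_pos (by omega), h]
    · rw [h]; split_ifs <;> omega
  have e3 : ∑ x ∈ activeSet e hB, (if 2 ≤ ng e B x ∧ y = x - e then (1 : ℤ) else 0) = 1 - ch B y := by
    have : ∀ x, (2 ≤ ng e B x ∧ y = x - e) ↔ (y + e = x ∧ 2 ≤ ng e B (y + e)) := fun x =>
      ⟨fun ⟨h, h'⟩ => ⟨by omega, by rwa [show y + e = x by omega]⟩, fun ⟨h, h'⟩ => ⟨h ▸ h', by omega⟩⟩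
    simp only [this, ite_and]
    rw [Finset.sum_ite_eq]
    simp only [mem_activeSet, mult_pos_iff']
    rcases ch_cases B y with ⟨-, h⟩ | ⟨-, h⟩
    · rw [h]; split_ifs <;> omega
    · rw [if_pos (by omega), if_pos (by omega), h]; norm_num
  unfold epsAt
  rw [Finset.sum_sub_distrib, Finset.sum_sub_distrib, e1, e2, e3]
  ring

/-- A linear functional that takes the value one on all modified basis vectors. -/
theorem sum_mul_epsAt {x : ℤ} (hx : 0 < mult e B x) :
    ∑ y ∈ activeSet e hB, (nb e B y + ng e B y - 1) * epsAt e B x y = 1 := by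
  -- At an active position one of `nb`, `ng` is one. The weight `nb + ng - 1` is one where both are,
  -- and decreases by one from `x` to the neighbour that its basis vector subtracts.
  have h1 := nb_rec he hB x
  have h2 := ng_rec he hB x
  have h3 := nb_rec he hB (x - e)
  have h4 := ng_rec he hB (x - e)
  rw [sub_add_cancel] at h3 h4
  have h5 := nb_or_ng hm x
  have h6 := nb_or_ng hm (x - e)
  have h7 := nb_or_ng hm (x + e)
  have hc1 := ch_cases B x
  have hc2 := ch_cases B (x - e)
  have hx' := mult_pos_iff'.1 hx
  unfold epsAt
  simp only [mul_sub, Finset.sum_sub_distrib, mul_ite, mul_one, mul_zero]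
  have e1 : ∑ y ∈ activeSet e hB, (if y = x then nb e B y + ng e B y - 1 else 0) = nb e B x + ng e B x - 1 := by
    rw [Finset.sum_ite_eq', if_pos ((mem_activeSet hB).2 hx)]
  have e2 : ∑ y ∈ activeSet e hB, (if 2 ≤ nb e B x ∧ y = x + e then nb e B y + ng e B y - 1 else 0) =
      if 2 ≤ nb e B x then nb e B (x + e) + ng e B (x + e) - 1 else 0 := by
    by_cases h : 2 ≤ nb e B x
    · simp only [h, true_and, if_true]
      rw [Finset.sum_ite_eq', if_pos ((mem_activeSet hB).2 (mult_pos_iff'.2 (by omega)))]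
    · simp [h]
  have e3 : ∑ y ∈ activeSet e hB, (if 2 ≤ ng e B x ∧ y = x - e then nb e B y + ng e B y - 1 else 0) =
      if 2 ≤ ng e B x then nb e B (x - e) + ng e B (x - e) - 1 else 0 := by
    by_cases h : 2 ≤ ng e B x
    · simp only [h, true_and, if_true]
      rw [Finset.sum_ite_eq', if_pos ((mem_activeSet hB).2 (mult_pos_iff'.2 (by omega)))]
    · simp [h]
  rw [e1, e2, e3]
  split_ifs <;> omega

end hooks

/-! ### Vertices of the parallelotope -/

/-- The entry at position `y` of the vertex belonging to a set `S` of starting positions. -/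
def vertexAt (e : ℕ) (B : Set ℤ) (S : Finset ℤ) (y : ℤ) : ℤ := gp e B y + ∑ x ∈ S, epsAt e B x y

/-- `l` is a vertex of the parallelotope at distance `d` from the anchor. -/
def IsVertex (e : ℕ) {B : Set ℤ} (hB : Maya B) (l : List ℤ) (d : ℕ) : Prop :=
  ∃ S ⊆ activeSet e hB, l = ((activeSet e hB).sort (· ≤ ·)).map (vertexAt e B S) ∧ S.card = d

theorem sort_eq_of_pairwise {s : Finset ℤ} {l : List ℤ} (h : l.Pairwise (· < ·)) (hm : ∀ x, x ∈ l ↔ x ∈ s) :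
    s.sort (· ≤ ·) = l := by
  refine List.Perm.eq_of_pairwise (le := (· ≤ ·)) (fun a b _ _ => le_antisymm) (Finset.pairwise_sort _ _)
    (h.imp le_of_lt) ?_
  refine (List.perm_ext_iff_of_nodup (Finset.sort_nodup _ _) (h.imp ne_of_lt)).2 fun x => ?_
  rw [Finset.mem_sort, hm]

theorem mem_activeSet_conj {e : ℕ} {B : Set ℤ} (hB : Maya B) (x : ℤ) :
    (e : ℤ) - 1 - x ∈ activeSet e hB.conj ↔ x ∈ activeSet e hB := by
  rw [mem_activeSet, mem_activeSet, mult_conj, show -1 - ((e : ℤ) - 1 - x) + e = x by ring]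

theorem sort_activeSet_conj {e : ℕ} {B : Set ℤ} (hB : Maya B) :
    (activeSet e hB.conj).sort (· ≤ ·) = (((activeSet e hB).sort (· ≤ ·)).map fun x => (e : ℤ) - 1 - x).reverse := by
  refine sort_eq_of_pairwise ?_ fun x => ?_
  · rw [List.pairwise_reverse, List.pairwise_map]
    exact (Finset.sortedLT_sort _).pairwise.imp fun h => by omega
  · rw [List.mem_reverse, List.mem_map]
    constructor
    · rintro ⟨y, hy, rfl⟩
      exact (mem_activeSet_conj hB y).2 ((Finset.mem_sort _).1 hy)
    · intro hx
      refine ⟨e - 1 - x, (Finset.mem_sort _).2 ((mem_activeSet_conj hB _).1 ?_), by ring⟩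
      rwa [show (e : ℤ) - 1 - (e - 1 - x) = x by ring]

/-- The sums over `S` and over its complement add up to `sum_epsAt`, which is the difference between
the gap counts at `y - 1` and `y`; conjugation uses the former, so complementary sets give
complementary entries. -/
theorem vertexAt_conj {e : ℕ} (he : 0 < e) {B : Set ℤ} (hB : Maya B) (hm : ∀ x, mult e B x ≤ 1) {S : Finset ℤ}
    (hS : S ⊆ activeSet e hB) {y : ℤ} (hy : 0 < mult e B y) :
    vertexAt e (conj B) ((activeSet e hB \ S).image fun x => (e : ℤ) - 1 - x) (e - 1 - y) =
      e - vertexAt e B S y := by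
  unfold vertexAt
  rw [Finset.sum_image fun a _ b _ h => by simpa using h]
  simp only [epsAt_conj]
  have h1 := Finset.sum_sdiff hS (f := fun x => epsAt e B x y)
  have h2 := sum_epsAt he hB hm hy
  rw [gp_conj, show -1 - ((e : ℤ) - 1 - y) + e - 1 = y - 1 by ring]
  have h3 := gp_sub e B y
  linarith

theorem IsVertex.conj {e : ℕ} (he : 0 < e) {B : Set ℤ} {hB : Maya B} (hm : ∀ x, mult e B x ≤ 1) {l : List ℤ} {d : ℕ}
    (h : IsVertex e hB l d) :
    IsVertex e hB.conj (l.map fun v => (e : ℤ) - v).reverse ((activeSet e hB).card - d) := by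
  obtain ⟨S, hS, rfl, rfl⟩ := h
  refine ⟨(activeSet e hB \ S).image fun x => (e : ℤ) - 1 - x, fun x hx => ?_, ?_, ?_⟩
  · obtain ⟨y, hy, rfl⟩ := Finset.mem_image.1 hx
    exact (mem_activeSet_conj hB y).2 (Finset.mem_sdiff.1 hy).1
  · rw [sort_activeSet_conj, List.map_reverse, List.map_map, List.map_map]
    congr 1
    refine List.map_congr_left fun y hy => ?_
    rw [Finset.mem_sort, mem_activeSet] at hy
    exact (vertexAt_conj he hB hm hS hy).symm
  · rw [Finset.card_image_of_injective _ fun a b h => by simpa using h, Finset.card_sdiff_of_subset hS]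

/-- Applying the functional of `sum_mul_epsAt` to a vertex recovers the number of basis vectors
used. -/
theorem IsVertex.unique {e : ℕ} (he : 0 < e) {B : Set ℤ} {hB : Maya B} (hm : ∀ x, mult e B x ≤ 1) {l : List ℤ} {c d : ℕ}
    (h : IsVertex e hB l c) (h' : IsVertex e hB l d) : c = d := by
  have key : ∀ S ⊆ activeSet e hB, ∑ y ∈ activeSet e hB, (nb e B y + ng e B y - 1) * vertexAt e B S y =
      ∑ y ∈ activeSet e hB, (nb e B y + ng e B y - 1) * gp e B y + S.card := by
    intro S hS
    unfold vertexAt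
    simp only [mul_add, Finset.sum_add_distrib, Finset.mul_sum]
    rw [Finset.sum_comm, Finset.sum_congr rfl fun x hx => sum_mul_epsAt he hB hm ((mem_activeSet hB).1 (hS hx))]
    simp
  obtain ⟨S, hS, rfl, rfl⟩ := h
  obtain ⟨T, hT, h, rfl⟩ := h'
  rw [List.map_inj_left] at h
  have h1 := key S hS
  have h2 := key T hT
  rw [Finset.sum_congr rfl fun y hy => by rw [h y ((Finset.mem_sort _).2 hy)]] at h1
  omega

/-! ### The modified basis vectors of a hook-quotient partition -/

theorem exists_eq_add_mul {e : ℕ} (he : 0 < e) {x y : ℤ} (h : x ≤ y) (h' : x ≡ y [ZMOD e]) :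
    ∃ t : ℕ, y = x + e * t := by
  obtain ⟨c, hc⟩ := h'.dvd
  have : 0 ≤ c := by
    by_contra hn
    have : (e : ℤ) * c < 0 := mul_neg_of_pos_of_neg (by positivity) (by omega)
    omega
  exact ⟨c.toNat, by rw [Int.toNat_of_nonneg this]; omega⟩

theorem modEq_add_self (e : ℕ) (x : ℤ) : x + e ≡ x [ZMOD e] := by simp [Int.ModEq]

theorem modEq_sub_self (e : ℕ) (x : ℤ) : x - e ≡ x [ZMOD e] := by simp [Int.ModEq]

theorem eq_of_nb_eq_one {e : ℕ} (he : 0 < e) {B : Set ℤ} (hB : Maya B) {b c : ℤ} (hb : b ∈ B) (hc : c ∈ B)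
    (h : b ≡ c [ZMOD e]) (h1 : nb e B b = 1) (h2 : nb e B c = 1) : b = c := by
  have key : ∀ b c : ℤ, b ∈ B → b ≡ c [ZMOD e] → nb e B b = 1 → nb e B c = 1 → b ≤ c → b = c := by
    intro b c hb h h1 h2 hle
    obtain ⟨t, rfl⟩ := exists_eq_add_mul he hle h
    rcases t with _ | t
    · simp
    · have h3 := nb_rec he hB b
      have h4 := nb_add_mul_le he hB (b + e) t
      rw [show b + (e : ℤ) + e * t = b + e * ((t + 1 : ℕ) : ℤ) by push_cast; ring] at h4
      rw [ch_of_mem hb] at h3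
      omega
  rcases le_total b c with hle | hle
  · exact key b c hb h h1 h2 hle
  · exact (key c b hc h.symm h2 h1 hle).symm

/-! ### Pivots and neighbours in terms of starting positions. -/

section hooks

variable {e : ℕ} (he : 0 < e) {lam : YoungDiagram} (hm : ∀ x, mult e (betaSet lam) x ≤ 1)
include he hm

theorem startPos_strictMono : StrictMono (startPos e lam) := by
  refine (startPos_mono e lam).strictMono_of_injective fun i j hij => ?_
  have h1 := card_startPos he lam (startPos e lam j)
  have h2 := hm (startPos e lam j)
  rw [← h1] at h2
  exact Finset.card_le_one.1 (by exact_mod_cast h2) i (by simpa using hij) j (by simp)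

theorem sort_activeSet :
    (activeSet e (maya_betaSet lam)).sort (· ≤ ·) = List.ofFn (startPos e lam) := by
  refine sort_eq_of_pairwise ?_ fun x => ?_
  · rw [List.pairwise_ofFn]; exact fun i j h => startPos_strictMono he hm h
  · rw [List.mem_ofFn, mem_activeSet]
    exact ⟨fun ⟨i, hi⟩ => hi ▸ mult_startPos_pos he lam i, fun h => exists_startPos he h⟩

theorem card_activeSet : (activeSet e (maya_betaSet lam)).card = weight e lam := by
  rw [← Finset.length_sort (· ≤ ·), sort_activeSet he hm, List.length_ofFn]

omit hm in
theorem bead_spec (i : Fin (weight e lam)) : bead e lam i ∈ betaSet lam ∧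
    ∃ k : ℕ, bead e lam i = startPos e lam i + e * k ∧
      nb e (betaSet lam) (startPos e lam i) - nb e (betaSet lam) (bead e lam i) <
        ng e (betaSet lam) (startPos e lam i) :=
  (mem_beadMovements he).1 (movement_mem e lam i)

/-- Either there is only one bead at or below the starting position, or only one gap above it and
the movement belongs to the first such bead. In both cases no bead is passed on the way. -/
theorem nb_bead (i : Fin (weight e lam)) :
    nb e (betaSet lam) (bead e lam i) = nb e (betaSet lam) (startPos e lam i) := by
  obtain ⟨h1, k, h2, h3⟩ := bead_spec he i
  have h4 := nb_add_mul_le he (maya_betaSet lam) (startPos e lam i) k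
  rw [← h2] at h4
  have h5 := nb_rec he (maya_betaSet lam) (bead e lam i)
  rw [ch_of_mem h1] at h5
  have h6 := nb_nonneg e (betaSet lam) (bead e lam i + e)
  have h7 := nb_or_ng hm (startPos e lam i)
  omega

omit hm in
theorem startPos_active (i : Fin (weight e lam)) :
    0 < nb e (betaSet lam) (startPos e lam i) ∧ 0 < ng e (betaSet lam) (startPos e lam i) :=
  mult_pos_iff'.1 (mult_startPos_pos he lam i)

omit hm in
theorem exists_startPos_add {i : Fin (weight e lam)} (h : 2 ≤ nb e (betaSet lam) (startPos e lam i)) :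
    ∃ k, startPos e lam k = startPos e lam i + e := by
  have h1 := nb_rec he (maya_betaSet lam) (startPos e lam i)
  have h2 := ng_rec he (maya_betaSet lam) (startPos e lam i)
  have h3 := startPos_active he i
  have h4 := ch_le_one (betaSet lam) (startPos e lam i)
  exact exists_startPos he (mult_pos_iff'.2 (by omega))

omit hm in
theorem exists_startPos_sub {i : Fin (weight e lam)} (h : 2 ≤ ng e (betaSet lam) (startPos e lam i)) :
    ∃ k, startPos e lam k = startPos e lam i - e := by
  have h1 := nb_rec he (maya_betaSet lam) (startPos e lam i - e)
  have h2 := ng_rec he (maya_betaSet lam) (startPos e lam i - e)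
  rw [sub_add_cancel] at h1 h2
  have h3 := startPos_active he i
  have h4 := ch_nonneg (betaSet lam) (startPos e lam i - e)
  exact exists_startPos he (mult_pos_iff'.2 (by omega))

omit he hm in
theorem mem_runnerIdx {i k : Fin (weight e lam)} :
    k ∈ runnerIdx e lam i ↔ startPos e lam k ≡ startPos e lam i [ZMOD e] := by simp [runnerIdx]

/-- The last movement on a runner has a single bead at or below its start, and that bead is then the
lowest of the runner. -/
theorem mem_lastBeadIdx {i k : Fin (weight e lam)} : k ∈ lastBeadIdx e lam i ↔
    startPos e lam k ≡ startPos e lam i [ZMOD e] ∧ nb e (betaSet lam) (startPos e lam k) = 1 := by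
  have hB := maya_betaSet lam
  set j := lastIdx e lam i with hj
  have h1 : startPos e lam j ≡ startPos e lam i [ZMOD e] :=
    mem_runnerIdx.1 (Finset.max'_mem _ (runnerIdx_nonempty e lam i))
  have h2 : nb e (betaSet lam) (startPos e lam j) = 1 := by
    by_contra hc
    have h3 := startPos_active he j
    obtain ⟨k, hk⟩ := exists_startPos_add he (i := j) (by omega)
    have h4 : k ≤ j := Finset.le_max' _ _ (mem_runnerIdx.2 (by
      rw [hk]; exact (modEq_add_self e _).trans h1))
    have := startPos_mono e lam h4
    omega
  rw [lastBeadIdx, Finset.mem_filter, mem_runnerIdx, ← hj]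
  refine and_congr_right fun h => ?_
  constructor
  · intro h3
    rw [← nb_bead he hm, h3, nb_bead he hm, h2]
  · intro h3
    obtain ⟨h4, m, h5, -⟩ := bead_spec he k
    obtain ⟨h6, n, h7, -⟩ := bead_spec he j
    refine eq_of_nb_eq_one he hB h4 h6 ?_ (by rw [nb_bead he hm, h3]) (by rw [nb_bead he hm, h2])
    rw [h5, h7]
    have := h.trans h1.symm
    simpa [Int.ModEq] using this

/-- The pivot is the first starting position with a single bead at or below it, and `nb` decreases
along the runner. -/
theorem lt_pivot_iff (i : Fin (weight e lam)) :
    i < pivot e lam i ↔ 2 ≤ nb e (betaSet lam) (startPos e lam i) := by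
  have hp := (mem_lastBeadIdx he hm).1 (Finset.min'_mem _ (lastBeadIdx_nonempty e lam i))
  constructor
  · intro h
    by_contra hc
    have h1 := startPos_active he i
    exact absurd h (not_lt.2 (Finset.min'_le _ _ ((mem_lastBeadIdx he hm).2 ⟨rfl, by omega⟩)))
  · intro h
    by_contra hc
    obtain ⟨t, ht⟩ := exists_eq_add_mul he (startPos_mono e lam (not_lt.1 hc)) hp.1
    have := nb_add_mul_le he (maya_betaSet lam) (startPos e lam (pivot e lam i)) t
    rw [← ht] at this
    have h2 : nb e (betaSet lam) (startPos e lam (pivot e lam i)) = 1 := hp.2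
    omega

/-- After the pivot `nb` stays one while the level falls, so `ng` grows. Conversely, two gaps above
make `x - e` active with a single bead below, so the pivot came earlier. -/
theorem pivot_lt_iff (i : Fin (weight e lam)) :
    pivot e lam i < i ↔ 2 ≤ ng e (betaSet lam) (startPos e lam i) := by
  have hB := maya_betaSet lam
  have hp : _ ∧ nb e (betaSet lam) (startPos e lam (pivot e lam i)) = 1 :=
    (mem_lastBeadIdx he hm).1 (Finset.min'_mem _ (lastBeadIdx_nonempty e lam i))
  have h0 := startPos_active he i
  constructor
  · intro h
    have h1 := mt (lt_pivot_iff he hm i).2 (not_lt.2 h.le)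
    have h2 := startPos_strictMono he hm h
    obtain ⟨t, ht⟩ := exists_eq_add_mul he h2.le hp.1
    have h3 := ng_add_mul_le he hB (startPos e lam (pivot e lam i)) t
    have h4 := lev_add_mul he hB (startPos e lam (pivot e lam i)) t
    have h5 := startPos_active he (pivot e lam i)
    rw [← ht] at h3 h4
    have h6 : t ≠ 0 := by rintro rfl; simp at ht; omega
    unfold lev at h4
    omega
  · intro h
    have h1 := nb_or_ng hm (startPos e lam i)
    have h2 := mt (lt_pivot_iff he hm i).1 (by omega)
    refine lt_of_le_of_ne (not_lt.1 h2) fun heq => ?_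
    have h3 := nb_rec he hB (startPos e lam i - e)
    have h4 := ng_rec he hB (startPos e lam i - e)
    rw [sub_add_cancel] at h3 h4
    have h5 := nb_or_ng hm (startPos e lam i - e)
    have h6 := ch_cases (betaSet lam) (startPos e lam i - e)
    obtain ⟨k, hk⟩ := exists_startPos_sub he h
    have h7 : pivot e lam i ≤ k := Finset.min'_le _ _ ((mem_lastBeadIdx he hm).2
      ⟨by rw [hk]; exact modEq_sub_self e _, by rw [hk]; omega⟩)
    have h8 := startPos_mono e lam h7
    rw [heq] at h8
    omega

/-- Before the pivot the starting positions on a runner have no interruptions, so the next index is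
one row further down. -/
theorem startPos_nextIdx {i : Fin (weight e lam)} (h : i < pivot e lam i) :
    startPos e lam (nextIdx e lam i h) = startPos e lam i + e := by
  obtain ⟨k, hk⟩ := exists_startPos_add he ((lt_pivot_iff he hm i).1 h)
  have h1 : i < k := (startPos_mono e lam).reflect_lt (by omega)
  have h2 : nextIdx e lam i h ≤ k := Finset.min'_le _ _ (Finset.mem_filter.2
    ⟨mem_runnerIdx.2 (by rw [hk]; exact modEq_add_self e _), h1⟩)
  have h3 : nextIdx e lam i h ∈ (runnerIdx e lam i).filter fun k => i < k := Finset.min'_mem _ _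
  rw [Finset.mem_filter, mem_runnerIdx] at h3
  have h4 := startPos_strictMono he hm h3.2
  have h5 := startPos_mono e lam h2
  obtain ⟨t, ht⟩ := exists_eq_add_mul he h4.le h3.1.symm
  rcases t with _ | t
  · simp at ht; omega
  · have : (0 : ℤ) ≤ e * t := by positivity
    push_cast at ht
    rw [mul_add, mul_one] at ht
    omega

theorem startPos_prevIdx {i : Fin (weight e lam)} (h : pivot e lam i < i) :
    startPos e lam (prevIdx e lam i h) = startPos e lam i - e := by
  obtain ⟨k, hk⟩ := exists_startPos_sub he ((pivot_lt_iff he hm i).1 h)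
  have h1 : k < i := (startPos_mono e lam).reflect_lt (by omega)
  have h2 : k ≤ prevIdx e lam i h := Finset.le_max' ((runnerIdx e lam i).filter fun k => k < i) k (Finset.mem_filter.2
    ⟨mem_runnerIdx.2 (by rw [hk]; exact modEq_sub_self e _), h1⟩)
  have h3 : prevIdx e lam i h ∈ (runnerIdx e lam i).filter fun k => k < i := Finset.max'_mem _ _
  rw [Finset.mem_filter, mem_runnerIdx] at h3
  have h4 := startPos_strictMono he hm h3.2
  have h5 := startPos_mono e lam h2
  obtain ⟨t, ht⟩ := exists_eq_add_mul he h4.le h3.1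
  rcases t with _ | t
  · simp at ht; omega
  · have : (0 : ℤ) ≤ e * t := by positivity
    push_cast at ht
    rw [mul_add, mul_one] at ht
    omega

theorem eps_apply (i k : Fin (weight e lam)) :
    eps e lam i k = epsAt e (betaSet lam) (startPos e lam i) (startPos e lam k) := by
  have hq : ∀ j, k = j ↔ startPos e lam k = startPos e lam j := fun j =>
    (startPos_strictMono he hm).injective.eq_iff.symm
  have h0 := nb_or_ng hm (startPos e lam i)
  unfold eps epsAt
  by_cases h1 : i < pivot e lam i
  · have h2 := (lt_pivot_iff he hm i).1 h1
    rw [dif_pos h1]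
    simp only [Pi.sub_apply, Pi.single_apply, hq, startPos_nextIdx he hm]
    simp [h2, show ¬ 2 ≤ ng e (betaSet lam) (startPos e lam i) by omega]
  rw [dif_neg h1]
  by_cases h2 : pivot e lam i < i
  · have h3 := (pivot_lt_iff he hm i).1 h2
    rw [dif_pos h2]
    simp only [Pi.sub_apply, Pi.single_apply, hq, startPos_prevIdx he hm]
    simp [h3, show ¬ 2 ≤ nb e (betaSet lam) (startPos e lam i) by omega]
  · rw [dif_neg h2]
    rw [lt_pivot_iff he hm] at h1
    rw [pivot_lt_iff he hm] at h2
    simp only [Pi.single_apply, hq]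
    simp [h1, h2]

theorem vertex_eq (G : Finset (Fin (weight e lam))) :
    vertex e lam G = ((activeSet e (maya_betaSet lam)).sort (· ≤ ·)).map
      (vertexAt e (betaSet lam) (G.image (startPos e lam))) := by
  rw [sort_activeSet he hm, List.map_ofFn, vertex]
  congr 1
  ext k
  simp only [Pi.add_apply, Finset.sum_apply, Function.comp_apply, vertexAt, z_apply, eps_apply he hm]
  rw [Finset.sum_image fun a _ b _ h => (startPos_strictMono he hm).injective h]

theorem isVertex_iff {l : List ℤ} {d : ℕ} :
    IsVertex e (maya_betaSet lam) l d ↔ ∃ G, vertex e lam G = l ∧ G.card = d := by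
  have hinj := (startPos_strictMono he hm).injective
  constructor
  · rintro ⟨S, hS, rfl, rfl⟩
    have h1 : (Finset.univ.filter fun i => startPos e lam i ∈ S).image (startPos e lam) = S := by
      ext x
      simp only [Finset.mem_image, Finset.mem_filter, Finset.mem_univ, true_and]
      constructor
      · rintro ⟨i, hi, rfl⟩; exact hi
      · intro hx
        obtain ⟨i, rfl⟩ := exists_startPos he ((mem_activeSet _).1 (hS hx))
        exact ⟨i, hx, rfl⟩
    refine ⟨Finset.univ.filter fun i => startPos e lam i ∈ S, ?_, ?_⟩
    · rw [vertex_eq he hm, h1]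
    · rw [← Finset.card_image_of_injective _ hinj, h1]
  · rintro ⟨G, rfl, rfl⟩
    refine ⟨G.image (startPos e lam), fun x hx => ?_, vertex_eq he hm G, Finset.card_image_of_injective _ hinj⟩
    obtain ⟨i, -, rfl⟩ := Finset.mem_image.1 hx
    exact (mem_activeSet _).2 (mult_startPos_pos he lam i)

theorem mem_parallelotope_iff {l : List ℤ} :
    l ∈ parallelotope e lam ↔ ∃ d, IsVertex e (maya_betaSet lam) l d := by
  simp only [isVertex_iff he hm]
  exact ⟨fun ⟨G, h⟩ => ⟨_, G, h, rfl⟩, fun ⟨_, G, h, _⟩ => ⟨G, h⟩⟩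

theorem IsVertex.dist_eq {mu : YoungDiagram} {d : ℕ} (h : IsVertex e (maya_betaSet lam) (zList e mu) d) :
    dist e lam mu = d := by
  obtain ⟨G, h1, h2⟩ := (isVertex_iff he hm).1 h
  have hex : ∃ G, vertex e lam G = zList e mu := ⟨G, h1⟩
  rw [dist, dif_pos hex]
  exact ((isVertex_iff he hm).2 ⟨_, hex.choose_spec, rfl⟩).unique he hm h

theorem IsVertex.transpose {l : List ℤ} {d : ℕ} (h : IsVertex e (maya_betaSet lam) l d) :
    IsVertex e (maya_betaSet lam.transpose) (l.map fun v => (e : ℤ) - v).reverse (weight e lam - d) := by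
  have h1 := h.conj he hm
  rw [card_activeSet he hm] at h1
  have h2 : ∀ {C : Set ℤ} (hC : Maya C), C = Abacus.conj (betaSet lam) →
      IsVertex e hC (l.map fun v => (e : ℤ) - v).reverse (weight e lam - d) := by
    rintro C hC rfl; exact h1
  exact h2 _ (betaSet_transpose lam)

omit he in
theorem mult_transpose_le (x : ℤ) : mult e (betaSet lam.transpose) x ≤ 1 := by
  rw [betaSet_transpose, mult_conj]; exact hm _

end hooks

end Abacus

end

theorem corollary9p4 (e : ℕ) (he : 2 ≤ e) (w : ℕ) (lam mu : YoungDiagram)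
    (hlam : Abacus.IsHookQuotient e lam)
    (hreg : Abacus.IsRegular e mu) (hmu : Abacus.IsIncreasing e 0 mu)
    (hblock : Abacus.SameBlock e lam mu) (hw : Abacus.weight e lam = w) :
    (Abacus.zList e mu ∈ Abacus.parallelotope e lam ↔
      Abacus.zList e (Abacus.mullineux e mu) ∈ Abacus.parallelotope e lam.transpose) ∧
    (Abacus.zList e mu ∈ Abacus.parallelotope e lam →
      Abacus.dist e lam mu + Abacus.dist e lam.transpose (Abacus.mullineux e mu) = w) := by
  have he0 : 0 < e := by omega
  have hm := hlam.mult_le_one he0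
  have hm' := Abacus.mult_transpose_le hm
  have hz := Abacus.zList_mullineux he hreg hmu
  -- Reversal with `v ↦ e - v` is an involution, so the converse follows from the same transport
  -- applied to the conjugate.
  have hzz : Abacus.zList e mu =
      ((Abacus.zList e (Abacus.mullineux e mu)).map fun v => (e : ℤ) - v).reverse := by
    rw [hz, List.map_reverse, List.reverse_reverse, List.map_map]
    simp
  rw [Abacus.mem_parallelotope_iff he0 hm, Abacus.mem_parallelotope_iff he0 hm']
  refine ⟨⟨fun ⟨d, h⟩ => ⟨_, hz ▸ h.transpose he0 hm⟩, fun ⟨d, h⟩ => ?_⟩, fun ⟨d, h⟩ => ?_⟩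
  · have h1 := h.transpose he0 hm'
    rw [← hzz] at h1
    exact ⟨_, by simpa only [YoungDiagram.transpose_transpose] using h1⟩
  · have h1 := h.transpose he0 hm
    rw [← hz] at h1
    rw [h.dist_eq he0 hm, h1.dist_eq he0 hm']
    -- The dual distance is a truncated difference, so the bound `d ≤ w` is still needed.
    obtain ⟨S, hS, -, rfl⟩ := h
    have h2 := Finset.card_le_card hS
    rw [Abacus.card_activeSet he0 hm] at h2
    omega
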